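/- Let $k$ be a field and let $H$ be a finite dimensional quasi-Hopf algebra over $k$, with comultiplication $\Delta$, $\Delta(h)=\sum h_1\otimes h_2$, counit $\varepsilon$, reassociator $\Phi$, $\Phi^{-1}=\sum x^1\otimes x^2\otimes x^3$, and antipode $(S,\alpha,\beta)$, where $S$ is an anti-automorphism of the algebra $H$. Let $(\mathfrak A,\rho,\Phi_\rho)$ be a right $H$-comodule algebra: $\mathfrak A$ is a unital associative algebra, $\rho:\mathfrak A\to\mathfrak A\otimes H$, $\rho(\mathfrak a)=\sum\mathfrak a_{<0>}\otimes\mathfrak a_{<1>}$, is an algebra map and $\Phi_\rho\in\mathfrak A\otimes H\otimes H$ is invertible, with $\Phi_\rho^{-1}=\sum\tilde x^1\otimes\tilde x^2\otimes\tilde x^3$, such that $$\Phi_\rho(\rho\otimes id)(\rho(\mathfrak a))=(id\otimes\Delta)(\rho(\mathfrak a))\Phi_\rho,$$ $$(1_{\mathfrak A}\otimes\Phi)(id\otimes\Delta\otimes id)(\Phi_\rho)(\Phi_\rho\otimes1_H)=(id\otimes id\otimes\Delta)(\Phi_\rho)(\rho\otimes id\otimes id)(\Phi_\rho),$$ $(id\otimes\varepsilon)\circ\rho=id$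 and $(id\otimes\varepsilon\otimes id)(\Phi_\rho)=(id\otimes id\otimes\varepsilon)(\Phi_\rho)=1_{\mathfrak A}\otimes1_H$. A two-sided $(\mathfrak A,H)$-Hopf module is a $k$-vector space $M$ with commuting left $H$-action $\succ$ and right $\mathfrak A$-action $\prec$ and a linear map $\rho_M:M\to M\otimes H$, $\rho_M(m)=\sum m_{(0)}\otimes m_{(1)}$, such that $(id\otimes\varepsilon)\circ\rho_M=id$, $\Phi\cdot(\rho_M\otimes id)(\rho_M(m))=(id\otimes\Delta)(\rho_M(m))\cdot\Phi_\rho$, $\rho_M(h\succ m)=\sum h_1\succ m_{(0)}\otimes h_2m_{(1)}$ and $\rho_M(m\prec\mathfrak a)=\sum m_{(0)}\prec\mathfrak a_{<0>}\otimes m_{(1)}\mathfrak a_{<1>}$. With the left $H$-linear, right $\mathfrak A$-linear and right $H$-colinear maps these form the category ${}_H\mathcal M_{\mathfrak A}^H$. The quasi-smash product $\mathfrak A\,\overline{\#}\,H^*$ is the left $H$-module algebra (algebra in the monoidal category of left $H$-modules) on the space $\mathfrak A\otimes H^*$ with product $$(\mathfrak a\,\overline{\#}\,\varphi)(\mathfrak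 a'\,\overline{\#}\,\psi)=\sum\mathfrak a\mathfrak a'_{<0>}\tilde x^1\,\overline{\#}\,(\varphi\leftharpoonup\mathfrak a'_{<1>}\tilde x^2)(\psi\leftharpoonup\tilde x^3),$$ unit $1_{\mathfrak A}\,\overline{\#}\,\varepsilon$ and action $h\cdot(\mathfrak a\,\overline{\#}\,\varphi)=\mathfrak a\,\overline{\#}\,(h\rightharpoonup\varphi)$; here $H^*$ carries the convolution product and $(\varphi\leftharpoonup h)(h')=\varphi(hh')$, $(h\rightharpoonup\varphi)(h')=\varphi(h'h)$. For a left $H$-module algebra $A$, the smash product $A\#H$ is the unital associative algebra on $A\otimes H$ with unit $1_A\#1_H$ and product $(a\#h)(a'\#h')=\sum(x^1\cdot a)(x^2h_1\cdot a')\#x^3h_2h'$. Then the category ${}_H\mathcal M_{\mathfrak A}^H$ is isomorphic to the category $\mathcal M_{(\mathfrak A\,\overline{\#}\,H^*)\#H}$ of right modules over the algebra $(\mathfrak A\,\overline{\#}\,H^*)\#H$, by an isomorphism of categories that commutes with the forgetful functors to $k$-vector spaces. -/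

import Mathlib

universe w u₁ u₂ u₃

open CategoryTheory TensorProduct MulOpposite

namespace QuasiHopf

noncomputable section

/-! Operators and algebra maps on iterated tensor products.  Threefold and fourfold tensor products
are bracketed to the right. -/

/-- The linear map `A ⊗ B → End (M ⊗ N)` that lets `a ⊗ b` operate as `f a ⊗ g b`. -/
def tensorOp {k A B M N : Type*} [Field k] [AddCommGroup A] [Module k A] [AddCommGroup B]
    [Module k B] [AddCommGroup M] [Module k M] [AddCommGroup N] [Module k N]
    (f : A →ₗ[k] Module.End k M) (g : B →ₗ[k] Module.End k N) :
    A ⊗[k] B →ₗ[k] Module.End k (M ⊗[k] N) :=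
  TensorProduct.homTensorHomMap (RingHom.id k) M N M N ∘ₗ TensorProduct.map f g

@[simp]
theorem tensorOp_tmul {k A B M N : Type*} [Field k] [AddCommGroup A] [Module k A] [AddCommGroup B]
    [Module k B] [AddCommGroup M] [Module k M] [AddCommGroup N] [Module k N]
    (f : A →ₗ[k] Module.End k M) (g : B →ₗ[k] Module.End k N) (a : A) (b : B) (m : M) (n : N) :
    tensorOp f g (a ⊗ₜ b) (m ⊗ₜ n) = f a m ⊗ₜ[k] g b n := rfl

theorem tensor_mul_add {k A B : Type*} [Field k] [Ring A] [Algebra k A] [Ring B] [Algebra k B]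
    (x y z : A ⊗[k] B) : x * (y + z) = x * y + x * z := mul_add x y z

theorem tensor_add_mul {k A B : Type*} [Field k] [Ring A] [Algebra k A] [Ring B] [Algebra k B]
    (x y z : A ⊗[k] B) : (x + y) * z = x * z + y * z := add_mul x y z

theorem tensor_mul_zero {k A B : Type*} [Field k] [Ring A] [Algebra k A] [Ring B] [Algebra k B]
    (x : A ⊗[k] B) : x * 0 = 0 := mul_zero x

theorem tensor_zero_mul {k A B : Type*} [Field k] [Ring A] [Algebra k A] [Ring B] [Algebra k B]
    (x : A ⊗[k] B) : 0 * x = 0 := zero_mul x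

theorem tensor_mul_smul {k A B : Type*} [Field k] [Ring A] [Algebra k A] [Ring B] [Algebra k B]
    (c : k) (x y : A ⊗[k] B) : x * c • y = c • (x * y) := mul_smul_comm c x y

theorem tensor_smul_mul {k A B : Type*} [Field k] [Ring A] [Algebra k A] [Ring B] [Algebra k B]
    (c : k) (x y : A ⊗[k] B) : c • x * y = c • (x * y) := smul_mul_assoc c x y

theorem tensor_mul_assoc {k A B : Type*} [Field k] [Ring A] [Algebra k A] [Ring B] [Algebra k B]
    (x y z : A ⊗[k] B) : x * y * z = x * (y * z) := mul_assoc x y z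

theorem cocycle_solve {M : Type*} [Monoid M] {u v w s t u' v' s' t' : M}
    (h : u * v * w = s * t) (hu : u' * u = 1) (hv : v' * v = 1) (hs : s * s' = 1)
    (ht : t * t' = 1) : w * t' * s' * u = v' := by
  have hw : w = v' * u' * (s * t) := by
    rw [← h, show v' * u' * (u * v * w) = v' * (u' * u) * v * w by simp only [mul_assoc], hu,
      mul_one, hv, one_mul]
  rw [hw, show v' * u' * (s * t) * t' * s' * u = v' * u' * (s * (t * t') * s') * u by
    simp only [mul_assoc], ht, mul_one, hs, mul_one, mul_assoc, hu, mul_one]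

theorem cocycle_solve' {M : Type*} [Monoid M] {u v w s t u' v' w' s' t' : M}
    (h : u * v * w = s * t) (hu : u' * u = 1) (hv : v' * v = 1) (hw : w' * w = 1)
    (hs : s * s' = 1) (ht : t * t' = 1) : w' * v' * u' = t' * s' := by
  have hr : w' * v' * u' * (u * v * w) = 1 := by
    rw [show w' * v' * u' * (u * v * w) = w' * (v' * (u' * u) * v) * w by
      simp only [mul_assoc], hu, mul_one, hv, mul_one, hw]
  have hl : s * t * (t' * s') = 1 := by
    rw [show s * t * (t' * s') = s * (t * t') * s' by simp only [mul_assoc], ht, mul_one, hs]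
  calc w' * v' * u' = w' * v' * u' * (s * t * (t' * s')) := by rw [hl, mul_one]
    _ = t' * s' := by rw [← h, ← mul_assoc, hr, one_mul]

theorem map_inv_mul {k A B : Type*} [Field k] [Ring A] [Algebra k A] [Ring B] [Algebra k B]
    (f : A →ₐ[k] B) (x : Aˣ) : f ↑x⁻¹ * f ↑x = 1 := by
  rw [← map_mul, Units.inv_mul, map_one]

theorem map_mul_inv {k A B : Type*} [Field k] [Ring A] [Algebra k A] [Ring B] [Algebra k B]
    (f : A →ₐ[k] B) (x : Aˣ) : f ↑x * f ↑x⁻¹ = 1 := by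
  rw [← map_mul, Units.mul_inv, map_one]

theorem map_inv_eq_one {k A B : Type*} [Field k] [Ring A] [Algebra k A] [Ring B] [Algebra k B]
    (f : A →ₐ[k] B) (x : Aˣ) (h : f ↑x = 1) : f ↑x⁻¹ = 1 := by
  have := map_inv_mul f x
  rwa [h, mul_one] at this

/-- For `f : A → B ⊗ C`, the algebra map `f ⊗ id : A ⊗ D → B ⊗ (C ⊗ D)`. -/
def splitLeft {k A B C : Type*} (D : Type*) [Field k] [Ring A] [Algebra k A] [Ring B] [Algebra k B]
    [Ring C] [Algebra k C] [Ring D] [Algebra k D] (f : A →ₐ[k] B ⊗[k] C) :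
    A ⊗[k] D →ₐ[k] B ⊗[k] (C ⊗[k] D) :=
  (Algebra.TensorProduct.assoc k k k B C D).toAlgHom.comp
    (Algebra.TensorProduct.map f (AlgHom.id k D))

/-- The algebra map `id ⊗ g : A ⊗ B → A ⊗ C`. -/
def onRight {k B C : Type*} (A : Type*) [Field k] [Ring A] [Algebra k A] [Ring B] [Algebra k B]
    [Ring C] [Algebra k C] (g : B →ₐ[k] C) : A ⊗[k] B →ₐ[k] A ⊗[k] C :=
  Algebra.TensorProduct.map (AlgHom.id k A) g

/-- The algebra map `id ⊗ ε : A ⊗ H → A`. -/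
def dropRight {k H : Type*} (A : Type*) [Field k] [Ring A] [Algebra k A] [Ring H] [Algebra k H]
    (ε : H →ₐ[k] k) : A ⊗[k] H →ₐ[k] A :=
  (Algebra.TensorProduct.rid k k A).toAlgHom.comp (onRight A ε)

/-- The algebra map `ε ⊗ id : H ⊗ A → A`. -/
def dropLeft {k H : Type*} (A : Type*) [Field k] [Ring A] [Algebra k A] [Ring H] [Algebra k H]
    (ε : H →ₐ[k] k) : H ⊗[k] A →ₐ[k] A :=
  (Algebra.TensorProduct.lid k A).toAlgHom.comp
    (Algebra.TensorProduct.map ε (AlgHom.id k A))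

/-- The algebra map `t ↦ t ⊗ 1 : A ⊗ (H ⊗ H) → A ⊗ (H ⊗ (H ⊗ H))`. -/
def appendOne (k A H : Type*) [Field k] [Ring A] [Algebra k A] [Ring H] [Algebra k H] :
    A ⊗[k] (H ⊗[k] H) →ₐ[k] A ⊗[k] (H ⊗[k] (H ⊗[k] H)) :=
  onRight A (onRight H Algebra.TensorProduct.includeLeft)

/-- The algebra map `t ↦ 1 ⊗ t : B → A ⊗ B`. -/
def prependOne (k A B : Type*) [Field k] [Ring A] [Algebra k A] [Ring B] [Algebra k B] :
    B →ₐ[k] A ⊗[k] B :=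
  Algebra.TensorProduct.includeRight

@[simp]
theorem splitLeft_tmul {k A B C : Type*} (D : Type*) [Field k] [Ring A] [Algebra k A] [Ring B]
    [Algebra k B] [Ring C] [Algebra k C] [Ring D] [Algebra k D] (f : A →ₐ[k] B ⊗[k] C)
    (a : A) (d : D) :
    splitLeft D f (a ⊗ₜ d) = Algebra.TensorProduct.assoc k k k B C D (f a ⊗ₜ d) := rfl

@[simp]
theorem onRight_tmul {k B C : Type*} (A : Type*) [Field k] [Ring A] [Algebra k A] [Ring B]
    [Algebra k B] [Ring C] [Algebra k C] (g : B →ₐ[k] C) (a : A) (b : B) :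
    onRight A g (a ⊗ₜ b) = a ⊗ₜ[k] g b := rfl

@[simp]
theorem dropRight_tmul {k H : Type*} (A : Type*) [Field k] [Ring A] [Algebra k A] [Ring H]
    [Algebra k H] (ε : H →ₐ[k] k) (a : A) (h : H) :
    dropRight A ε (a ⊗ₜ h) = ε h • a := rfl

@[simp]
theorem dropLeft_tmul {k H : Type*} (A : Type*) [Field k] [Ring A] [Algebra k A] [Ring H]
    [Algebra k H] (ε : H →ₐ[k] k) (a : A) (h : H) :
    dropLeft A ε (h ⊗ₜ a) = ε h • a := rfl

@[simp]
theorem appendOne_tmul {k A H : Type*} [Field k] [Ring A] [Algebra k A] [Ring H] [Algebra k H]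
    (a : A) (h g : H) :
    appendOne k A H (a ⊗ₜ (h ⊗ₜ g)) = a ⊗ₜ[k] (h ⊗ₜ[k] (g ⊗ₜ[k] (1 : H))) := rfl

@[simp]
theorem prependOne_apply {k A B : Type*} [Field k] [Ring A] [Algebra k A] [Ring B] [Algebra k B]
    (b : B) : prependOne k A B b = (1 : A) ⊗ₜ[k] b := rfl

/-- A quasi-bialgebra: an algebra `H` with algebra maps `Δ` and `ε` and an invertible reassociator
`Φ` such that `Δ` is counital, is coassociative up to conjugation by `Φ`, and `Φ` is a normalized
3-cocycle. -/
structure QuasiBialgebra (k H : Type*) [Field k] [Ring H] [Algebra k H] where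
  /-- the comultiplication -/
  Δ : H →ₐ[k] H ⊗[k] H
  /-- the counit -/
  ε : H →ₐ[k] k
  /-- the reassociator -/
  Φ : (H ⊗[k] (H ⊗[k] H))ˣ
  quasi_coassoc : ∀ h : H, onRight H Δ (Δ h) = ↑Φ * splitLeft H Δ (Δ h) * ↑Φ⁻¹
  counit_right : ∀ h : H, dropRight H ε (Δ h) = h
  counit_left : ∀ h : H, dropLeft H ε (Δ h) = h
  cocycle :
    prependOne k H (H ⊗[k] (H ⊗[k] H)) ↑Φ * onRight H (splitLeft H Δ) ↑Φ * appendOne k H H ↑Φ =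
      onRight H (onRight H Δ) ↑Φ * splitLeft (H ⊗[k] H) Δ ↑Φ
  normalized : onRight H (dropLeft H ε) (Φ : H ⊗[k] (H ⊗[k] H)) = 1

namespace QuasiBialgebra

variable {k H : Type*} [Field k] [Ring H] [Algebra k H] (Q : QuasiBialgebra k H)

theorem dropLeft_assoc (D : Type*) [Ring D] [Algebra k D] (t : H ⊗[k] H) (d : D) :
    dropLeft (H ⊗[k] D) Q.ε (Algebra.TensorProduct.assoc k k k H H D (t ⊗ₜ d)) =
      dropLeft H Q.ε t ⊗ₜ d := by
  induction t with
  | zero => simp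
  | add x y hx hy => simp only [map_add, add_tmul, hx, hy]
  | tmul a b => simp [smul_tmul']

/-- The map `ε ⊗ ε ⊗ id ⊗ id`. -/
def dropTwo : H ⊗[k] (H ⊗[k] (H ⊗[k] H)) →ₐ[k] H ⊗[k] H :=
  (dropLeft (H ⊗[k] H) Q.ε).comp (dropLeft (H ⊗[k] (H ⊗[k] H)) Q.ε)

theorem dropTwo_prependOne (t : H ⊗[k] (H ⊗[k] H)) :
    Q.dropTwo (prependOne k H (H ⊗[k] (H ⊗[k] H)) t) = dropLeft (H ⊗[k] H) Q.ε t := by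
  simp [dropTwo]

theorem dropTwo_middle (t : H ⊗[k] (H ⊗[k] H)) :
    Q.dropTwo (onRight H (splitLeft H Q.Δ) t) = dropLeft (H ⊗[k] H) Q.ε t := by
  induction t with
  | zero => simp
  | add x y hx hy => simp only [map_add, hx, hy]
  | tmul a t =>
  induction t with
  | zero => simp
  | add x y hx hy => simp only [map_add, tmul_add, hx, hy]
  | tmul b c =>
  simp only [dropTwo, AlgHom.comp_apply, onRight_tmul, splitLeft_tmul, dropLeft_tmul, map_smul]
  rw [Q.dropLeft_assoc, Q.counit_left]

theorem dropTwo_appendOne (t : H ⊗[k] (H ⊗[k] H)) :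
    Q.dropTwo (appendOne k H H t) =
      dropLeft H Q.ε (onRight H (dropLeft H Q.ε) t) ⊗ₜ[k] (1 : H) := by
  induction t with
  | zero => simp
  | add x y hx hy => simp only [map_add, add_tmul, hx, hy]
  | tmul a t =>
  induction t with
  | zero => simp
  | add x y hx hy => simp only [map_add, add_tmul, tmul_add, hx, hy]
  | tmul b c => simp [dropTwo, smul_tmul', mul_comm]

theorem dropTwo_right (t : H ⊗[k] (H ⊗[k] H)) :
    Q.dropTwo (onRight H (onRight H Q.Δ) t) =
      Q.Δ (dropLeft H Q.ε (onRight H (dropLeft H Q.ε) t)) := by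
  induction t with
  | zero => simp
  | add x y hx hy => simp only [map_add, hx, hy]
  | tmul a t =>
  induction t with
  | zero => simp
  | add x y hx hy => simp only [map_add, tmul_add, hx, hy]
  | tmul b c => simp [dropTwo, smul_comm (Q.ε a)]

theorem dropTwo_left (t : H ⊗[k] (H ⊗[k] H)) :
    Q.dropTwo (splitLeft (H ⊗[k] H) Q.Δ t) = dropLeft (H ⊗[k] H) Q.ε t := by
  induction t with
  | zero => simp
  | add x y hx hy => simp only [map_add, hx, hy]
  | tmul a t =>
  rw [splitLeft_tmul, dropTwo, AlgHom.comp_apply, Q.dropLeft_assoc, Q.counit_left]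

/-- `(ε ⊗ id ⊗ id)(Φ) = 1`. -/
theorem normalized_left : dropLeft (H ⊗[k] H) Q.ε (Q.Φ : H ⊗[k] (H ⊗[k] H)) = 1 := by
  have h := congrArg Q.dropTwo Q.cocycle
  rw [map_mul, map_mul, map_mul, Q.dropTwo_prependOne, Q.dropTwo_middle, Q.dropTwo_appendOne,
    Q.dropTwo_right, Q.dropTwo_left, Q.normalized, map_one, map_one,
    ← Algebra.TensorProduct.one_def, mul_one, one_mul] at h
  have h' := congrArg (dropLeft (H ⊗[k] H) Q.ε ↑Q.Φ⁻¹ * ·) h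
  simpa only [← mul_assoc, map_inv_mul, one_mul] using h'

end QuasiBialgebra

/-- A quasi-Hopf algebra: a quasi-bialgebra with an anti-automorphism `S` of the algebra `H` and
elements `α`, `β` satisfying Drinfeld's antipode axioms. -/
structure QuasiHopfAlgebra (k H : Type*) [Field k] [Ring H] [Algebra k H] extends
    QuasiBialgebra k H where
  /-- the antipode, an anti-automorphism of the algebra `H` -/
  S : H ≃ₐ[k] Hᵐᵒᵖ
  /-- the element `α` -/
  α : H
  /-- the element `β` -/
  β : H
  /-- `∑ S(h₁) α h₂ = ε(h) α` -/
  antipode_left : ∀ h : H,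
    TensorProduct.lift (LinearMap.mk₂ k (fun x y : H ↦ unop (S x) * α * y)
      (by intros; simp [add_mul]) (by intros; simp) (by intros; simp [mul_add])
      (by intros; simp)) (Δ h) = ε h • α
  /-- `∑ h₁ β S(h₂) = ε(h) β` -/
  antipode_right : ∀ h : H,
    TensorProduct.lift (LinearMap.mk₂ k (fun x y : H ↦ x * β * unop (S y))
      (by intros; simp [add_mul]) (by intros; simp) (by intros; simp [mul_add])
      (by intros; simp)) (Δ h) = ε h • β
  /-- `∑ X¹ β S(X²) α X³ = 1` -/
  antipode_reassociator :
    TensorProduct.lift (LinearMap.mk₂ k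
      (fun (x : H) (t : H ⊗[k] H) ↦ x * β *
        TensorProduct.lift (LinearMap.mk₂ k (fun y z : H ↦ unop (S y) * α * z)
          (by intros; simp [add_mul]) (by intros; simp) (by intros; simp [mul_add])
          (by intros; simp)) t)
      (by intros; simp [add_mul]) (by intros; simp) (by intros; simp [mul_add])
      (by intros; simp)) (Φ : H ⊗[k] (H ⊗[k] H)) = 1
  /-- `∑ S(x¹) α x² β S(x³) = 1` -/
  antipode_reassociator_inv :
    TensorProduct.lift (LinearMap.mk₂ k
      (fun (x : H) (t : H ⊗[k] H) ↦ unop (S x) * α *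
        TensorProduct.lift (LinearMap.mk₂ k (fun y z : H ↦ y * β * unop (S z))
          (by intros; simp [add_mul]) (by intros; simp) (by intros; simp [mul_add])
          (by intros; simp)) t)
      (by intros; simp [add_mul]) (by intros; simp) (by intros; simp [mul_add])
      (by intros; simp)) (↑Φ⁻¹ : H ⊗[k] (H ⊗[k] H)) = 1

/-- A right `H`-comodule algebra `(A, ρ, Φ_ρ)` over a quasi-bialgebra `H`. -/
structure RightComoduleAlgebra {k H : Type*} [Field k] [Ring H] [Algebra k H]
    (Q : QuasiBialgebra k H) (A : Type*) [Ring A] [Algebra k A] where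
  /-- the coaction -/
  ρ : A →ₐ[k] A ⊗[k] H
  /-- the reassociator of the coaction -/
  Φρ : (A ⊗[k] (H ⊗[k] H))ˣ
  quasi_coassoc : ∀ a : A, ↑Φρ * splitLeft H ρ (ρ a) = onRight A Q.Δ (ρ a) * ↑Φρ
  cocycle :
    prependOne k A (H ⊗[k] (H ⊗[k] H)) ↑Q.Φ * onRight A (splitLeft H Q.Δ) ↑Φρ *
        appendOne k A H ↑Φρ =
      onRight A (onRight H Q.Δ) ↑Φρ * splitLeft (H ⊗[k] H) ρ ↑Φρ
  counit : ∀ a : A, dropRight A Q.ε (ρ a) = a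
  normalized_middle : onRight A (dropLeft H Q.ε) (Φρ : A ⊗[k] (H ⊗[k] H)) = 1
  normalized_right : onRight A (dropRight H Q.ε) (Φρ : A ⊗[k] (H ⊗[k] H)) = 1

/-- A left `H`-module algebra: an algebra in the monoidal category of left `H`-modules, whose
associativity constraint is the action of `Φ`. -/
structure LeftModuleAlgebra {k H : Type*} [Field k] [Ring H] [Algebra k H]
    (Q : QuasiBialgebra k H) (X : Type*) [AddCommGroup X] [Module k X] where
  /-- the action of `H` -/
  act : H →ₐ[k] Module.End k X
  /-- the multiplication -/
  mul : X →ₗ[k] X →ₗ[k] X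
  /-- the unit -/
  one : X
  one_mul : ∀ a : X, mul one a = a
  mul_one : ∀ a : X, mul a one = a
  /-- `(a b) c = ∑ (X¹ a) [(X² b) (X³ c)]` -/
  mul_assoc : ∀ a b c : X,
    mul (mul a b) c =
      TensorProduct.lift mul (LinearMap.lTensor X (TensorProduct.lift mul)
        (tensorOp act.toLinearMap (tensorOp act.toLinearMap act.toLinearMap) ↑Q.Φ
          (a ⊗ₜ (b ⊗ₜ c))))
  /-- `h (a b) = ∑ (h₁ a) (h₂ b)` -/
  act_mul : ∀ (h : H) (a b : X),
    act h (mul a b) =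
      TensorProduct.lift mul (tensorOp act.toLinearMap act.toLinearMap (Q.Δ h) (a ⊗ₜ b))
  act_one : ∀ h : H, act h one = Q.ε h • one

section SmashProduct

set_option linter.unusedSimpArgs false

variable {k H X : Type*} [Field k] [Ring H] [Algebra k H] {Q : QuasiBialgebra k H}
  [AddCommGroup X] [Module k X]

/-- The underlying space `X ⊗ H` of the smash product `X # H` of a left `H`-module algebra `X`
with `H`. -/
def SmashProduct (_B : LeftModuleAlgebra Q X) : Type _ := X ⊗[k] H

namespace SmashProduct

variable (B : LeftModuleAlgebra Q X)

instance : AddCommGroup (SmashProduct B) := inferInstanceAs (AddCommGroup (X ⊗[k] H))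

instance : Module k (SmashProduct B) := inferInstanceAs (Module k (X ⊗[k] H))

/-- The linear map `p ⊗ (q ⊗ r) ↦ (p a) (q a') ⊗ r h'`. -/
def contract (a a' : X) (h' : H) : H ⊗[k] (H ⊗[k] H) →ₗ[k] X ⊗[k] H :=
  LinearMap.rTensor H (TensorProduct.lift B.mul) ∘ₗ
    (TensorProduct.assoc k X X H).symm.toLinearMap ∘ₗ
      LinearMap.applyₗ (a ⊗ₜ[k] (a' ⊗ₜ[k] h')) ∘ₗ
        tensorOp B.act.toLinearMap (tensorOp B.act.toLinearMap (LinearMap.mul k H))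

@[simp]
theorem contract_tmul (a a' : X) (h' p q r : H) :
    contract B a a' h' (p ⊗ₜ (q ⊗ₜ r)) = B.mul (B.act p a) (B.act q a') ⊗ₜ[k] (r * h') := rfl

/-- The multiplication `(a # h) (a' # h') = ∑ (x¹ a) (x² h₁ a') # x³ h₂ h'` of the smash product,
where `Φ⁻¹ = ∑ x¹ ⊗ x² ⊗ x³`. -/
def mulMap : X ⊗[k] H →ₗ[k] X ⊗[k] H →ₗ[k] X ⊗[k] H :=
  TensorProduct.lift <| LinearMap.mk₂ k
    (fun (a : X) (h : H) ↦ TensorProduct.lift <| LinearMap.mk₂ k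
      (fun (a' : X) (h' : H) ↦ contract B a a' h' (↑Q.Φ⁻¹ * prependOne k H (H ⊗[k] H) (Q.Δ h)))
      (by intros; simp [contract, add_tmul, tmul_add])
      (by intros; simp only [contract, ← smul_tmul', tmul_smul, map_smul, LinearMap.comp_apply,
        LinearMap.applyₗ_apply_apply, LinearEquiv.coe_coe, LinearMap.smul_apply])
      (by intros; simp [contract, tmul_add])
      (by intros; simp [contract, tmul_smul]))
    (by intros; ext; simp [contract, add_tmul])
    (by intros; ext; simp [contract, ← smul_tmul'])
    (by intros; ext; simp [tmul_add, tensor_mul_add])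
    (by intros; ext; simp [tensor_mul_smul])

theorem mulMap_tmul (a a' : X) (h h' : H) :
    mulMap B (a ⊗ₜ h) (a' ⊗ₜ h') =
      contract B a a' h' (↑Q.Φ⁻¹ * prependOne k H (H ⊗[k] H) (Q.Δ h)) := rfl

/-- The linear map `p ⊗ (q ⊗ (r ⊗ s)) ↦ (p a) ((q b) (r c)) ⊗ s h`. -/
def contract₃ (a b c : X) (h : H) : H ⊗[k] (H ⊗[k] (H ⊗[k] H)) →ₗ[k] X ⊗[k] H :=
  LinearMap.rTensor H (TensorProduct.lift B.mul ∘ₗ LinearMap.lTensor X (TensorProduct.lift B.mul))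
    ∘ₗ (TensorProduct.assoc k X (X ⊗[k] X) H).symm.toLinearMap ∘ₗ
      LinearMap.lTensor X (TensorProduct.assoc k X X H).symm.toLinearMap ∘ₗ
        LinearMap.applyₗ (a ⊗ₜ[k] (b ⊗ₜ[k] (c ⊗ₜ[k] h))) ∘ₗ
          tensorOp B.act.toLinearMap (tensorOp B.act.toLinearMap
            (tensorOp B.act.toLinearMap (LinearMap.mul k H)))

@[simp]
theorem contract₃_tmul (a b c : X) (h p q r s : H) :
    contract₃ B a b c h (p ⊗ₜ (q ⊗ₜ (r ⊗ₜ s))) =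
      B.mul (B.act p a) (B.mul (B.act q b) (B.act r c)) ⊗ₜ[k] (s * h) := rfl

theorem contract_left (a b c : X) (h p q : H) (P : H ⊗[k] (H ⊗[k] H)) (D : H ⊗[k] H) :
    contract B (B.mul (B.act p a) (B.act q b)) c h (P * prependOne k H (H ⊗[k] H) D) =
      contract₃ B a b c h (appendOne k H H ↑Q.Φ * splitLeft (H ⊗[k] H) Q.Δ P *
        (p ⊗ₜ (q ⊗ₜ D))) := by
  induction P with
  | zero => simp [tensor_mul_zero, tensor_zero_mul]
  | add x y hx hy => simp only [tensor_add_mul, map_add, tensor_mul_add, hx, hy]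
  | tmul p₁ P =>
  induction P with
  | zero => simp [tensor_mul_zero, tensor_zero_mul]
  | add x y hx hy => simp only [tensor_add_mul, map_add, tensor_mul_add, tmul_add, hx, hy]
  | tmul q₁ r₁ =>
  induction D with
  | zero => simp [tensor_mul_zero, tensor_zero_mul]
  | add x y hx hy => simp only [map_add, tensor_mul_add, tmul_add, hx, hy]
  | tmul d d' =>
  simp only [prependOne_apply, Algebra.TensorProduct.tmul_mul_tmul, mul_one, contract_tmul,
    B.act_mul, splitLeft_tmul]
  induction Q.Δ p₁ with
  | zero => simp [tensor_mul_zero, tensor_zero_mul]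
  | add x y hx hy => simp only [map_add, tensor_mul_add, tensor_add_mul, add_tmul, LinearMap.add_apply, hx, hy]
  | tmul e e' =>
  simp only [tensorOp_tmul, TensorProduct.lift.tmul, AlgHom.toLinearMap_apply, B.mul_assoc,
    Algebra.TensorProduct.assoc_tmul]
  induction (Q.Φ : H ⊗[k] (H ⊗[k] H)) with
  | zero => simp [tensor_mul_zero, tensor_zero_mul]
  | add x y hx hy => simp only [map_add, tensor_mul_add, tensor_add_mul, add_tmul, LinearMap.add_apply, hx, hy]
  | tmul f F =>
  induction F with
  | zero => simp [tensor_mul_zero, tensor_zero_mul]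
  | add x y hx hy =>
    simp only [map_add, tensor_mul_add, tensor_add_mul, add_tmul, tmul_add, LinearMap.add_apply, hx, hy]
  | tmul g j =>
  simp [mul_assoc]


theorem contract_right (a b c : X) (h : H) (T : H ⊗[k] (H ⊗[k] H)) (D : H ⊗[k] H) (p q r : H) :
    contract B a (B.mul (B.act p b) (B.act q c)) (r * h) (T * prependOne k H (H ⊗[k] H) D) =
      contract₃ B a b c h (onRight H (splitLeft H Q.Δ) T *
        prependOne k H (H ⊗[k] (H ⊗[k] H)) (splitLeft H Q.Δ D * (p ⊗ₜ (q ⊗ₜ r)))) := by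
  induction T with
  | zero => simp [tensor_mul_zero, tensor_zero_mul]
  | add x y hx hy => simp only [tensor_add_mul, map_add, tensor_mul_add, hx, hy]
  | tmul u T =>
  induction T with
  | zero => simp [tensor_mul_zero, tensor_zero_mul]
  | add x y hx hy => simp only [tensor_add_mul, map_add, tensor_mul_add, tmul_add, hx, hy]
  | tmul v w =>
  induction D with
  | zero => simp [tensor_mul_zero, tensor_zero_mul]
  | add x y hx hy => simp only [map_add, tensor_mul_add, tensor_add_mul, tmul_add, hx, hy]
  | tmul d d' =>
  simp only [prependOne_apply, Algebra.TensorProduct.tmul_mul_tmul, mul_one, contract_tmul,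
    map_mul, Module.End.mul_apply, B.act_mul, splitLeft_tmul, onRight_tmul]
  induction Q.Δ d with
  | zero => simp [tensor_mul_zero, tensor_zero_mul]
  | add x y hx hy =>
    simp only [map_add, tensor_mul_add, tensor_add_mul, add_tmul, tmul_add, LinearMap.add_apply,
      hx, hy]
  | tmul e e' =>
  simp only [tensorOp_tmul, TensorProduct.lift.tmul, AlgHom.toLinearMap_apply, B.act_mul]
  induction Q.Δ v with
  | zero => simp [tensor_mul_zero, tensor_zero_mul]
  | add x y hx hy =>
    simp only [map_add, tensor_mul_add, tensor_add_mul, add_tmul, tmul_add, LinearMap.add_apply,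
      hx, hy]
  | tmul f f' =>
  simp [mul_assoc]

theorem mulMap_assoc (x y z : X ⊗[k] H) :
    mulMap B (mulMap B x y) z = mulMap B x (mulMap B y z) := by
  induction x with
  | zero => simp
  | add x x' hx hx' => simp only [map_add, LinearMap.add_apply, hx, hx']
  | tmul a h =>
  induction y with
  | zero => simp
  | add x x' hx hx' => simp only [map_add, LinearMap.add_apply, hx, hx']
  | tmul b h' =>
  induction z with
  | zero => simp
  | add x x' hx hx' => simp only [map_add, LinearMap.add_apply, hx, hx']
  | tmul c h'' =>
  have left (P : H ⊗[k] (H ⊗[k] H)) : mulMap B (contract B a b h' P) (c ⊗ₜ h'') =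
      contract₃ B a b c h'' (appendOne k H H ↑Q.Φ * splitLeft (H ⊗[k] H) Q.Δ ↑Q.Φ⁻¹ *
        (onRight H (onRight H Q.Δ) P *
          prependOne k H (H ⊗[k] (H ⊗[k] H)) (prependOne k H (H ⊗[k] H) (Q.Δ h')))) := by
    induction P with
    | zero => simp [tensor_mul_zero, tensor_zero_mul]
    | add x y hx hy =>
      simp only [map_add, LinearMap.add_apply, tensor_mul_add, tensor_add_mul, hx, hy]
    | tmul p P =>
    induction P with
    | zero => simp [tensor_mul_zero, tensor_zero_mul]
    | add x y hx hy =>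
      simp only [map_add, LinearMap.add_apply, tensor_mul_add, tensor_add_mul, tmul_add, hx, hy]
    | tmul q r =>
    simp only [contract_tmul, mulMap_tmul, map_mul, onRight_tmul, prependOne_apply,
      Algebra.TensorProduct.tmul_mul_tmul, mul_one]
    exact contract_left B a b c h'' p q ↑Q.Φ⁻¹ (Q.Δ r * Q.Δ h')
  have right (P : H ⊗[k] (H ⊗[k] H)) : mulMap B (a ⊗ₜ h) (contract B b c h'' P) =
      contract₃ B a b c h'' (onRight H (splitLeft H Q.Δ) ↑Q.Φ⁻¹ *
        prependOne k H (H ⊗[k] (H ⊗[k] H)) (splitLeft H Q.Δ (Q.Δ h) * P)) := by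
    induction P with
    | zero => simp [tensor_mul_zero, tensor_zero_mul]
    | add x y hx hy =>
      simp only [map_add, LinearMap.add_apply, tensor_mul_add, tensor_add_mul, hx, hy]
    | tmul p P =>
    induction P with
    | zero => simp [tensor_mul_zero, tensor_zero_mul]
    | add x y hx hy =>
      simp only [map_add, LinearMap.add_apply, tensor_mul_add, tensor_add_mul, tmul_add, hx, hy]
    | tmul q r =>
    rw [contract_tmul, mulMap_tmul, contract_right]
  rw [mulMap_tmul, mulMap_tmul, left, right]
  congr 1
  have key : appendOne k H H (Q.Φ : H ⊗[k] (H ⊗[k] H)) * splitLeft (H ⊗[k] H) Q.Δ ↑Q.Φ⁻¹ *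
      onRight H (onRight H Q.Δ) ↑Q.Φ⁻¹ * prependOne k H (H ⊗[k] (H ⊗[k] H)) ↑Q.Φ =
        onRight H (splitLeft H Q.Δ) ↑Q.Φ⁻¹ :=
    cocycle_solve Q.cocycle (map_inv_mul _ _) (map_inv_mul _ _) (map_mul_inv _ _)
      (map_mul_inv _ _)
  have hh : onRight H (onRight H Q.Δ) (prependOne k H (H ⊗[k] H) (Q.Δ h)) =
      prependOne k H (H ⊗[k] (H ⊗[k] H)) (onRight H Q.Δ (Q.Δ h)) := rfl
  rw [map_mul, hh, Q.quasi_coassoc, map_mul, map_mul, map_mul, map_mul, ← key]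
  simp only [tensor_mul_assoc]

theorem one_mulMap (x : X ⊗[k] H) : mulMap B (B.one ⊗ₜ 1) x = x := by
  induction x with
  | zero => simp
  | add x y hx hy => simp only [map_add, hx, hy]
  | tmul a h =>
  have aux (t : H ⊗[k] (H ⊗[k] H)) : contract B B.one a h t =
      tensorOp B.act.toLinearMap (LinearMap.mul k H) (dropLeft (H ⊗[k] H) Q.ε t) (a ⊗ₜ h) := by
    induction t with
    | zero => simp
    | add x y hx hy => simp only [map_add, LinearMap.add_apply, hx, hy]
    | tmul p t =>
    induction t with
    | zero => simp
    | add x y hx hy => simp only [map_add, LinearMap.add_apply, tmul_add, hx, hy]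
    | tmul q r => simp [B.act_one, B.one_mul, smul_tmul']
  rw [mulMap_tmul, map_one, map_one, mul_one, aux, map_inv_eq_one _ _ Q.normalized_left,
    Algebra.TensorProduct.one_def]
  simp

theorem mulMap_one (x : X ⊗[k] H) : mulMap B x (B.one ⊗ₜ 1) = x := by
  induction x with
  | zero => simp
  | add x y hx hy => simp only [map_add, LinearMap.add_apply, hx, hy]
  | tmul a h =>
  have aux (t : H ⊗[k] (H ⊗[k] H)) : contract B a B.one 1 t =
      tensorOp B.act.toLinearMap (LinearMap.mul k H) (onRight H (dropLeft H Q.ε) t)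
        (a ⊗ₜ 1) := by
    induction t with
    | zero => simp
    | add x y hx hy => simp only [map_add, LinearMap.add_apply, hx, hy]
    | tmul p t =>
    induction t with
    | zero => simp
    | add x y hx hy => simp only [map_add, LinearMap.add_apply, tmul_add, hx, hy]
    | tmul q r => simp [B.act_one, B.mul_one, smul_tmul']
  rw [mulMap_tmul, aux, map_mul, map_inv_eq_one _ _ Q.normalized, one_mul, prependOne_apply,
    onRight_tmul, Q.counit_left]
  simp

/-- The product of the ring `X # H` is `mulMap`. -/
instance : Mul (SmashProduct B) := ⟨fun x y ↦ mulMap B x y⟩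

/-- The unit is `1 # 1`. -/
instance : One (SmashProduct B) := ⟨B.one ⊗ₜ[k] (1 : H)⟩

/-- The smash product is an associative unital ring. -/
instance : Ring (SmashProduct B) where
  __ := (inferInstance : AddCommGroup (SmashProduct B))
  left_distrib x y z := map_add (mulMap B x) y z
  right_distrib x y z := LinearMap.map_add₂ (mulMap B) x y z
  zero_mul x := LinearMap.map_zero₂ (mulMap B) x
  mul_zero x := map_zero (mulMap B x)
  mul_assoc := mulMap_assoc B
  one_mul := one_mulMap B
  mul_one := mulMap_one B

instance : Algebra k (SmashProduct B) :=
  Algebra.ofModule (fun c x y ↦ LinearMap.map_smul₂ (mulMap B) c x y)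
    (fun c x y ↦ map_smul (mulMap B x) c y)

end SmashProduct

end SmashProduct

section QuasiSmash

set_option linter.unusedSimpArgs false

variable {k H A : Type*} [Field k] [Ring H] [Algebra k H] (Q : QuasiBialgebra k H)
  [Ring A] [Algebra k A]

/-- The left action of `H` on `H* = Module.Dual k H`, given by `(h ⇀ φ)(h') = φ(h' h)`. -/
def dualLeft (k H : Type*) [Field k] [Ring H] [Algebra k H] :
    H →ₐ[k] Module.End k (Module.Dual k H) :=
  AlgHom.ofLinearMap
    (LinearMap.mk₂ k (fun (h : H) (φ : Module.Dual k H) ↦ φ ∘ₗ LinearMap.mulRight k h)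
      (by intros; ext; simp [mul_add]) (by intros; ext; simp)
      (by intros; ext; simp) (by intros; ext; simp))
    (by ext; simp) (by intros; ext; simp [mul_assoc])

/-- The right action of `H` on `H*`, given by `(φ ↼ h)(h') = φ(h h')`. -/
def dualRight (k H : Type*) [Field k] [Ring H] [Algebra k H] :
    H →ₗ[k] Module.End k (Module.Dual k H) :=
  LinearMap.mk₂ k (fun (h : H) (φ : Module.Dual k H) ↦ φ ∘ₗ LinearMap.mulLeft k h)
    (by intros; ext; simp [add_mul]) (by intros; ext; simp)
    (by intros; ext; simp) (by intros; ext; simp)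

@[simp]
theorem dualLeft_apply (h h' : H) (φ : Module.Dual k H) : dualLeft k H h φ h' = φ (h' * h) := rfl

@[simp]
theorem dualRight_apply (h h' : H) (φ : Module.Dual k H) : dualRight k H h φ h' = φ (h * h') := rfl

theorem dualRight_dualRight (g h : H) (φ : Module.Dual k H) :
    dualRight k H h (dualRight k H g φ) = dualRight k H (g * h) φ := by
  ext; simp [mul_assoc]

theorem dualRight_dualLeft (g h : H) (φ : Module.Dual k H) :
    dualRight k H h (dualLeft k H g φ) = dualLeft k H g (dualRight k H h φ) := by
  ext; simp [mul_assoc]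

/-- The convolution product `(φ ψ)(h) = ∑ φ(h₁) ψ(h₂)` on `H*`. -/
def convolution : Module.Dual k H →ₗ[k] Module.Dual k H →ₗ[k] Module.Dual k H :=
  TensorProduct.curry (Q.Δ.toLinearMap.dualMap ∘ₗ TensorProduct.dualDistrib k H H)

theorem convolution_apply (φ ψ : Module.Dual k H) (h : H) :
    convolution Q φ ψ h = TensorProduct.dualDistrib k H H (φ ⊗ₜ ψ) (Q.Δ h) := rfl

theorem dualLeft_convolution (h : H) (φ ψ : Module.Dual k H) :
    dualLeft k H h (convolution Q φ ψ) =
      TensorProduct.lift (convolution Q)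
        (tensorOp (dualLeft k H).toLinearMap (dualLeft k H).toLinearMap (Q.Δ h) (φ ⊗ₜ ψ)) := by
  ext x
  rw [dualLeft_apply, convolution_apply, map_mul]
  induction Q.Δ h with
  | zero => simp [tensor_mul_zero]
  | add x y hx hy => simp only [tensor_mul_add, map_add, LinearMap.add_apply, hx, hy]
  | tmul p q =>
  simp only [tensorOp_tmul, TensorProduct.lift.tmul, convolution_apply]
  induction Q.Δ x with
  | zero => simp [tensor_zero_mul]
  | add x y hx hy => simp only [tensor_add_mul, map_add, hx, hy]
  | tmul r s => simp

theorem dualRight_convolution (h : H) (φ ψ : Module.Dual k H) :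
    dualRight k H h (convolution Q φ ψ) =
      TensorProduct.lift (convolution Q)
        (tensorOp (dualRight k H) (dualRight k H) (Q.Δ h) (φ ⊗ₜ ψ)) := by
  ext x
  rw [dualRight_apply, convolution_apply, map_mul]
  induction Q.Δ h with
  | zero => simp [tensor_zero_mul]
  | add x y hx hy => simp only [tensor_add_mul, map_add, LinearMap.add_apply, hx, hy]
  | tmul p q =>
  simp only [tensorOp_tmul, TensorProduct.lift.tmul, convolution_apply]
  induction Q.Δ x with
  | zero => simp [tensor_mul_zero]
  | add x y hx hy => simp only [tensor_mul_add, map_add, hx, hy]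
  | tmul r s => simp

/-- The linear form `x ⊗ (y ⊗ z) ↦ φ(x) ψ(y) χ(z)`. -/
def pair₃ (φ ψ χ : Module.Dual k H) : H ⊗[k] (H ⊗[k] H) →ₗ[k] k :=
  TensorProduct.dualDistrib k H (H ⊗[k] H) (φ ⊗ₜ TensorProduct.dualDistrib k H H (ψ ⊗ₜ χ))

@[simp]
theorem pair₃_tmul (φ ψ χ : Module.Dual k H) (x y z : H) :
    pair₃ φ ψ χ (x ⊗ₜ (y ⊗ₜ z)) = φ x * (ψ y * χ z) := rfl

theorem convolution_right (φ ψ χ : Module.Dual k H) (h : H) :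
    convolution Q φ (convolution Q ψ χ) h = pair₃ φ ψ χ (onRight H Q.Δ (Q.Δ h)) := by
  rw [convolution_apply]
  induction Q.Δ h with
  | zero => simp
  | add x y hx hy => simp only [map_add, hx, hy]
  | tmul x y => rfl

theorem convolution_left (φ ψ χ : Module.Dual k H) (h : H) :
    convolution Q (convolution Q φ ψ) χ h = pair₃ φ ψ χ (splitLeft H Q.Δ (Q.Δ h)) := by
  rw [convolution_apply]
  induction Q.Δ h with
  | zero => simp
  | add x y hx hy => simp only [map_add, hx, hy]
  | tmul x z =>
  simp only [dualDistrib_apply, convolution_apply, splitLeft_tmul]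
  induction Q.Δ x with
  | zero => simp
  | add x y hx hy => simp only [map_add, add_tmul, add_mul, hx, hy]
  | tmul x y => simp [mul_assoc]

/-- The threefold convolution `φ ⊗ (ψ ⊗ χ) ↦ φ (ψ χ)`. -/
def convolution₃ :
    Module.Dual k H ⊗[k] (Module.Dual k H ⊗[k] Module.Dual k H) →ₗ[k] Module.Dual k H :=
  TensorProduct.lift (convolution Q) ∘ₗ
    LinearMap.lTensor (Module.Dual k H) (TensorProduct.lift (convolution Q))

@[simp]
theorem convolution₃_tmul (φ ψ χ : Module.Dual k H) :
    convolution₃ Q (φ ⊗ₜ (ψ ⊗ₜ χ)) = convolution Q φ (convolution Q ψ χ) := rfl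

/-- The left action of `H ⊗ (H ⊗ H)` on `H* ⊗ (H* ⊗ H*)`. -/
def dualLeft₃ (k H : Type*) [Field k] [Ring H] [Algebra k H] :
    H ⊗[k] (H ⊗[k] H) →ₗ[k]
      Module.End k (Module.Dual k H ⊗[k] (Module.Dual k H ⊗[k] Module.Dual k H)) :=
  tensorOp (dualLeft k H).toLinearMap
    (tensorOp (dualLeft k H).toLinearMap (dualLeft k H).toLinearMap)

/-- The right action of `H ⊗ (H ⊗ H)` on `H* ⊗ (H* ⊗ H*)`. -/
def dualRight₃ (k H : Type*) [Field k] [Ring H] [Algebra k H] :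
    H ⊗[k] (H ⊗[k] H) →ₗ[k]
      Module.End k (Module.Dual k H ⊗[k] (Module.Dual k H ⊗[k] Module.Dual k H)) :=
  tensorOp (dualRight k H) (tensorOp (dualRight k H) (dualRight k H))

@[simp]
theorem dualLeft₃_tmul (p q r : H) (φ ψ χ : Module.Dual k H) :
    dualLeft₃ k H (p ⊗ₜ (q ⊗ₜ r)) (φ ⊗ₜ (ψ ⊗ₜ χ)) =
      dualLeft k H p φ ⊗ₜ[k] (dualLeft k H q ψ ⊗ₜ[k] dualLeft k H r χ) := rfl

@[simp]
theorem dualRight₃_tmul (p q r : H) (φ ψ χ : Module.Dual k H) :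
    dualRight₃ k H (p ⊗ₜ (q ⊗ₜ r)) (φ ⊗ₜ (ψ ⊗ₜ χ)) =
      dualRight k H p φ ⊗ₜ[k] (dualRight k H q ψ ⊗ₜ[k] dualRight k H r χ) := rfl

theorem convolution_assoc (φ ψ χ : Module.Dual k H) :
    convolution Q (convolution Q φ ψ) χ =
      convolution₃ Q (dualRight₃ k H ↑Q.Φ⁻¹ (dualLeft₃ k H ↑Q.Φ (φ ⊗ₜ (ψ ⊗ₜ χ)))) := by
  have aux (V W : H ⊗[k] (H ⊗[k] H)) (h : H) :
      convolution₃ Q (dualRight₃ k H V (dualLeft₃ k H W (φ ⊗ₜ (ψ ⊗ₜ χ)))) h =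
        pair₃ φ ψ χ (V * onRight H Q.Δ (Q.Δ h) * W) := by
    induction V with
    | zero => simp [tensor_mul_zero, tensor_zero_mul]
    | add x y hx hy => simp only [tensor_add_mul, map_add, LinearMap.add_apply, hx, hy]
    | tmul p V =>
    induction V with
    | zero => simp [tensor_mul_zero, tensor_zero_mul]
    | add x y hx hy =>
      simp only [tensor_add_mul, map_add, LinearMap.add_apply, tmul_add, hx, hy]
    | tmul q r =>
    induction W with
    | zero => simp [tensor_mul_zero, tensor_zero_mul]
    | add x y hx hy => simp only [tensor_mul_add, map_add, LinearMap.add_apply, hx, hy]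
    | tmul u W =>
    induction W with
    | zero => simp [tensor_mul_zero, tensor_zero_mul]
    | add x y hx hy =>
      simp only [tensor_mul_add, map_add, LinearMap.add_apply, tmul_add, hx, hy]
    | tmul v w =>
    simp only [dualLeft₃_tmul, dualRight₃_tmul, convolution₃_tmul, convolution_right]
    induction onRight H Q.Δ (Q.Δ h) with
    | zero => simp [tensor_mul_zero, tensor_zero_mul]
    | add x y hx hy => simp only [tensor_mul_add, tensor_add_mul, map_add, hx, hy]
    | tmul x T =>
    induction T with
    | zero => simp [tensor_mul_zero, tensor_zero_mul]
    | add x y hx hy => simp only [tensor_mul_add, tensor_add_mul, map_add, tmul_add, hx, hy]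
    | tmul y z => simp [mul_assoc]
  ext h
  rw [aux, convolution_left, Q.quasi_coassoc]
  congr 1
  rw [show (↑Q.Φ⁻¹ : H ⊗[k] (H ⊗[k] H)) * (↑Q.Φ * splitLeft H Q.Δ (Q.Δ h) * ↑Q.Φ⁻¹) * ↑Q.Φ =
    (↑Q.Φ⁻¹ * ↑Q.Φ) * splitLeft H Q.Δ (Q.Δ h) * (↑Q.Φ⁻¹ * ↑Q.Φ) by simp only [mul_assoc],
    Units.inv_mul, mul_one, one_mul]

theorem dualRight_counit (h : H) : dualRight k H h Q.ε.toLinearMap = Q.ε h • Q.ε.toLinearMap := by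
  ext; simp

theorem dualLeft_counit (h : H) : dualLeft k H h Q.ε.toLinearMap = Q.ε h • Q.ε.toLinearMap := by
  ext; simp [mul_comm]

theorem counit_convolution (φ : Module.Dual k H) : convolution Q Q.ε.toLinearMap φ = φ := by
  ext h
  rw [convolution_apply]
  conv_rhs => rw [← Q.counit_left h]
  induction Q.Δ h with
  | zero => simp
  | add x y hx hy => simp only [map_add, hx, hy]
  | tmul x y => simp

theorem convolution_counit (φ : Module.Dual k H) : convolution Q φ Q.ε.toLinearMap = φ := by
  ext h
  rw [convolution_apply]
  conv_rhs => rw [← Q.counit_right h]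
  induction Q.Δ h with
  | zero => simp
  | add x y hx hy => simp only [map_add, hx, hy]
  | tmul x y => simp [mul_comm]

variable {Q}
variable (R : RightComoduleAlgebra Q A)

namespace RightComoduleAlgebra

/-- The linear map `b ⊗ (p ⊗ q) ↦ a b ⊗ (φ ↼ p) (ψ ↼ q)` for `τ = φ ⊗ ψ`. -/
def spread (_R : RightComoduleAlgebra Q A) (a : A) (τ : Module.Dual k H ⊗[k] Module.Dual k H) :
    A ⊗[k] (H ⊗[k] H) →ₗ[k] A ⊗[k] Module.Dual k H :=
  LinearMap.lTensor A (TensorProduct.lift (convolution Q)) ∘ₗ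
    LinearMap.applyₗ (a ⊗ₜ[k] τ) ∘ₗ
      tensorOp (N := Module.Dual k H ⊗[k] Module.Dual k H) (LinearMap.mul k A).flip
        (tensorOp (dualRight k H) (dualRight k H))

@[simp]
theorem spread_tmul (a b : A) (φ ψ : Module.Dual k H) (p q : H) :
    R.spread a (φ ⊗ₜ ψ) (b ⊗ₜ (p ⊗ₜ q)) =
      (a * b) ⊗ₜ[k] convolution Q (dualRight k H p φ) (dualRight k H q ψ) := rfl

theorem spread_add (a : A) (τ τ' : Module.Dual k H ⊗[k] Module.Dual k H) :
    R.spread a (τ + τ') = R.spread a τ + R.spread a τ' := by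
  simp only [spread, tmul_add, map_add, LinearMap.add_comp, LinearMap.comp_add]

theorem spread_zero (a : A) : R.spread a 0 = 0 := by
  simp [spread]

/-- The algebra map `t ↦ t ⊗ 1 : A ⊗ H → A ⊗ (H ⊗ H)`. -/
def extend (_R : RightComoduleAlgebra Q A) : A ⊗[k] H →ₐ[k] A ⊗[k] (H ⊗[k] H) :=
  onRight A Algebra.TensorProduct.includeLeft

@[simp]
theorem extend_tmul (a : A) (h : H) : R.extend (a ⊗ₜ h) = a ⊗ₜ[k] (h ⊗ₜ[k] (1 : H)) := rfl

/-- The multiplication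
`(a # φ) (a' # ψ) = ∑ a a'₀ x¹ # (φ ↼ a'₁ x²) (ψ ↼ x³)` of the quasi-smash product, where
`ρ(a') = ∑ a'₀ ⊗ a'₁` and `Φρ⁻¹ = ∑ x¹ ⊗ x² ⊗ x³`. -/
def quasiSmashMul :
    A ⊗[k] Module.Dual k H →ₗ[k] A ⊗[k] Module.Dual k H →ₗ[k] A ⊗[k] Module.Dual k H :=
  TensorProduct.lift <| LinearMap.mk₂ k
    (fun (a : A) (φ : Module.Dual k H) ↦ TensorProduct.lift <| LinearMap.mk₂ k
      (fun (a' : A) (ψ : Module.Dual k H) ↦ R.spread a (φ ⊗ₜ ψ) (R.extend (R.ρ a') * ↑R.Φρ⁻¹))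
      (by intros; simp [add_mul])
      (by intros; simp [tensor_smul_mul])
      (by intros; simp [spread, tmul_add])
      (by intros; simp [spread]))
    (by intros; ext; simp [spread, add_tmul])
    (by intros; ext; simp [spread, ← smul_tmul'])
    (by intros; ext; simp [spread, tmul_add, add_tmul])
    (by intros; ext; simp [spread, ← smul_tmul'])

theorem quasiSmashMul_tmul (a a' : A) (φ ψ : Module.Dual k H) :
    R.quasiSmashMul (a ⊗ₜ φ) (a' ⊗ₜ ψ) = R.spread a (φ ⊗ₜ ψ) (R.extend (R.ρ a') * ↑R.Φρ⁻¹) := rfl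

/-- The linear map `b ⊗ (p ⊗ (q ⊗ r)) ↦ a b ⊗ (φ ↼ p) ((ψ ↼ q) (χ ↼ r))` for
`τ = φ ⊗ (ψ ⊗ χ)`. -/
def spread₃ (_R : RightComoduleAlgebra Q A) (a : A)
    (τ : Module.Dual k H ⊗[k] (Module.Dual k H ⊗[k] Module.Dual k H)) :
    A ⊗[k] (H ⊗[k] (H ⊗[k] H)) →ₗ[k] A ⊗[k] Module.Dual k H :=
  LinearMap.lTensor A (convolution₃ Q) ∘ₗ LinearMap.applyₗ (a ⊗ₜ[k] τ) ∘ₗ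
    tensorOp (N := Module.Dual k H ⊗[k] (Module.Dual k H ⊗[k] Module.Dual k H))
      (LinearMap.mul k A).flip (dualRight₃ k H)

@[simp]
theorem spread₃_tmul (a b : A)
    (τ : Module.Dual k H ⊗[k] (Module.Dual k H ⊗[k] Module.Dual k H)) (t : H ⊗[k] (H ⊗[k] H)) :
    R.spread₃ a τ (b ⊗ₜ t) = (a * b) ⊗ₜ[k] convolution₃ Q (dualRight₃ k H t τ) := rfl

theorem spread₃_add (a : A)
    (τ τ' : Module.Dual k H ⊗[k] (Module.Dual k H ⊗[k] Module.Dual k H)) :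
    R.spread₃ a (τ + τ') = R.spread₃ a τ + R.spread₃ a τ' := by
  simp only [spread₃, tmul_add, map_add, LinearMap.add_comp, LinearMap.comp_add]

theorem spread₃_zero (a : A) : R.spread₃ a 0 = 0 := by
  simp [spread₃]

theorem quasiSmashMul_left (a b : A) (φ ψ χ : Module.Dual k H) (p q : H)
    (T : A ⊗[k] (H ⊗[k] H)) :
    R.spread (a * b) (convolution Q (dualRight k H p φ) (dualRight k H q ψ) ⊗ₜ χ) T =
      R.spread₃ a (dualLeft₃ k H ↑Q.Φ (φ ⊗ₜ (ψ ⊗ₜ χ)))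
        (appendOne k A H (b ⊗ₜ (p ⊗ₜ q)) * onRight A (splitLeft H Q.Δ) T *
          prependOne k A (H ⊗[k] (H ⊗[k] H)) ↑Q.Φ⁻¹) := by
  induction T with
  | zero => simp [tensor_mul_zero, tensor_zero_mul]
  | add x y hx hy => simp only [tensor_mul_add, tensor_add_mul, map_add, hx, hy]
  | tmul c T =>
  induction T with
  | zero => simp [tensor_mul_zero, tensor_zero_mul]
  | add x y hx hy => simp only [tensor_mul_add, tensor_add_mul, map_add, tmul_add, hx, hy]
  | tmul u v =>
  simp only [spread_tmul, dualRight_convolution, onRight_tmul, splitLeft_tmul]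
  induction Q.Δ u with
  | zero => simp [tensor_mul_zero, tensor_zero_mul]
  | add x y hx hy =>
    simp only [tensor_mul_add, tensor_add_mul, map_add, tmul_add, add_tmul,
      LinearMap.add_apply, hx, hy]
  | tmul d e =>
  simp only [tensorOp_tmul, TensorProduct.lift.tmul, convolution_assoc, appendOne_tmul,
    prependOne_apply, Algebra.TensorProduct.assoc_tmul, Algebra.TensorProduct.tmul_mul_tmul]
  induction (↑Q.Φ⁻¹ : H ⊗[k] (H ⊗[k] H)) with
  | zero => simp [tensor_mul_zero, tensor_zero_mul]
  | add x y hx hy =>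
    simp only [tensor_mul_add, tensor_add_mul, map_add, tmul_add, add_tmul,
      LinearMap.add_apply, hx, hy]
  | tmul x T =>
  induction T with
  | zero => simp [tensor_mul_zero, tensor_zero_mul]
  | add x y hx hy =>
    simp only [tensor_mul_add, tensor_add_mul, map_add, tmul_add, add_tmul,
      LinearMap.add_apply, hx, hy]
  | tmul y z =>
  induction (Q.Φ : H ⊗[k] (H ⊗[k] H)) with
  | zero => simp [spread₃_zero]
  | add x y hx hy =>
    simp only [map_add, tmul_add, LinearMap.add_apply, spread₃_add, hx, hy]
  | tmul x T =>
  induction T with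
  | zero => simp [spread₃_zero]
  | add x y hx hy =>
    simp only [map_add, tmul_add, LinearMap.add_apply, spread₃_add, hx, hy]
  | tmul y z =>
  simp [dualRight_dualRight, dualRight_dualLeft, mul_assoc]

theorem quasiSmashMul_right (a b c : A) (φ ψ χ : Module.Dual k H) (u v : H) :
    R.spread a (φ ⊗ₜ convolution Q (dualRight k H u ψ) (dualRight k H v χ))
        (R.extend (R.ρ (b * c)) * ↑R.Φρ⁻¹) =
      R.spread₃ a (φ ⊗ₜ (ψ ⊗ₜ χ))
        (appendOne k A H (R.extend (R.ρ b)) * splitLeft (H ⊗[k] H) R.ρ (c ⊗ₜ (u ⊗ₜ v)) *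
          onRight A (onRight H Q.Δ) ↑R.Φρ⁻¹) := by
  rw [map_mul R.ρ, map_mul R.extend, splitLeft_tmul]
  induction (↑R.Φρ⁻¹ : A ⊗[k] (H ⊗[k] H)) with
  | zero => simp [tensor_mul_zero, tensor_zero_mul]
  | add x y hx hy => simp only [tensor_mul_add, tensor_add_mul, map_add, hx, hy]
  | tmul y T =>
  induction T with
  | zero => simp [tensor_mul_zero, tensor_zero_mul]
  | add x y hx hy => simp only [tensor_mul_add, tensor_add_mul, map_add, tmul_add, hx, hy]
  | tmul y₂ y₃ =>
  induction R.ρ c with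
  | zero => simp [tensor_mul_zero, tensor_zero_mul]
  | add x y hx hy =>
    simp only [tensor_mul_add, tensor_add_mul, map_add, tmul_add, add_tmul, hx, hy]
  | tmul c c' =>
  induction R.ρ b with
  | zero => simp [tensor_mul_zero, tensor_zero_mul]
  | add x y hx hy =>
    simp only [tensor_mul_add, tensor_add_mul, map_add, tmul_add, add_tmul, hx, hy]
  | tmul b b' =>
  simp only [extend_tmul, appendOne_tmul, onRight_tmul, Algebra.TensorProduct.assoc_tmul,
    Algebra.TensorProduct.tmul_mul_tmul, one_mul, spread_tmul, spread₃_tmul,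
    dualRight_convolution]
  induction Q.Δ y₃ with
  | zero => simp [tensor_mul_zero, tensor_zero_mul]
  | add x y hx hy =>
    simp only [tensor_mul_add, tensor_add_mul, map_add, tmul_add, add_tmul,
      LinearMap.add_apply, hx, hy]
  | tmul d d' => simp [dualRight_dualRight, mul_assoc]

theorem onRight_splitLeft_extend (t : A ⊗[k] H) :
    onRight A (splitLeft H Q.Δ) (R.extend t) = appendOne k A H (onRight A Q.Δ t) := by
  induction t with
  | zero => simp
  | add x y hx hy => simp only [map_add, hx, hy]
  | tmul a h =>
  simp only [extend_tmul, onRight_tmul, splitLeft_tmul]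
  induction Q.Δ h with
  | zero => simp
  | add x y hx hy => simp only [map_add, add_tmul, tmul_add, hx, hy]
  | tmul x y => simp

theorem splitLeft_extend (t : A ⊗[k] H) :
    splitLeft (H ⊗[k] H) R.ρ (R.extend t) = appendOne k A H (splitLeft H R.ρ t) := by
  induction t with
  | zero => simp
  | add x y hx hy => simp only [map_add, hx, hy]
  | tmul a h =>
  simp only [extend_tmul, splitLeft_tmul]
  induction R.ρ a with
  | zero => simp
  | add x y hx hy => simp only [map_add, add_tmul, tmul_add, hx, hy]
  | tmul x y => simp

theorem quasiSmash_tensor (a' a'' : A) :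
    appendOne k A H (R.extend (R.ρ a') * ↑R.Φρ⁻¹) *
        onRight A (splitLeft H Q.Δ) (R.extend (R.ρ a'') * ↑R.Φρ⁻¹) *
          prependOne k A (H ⊗[k] (H ⊗[k] H)) ↑Q.Φ⁻¹ =
      appendOne k A H (R.extend (R.ρ a')) *
        splitLeft (H ⊗[k] H) R.ρ (R.extend (R.ρ a'') * ↑R.Φρ⁻¹) *
          onRight A (onRight H Q.Δ) ↑R.Φρ⁻¹ := by
  have h₁ : (↑R.Φρ⁻¹ : A ⊗[k] (H ⊗[k] H)) * onRight A Q.Δ (R.ρ a'') =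
      splitLeft H R.ρ (R.ρ a'') * ↑R.Φρ⁻¹ := by
    rw [Units.inv_mul_eq_iff_eq_mul, ← mul_assoc, R.quasi_coassoc, Units.mul_inv_cancel_right]
  have h₂ : appendOne k A H ↑R.Φρ⁻¹ * onRight A (splitLeft H Q.Δ) ↑R.Φρ⁻¹ *
      prependOne k A (H ⊗[k] (H ⊗[k] H)) ↑Q.Φ⁻¹ =
        splitLeft (H ⊗[k] H) R.ρ ↑R.Φρ⁻¹ * onRight A (onRight H Q.Δ) ↑R.Φρ⁻¹ :=
    cocycle_solve' R.cocycle (map_inv_mul _ _) (map_inv_mul _ _) (map_inv_mul _ _)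
      (map_mul_inv _ _) (map_mul_inv _ _)
  rw [map_mul, map_mul, map_mul, R.onRight_splitLeft_extend, R.splitLeft_extend]
  simp only [tensor_mul_assoc] at h₂ ⊢
  rw [← h₂, ← tensor_mul_assoc (appendOne k A H ↑R.Φρ⁻¹), ← map_mul, h₁, map_mul]
  simp only [tensor_mul_assoc]

theorem drop_extend (t : A ⊗[k] H) :
    onRight A (dropLeft H Q.ε) (R.extend t) = dropRight A Q.ε t ⊗ₜ[k] (1 : H) := by
  induction t with
  | zero => simp
  | add x y hx hy => simp only [map_add, add_tmul, hx, hy]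
  | tmul a h => simp [smul_tmul']

theorem spread_counit_left (a : A) (φ : Module.Dual k H) (T : A ⊗[k] (H ⊗[k] H)) :
    R.spread a (Q.ε.toLinearMap ⊗ₜ φ) T =
      tensorOp (LinearMap.mul k A).flip (dualRight k H) (onRight A (dropLeft H Q.ε) T)
        (a ⊗ₜ φ) := by
  induction T with
  | zero => simp
  | add x y hx hy => simp only [map_add, LinearMap.add_apply, hx, hy]
  | tmul b T =>
  induction T with
  | zero => simp
  | add x y hx hy => simp only [map_add, LinearMap.add_apply, tmul_add, hx, hy]
  | tmul p q => simp [dualRight_counit, counit_convolution]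

theorem spread_counit_right (a : A) (φ : Module.Dual k H) (T : A ⊗[k] (H ⊗[k] H)) :
    R.spread a (φ ⊗ₜ Q.ε.toLinearMap) T =
      tensorOp (LinearMap.mul k A).flip (dualRight k H) (onRight A (dropRight H Q.ε) T)
        (a ⊗ₜ φ) := by
  induction T with
  | zero => simp
  | add x y hx hy => simp only [map_add, LinearMap.add_apply, hx, hy]
  | tmul b T =>
  induction T with
  | zero => simp
  | add x y hx hy => simp only [map_add, LinearMap.add_apply, tmul_add, hx, hy]
  | tmul p q => simp [dualRight_counit, convolution_counit]

theorem one_quasiSmashMul (x : A ⊗[k] Module.Dual k H) :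
    R.quasiSmashMul (1 ⊗ₜ Q.ε.toLinearMap) x = x := by
  induction x with
  | zero => simp
  | add x y hx hy => simp only [map_add, hx, hy]
  | tmul a φ =>
  rw [quasiSmashMul_tmul, spread_counit_left, map_mul (onRight A (dropLeft H Q.ε)),
    map_inv_eq_one _ _ R.normalized_middle, mul_one, drop_extend, R.counit, tensorOp_tmul]
  congr 1
  · simp
  · ext; simp

theorem quasiSmashMul_one (x : A ⊗[k] Module.Dual k H) :
    R.quasiSmashMul x (1 ⊗ₜ Q.ε.toLinearMap) = x := by
  induction x with
  | zero => simp
  | add x y hx hy => simp only [map_add, LinearMap.add_apply, hx, hy]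
  | tmul a φ =>
  rw [quasiSmashMul_tmul, spread_counit_right, map_one, map_one, one_mul,
    map_inv_eq_one _ _ R.normalized_right, Algebra.TensorProduct.one_def, tensorOp_tmul]
  congr 1
  · simp
  · ext; simp

/-- The left action `h (a # φ) = a # (h ⇀ φ)` of `H` on `A ⊗ H*`. -/
def quasiSmashAct (_R : RightComoduleAlgebra Q A) :
    H →ₐ[k] Module.End k (A ⊗[k] Module.Dual k H) :=
  (Module.End.lTensorAlgHom k (Module.Dual k H) A).comp (dualLeft k H)

@[simp]
theorem quasiSmashAct_tmul (h : H) (a : A) (φ : Module.Dual k H) :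
    R.quasiSmashAct h (a ⊗ₜ φ) = a ⊗ₜ[k] dualLeft k H h φ := rfl

theorem quasiSmashMul_assoc (x y z : A ⊗[k] Module.Dual k H) :
    R.quasiSmashMul (R.quasiSmashMul x y) z =
      TensorProduct.lift R.quasiSmashMul (LinearMap.lTensor _ (TensorProduct.lift R.quasiSmashMul)
        (tensorOp R.quasiSmashAct.toLinearMap
          (tensorOp R.quasiSmashAct.toLinearMap R.quasiSmashAct.toLinearMap) ↑Q.Φ
          (x ⊗ₜ (y ⊗ₜ z)))) := by
  induction x with
  | zero => simp
  | add x x' hx hx' => simp only [map_add, add_tmul, LinearMap.add_apply, hx, hx']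
  | tmul a φ =>
  induction y with
  | zero => simp
  | add x x' hx hx' => simp only [map_add, add_tmul, tmul_add, LinearMap.add_apply, hx, hx']
  | tmul a' ψ =>
  induction z with
  | zero => simp
  | add x x' hx hx' => simp only [map_add, tmul_add, LinearMap.add_apply, hx, hx']
  | tmul a'' χ =>
  have left (P : A ⊗[k] (H ⊗[k] H)) : R.quasiSmashMul (R.spread a (φ ⊗ₜ ψ) P) (a'' ⊗ₜ χ) =
      R.spread₃ a (dualLeft₃ k H ↑Q.Φ (φ ⊗ₜ (ψ ⊗ₜ χ)))
        (appendOne k A H P * onRight A (splitLeft H Q.Δ) (R.extend (R.ρ a'') * ↑R.Φρ⁻¹) *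
          prependOne k A (H ⊗[k] (H ⊗[k] H)) ↑Q.Φ⁻¹) := by
    induction P with
    | zero => simp [tensor_mul_zero, tensor_zero_mul]
    | add x y hx hy =>
      simp only [map_add, LinearMap.add_apply, tensor_mul_add, tensor_add_mul, hx, hy]
    | tmul b P =>
    induction P with
    | zero => simp [tensor_mul_zero, tensor_zero_mul]
    | add x y hx hy =>
      simp only [map_add, LinearMap.add_apply, tensor_mul_add, tensor_add_mul, tmul_add, hx, hy]
    | tmul p q => rw [spread_tmul, quasiSmashMul_tmul, quasiSmashMul_left]
  have right (φ ψ χ : Module.Dual k H) (P : A ⊗[k] (H ⊗[k] H)) :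
      R.quasiSmashMul (a ⊗ₜ φ) (R.spread a' (ψ ⊗ₜ χ) P) =
        R.spread₃ a (φ ⊗ₜ (ψ ⊗ₜ χ))
          (appendOne k A H (R.extend (R.ρ a')) * splitLeft (H ⊗[k] H) R.ρ P *
            onRight A (onRight H Q.Δ) ↑R.Φρ⁻¹) := by
    induction P with
    | zero => simp [tensor_mul_zero, tensor_zero_mul]
    | add x y hx hy =>
      simp only [map_add, LinearMap.add_apply, tensor_mul_add, tensor_add_mul, hx, hy]
    | tmul b P =>
    induction P with
    | zero => simp [tensor_mul_zero, tensor_zero_mul]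
    | add x y hx hy =>
      simp only [map_add, LinearMap.add_apply, tensor_mul_add, tensor_add_mul, tmul_add, hx, hy]
    | tmul p q => rw [spread_tmul, quasiSmashMul_tmul, quasiSmashMul_right]
  rw [quasiSmashMul_tmul, left, quasiSmash_tensor]
  induction (Q.Φ : H ⊗[k] (H ⊗[k] H)) with
  | zero => simp [spread₃_zero]
  | add x y hx hy => simp only [map_add, LinearMap.add_apply, spread₃_add, hx, hy]
  | tmul x T =>
  induction T with
  | zero => simp [spread₃_zero]
  | add x y hx hy => simp only [map_add, LinearMap.add_apply, tmul_add, spread₃_add, hx, hy]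
  | tmul y z =>
  simp only [tensorOp_tmul, AlgHom.toLinearMap_apply, quasiSmashAct_tmul, LinearMap.lTensor_tmul,
    TensorProduct.lift.tmul, dualLeft₃_tmul]
  rw [R.quasiSmashMul_tmul a', right]

theorem quasiSmashAct_mul (h : H) (x y : A ⊗[k] Module.Dual k H) :
    R.quasiSmashAct h (R.quasiSmashMul x y) =
      TensorProduct.lift R.quasiSmashMul
        (tensorOp R.quasiSmashAct.toLinearMap R.quasiSmashAct.toLinearMap (Q.Δ h)
          (x ⊗ₜ y)) := by
  induction x with
  | zero => simp
  | add x x' hx hx' => simp only [map_add, add_tmul, LinearMap.add_apply, hx, hx']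
  | tmul a φ =>
  induction y with
  | zero => simp
  | add x x' hx hx' => simp only [map_add, add_tmul, tmul_add, LinearMap.add_apply, hx, hx']
  | tmul a' ψ =>
  have left (P : A ⊗[k] (H ⊗[k] H)) : R.quasiSmashAct h (R.spread a (φ ⊗ₜ ψ) P) =
      R.spread a (tensorOp (dualLeft k H).toLinearMap (dualLeft k H).toLinearMap (Q.Δ h)
        (φ ⊗ₜ ψ)) P := by
    induction P with
    | zero => simp
    | add x y hx hy => simp only [map_add, hx, hy]
    | tmul b P =>
    induction P with
    | zero => simp
    | add x y hx hy => simp only [map_add, tmul_add, hx, hy]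
    | tmul p q =>
    rw [spread_tmul, quasiSmashAct_tmul, dualLeft_convolution]
    induction Q.Δ h with
    | zero => simp [spread_zero]
    | add x y hx hy => simp only [map_add, LinearMap.add_apply, tmul_add, spread_add, hx, hy]
    | tmul x y => simp [dualRight_dualLeft]
  rw [quasiSmashMul_tmul, left]
  induction Q.Δ h with
  | zero => simp [spread_zero]
  | add x y hx hy => simp only [map_add, LinearMap.add_apply, spread_add, hx, hy]
  | tmul x y => rfl

/-- The quasi-smash product `A # H*` of a right `H`-comodule algebra `A` with the dual `H*`, as a
left `H`-module algebra on the space `A ⊗ H*`, with unit `1 # ε` and `h (a # φ) = a # (h ⇀ φ)`. -/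
def quasiSmash : LeftModuleAlgebra Q (A ⊗[k] Module.Dual k H) where
  act := R.quasiSmashAct
  mul := R.quasiSmashMul
  one := 1 ⊗ₜ Q.ε.toLinearMap
  one_mul := R.one_quasiSmashMul
  mul_one := R.quasiSmashMul_one
  mul_assoc := R.quasiSmashMul_assoc
  act_mul := R.quasiSmashAct_mul
  act_one h := by rw [quasiSmashAct_tmul, dualLeft_counit, tmul_smul]

end RightComoduleAlgebra

end QuasiSmash

section TwoSidedHopfModule

variable {k H A : Type*} [Field k] [Ring H] [Algebra k H] [Ring A] [Algebra k A]
  {Q : QuasiBialgebra k H}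

/-- A two-sided Hopf module over a right `H`-comodule algebra `A`: a `k`-vector space `M` with
commuting left `H`-action and right `A`-action, and a linear map `coact : M → M ⊗ H` that is
counital, is coassociative up to `Φ` and `Φρ`, and is compatible with both actions. -/
structure TwoSidedHopfModule (R : RightComoduleAlgebra Q A) where
  /-- the underlying vector space -/
  carrier : Type w
  [addCommGroup : AddCommGroup carrier]
  [module : Module k carrier]
  /-- the left action of `H` -/
  lact : H →ₐ[k] Module.End k carrier
  /-- the right action of `A`: `ract a m` is `m a` -/
  ract : A →ₗ[k] Module.End k carrier
  ract_one : ∀ m : carrier, ract 1 m = m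
  ract_mul : ∀ (a b : A) (m : carrier), ract (a * b) m = ract b (ract a m)
  lact_ract : ∀ (h : H) (a : A) (m : carrier), ract a (lact h m) = lact h (ract a m)
  /-- the right coaction of `H` -/
  coact : carrier →ₗ[k] carrier ⊗[k] H
  counit : ∀ m : carrier,
    TensorProduct.rid k carrier (LinearMap.lTensor carrier Q.ε.toLinearMap (coact m)) = m
  /-- `Φ · (coact ⊗ id)(coact m) = (id ⊗ Δ)(coact m) · Φρ` -/
  quasi_coassoc : ∀ m : carrier,
    tensorOp lact.toLinearMap (tensorOp (LinearMap.mul k H) (LinearMap.mul k H)) ↑Q.Φ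
        (TensorProduct.assoc k carrier H H (LinearMap.rTensor H coact (coact m))) =
      tensorOp ract (tensorOp (LinearMap.mul k H).flip (LinearMap.mul k H).flip) ↑R.Φρ
        (LinearMap.lTensor carrier Q.Δ.toLinearMap (coact m))
  /-- `coact (h m) = ∑ h₁ m₀ ⊗ h₂ m₁` -/
  coact_lact : ∀ (h : H) (m : carrier),
    coact (lact h m) = tensorOp lact.toLinearMap (LinearMap.mul k H) (Q.Δ h) (coact m)
  /-- `coact (m a) = ∑ m₀ a₀ ⊗ m₁ a₁` -/
  coact_ract : ∀ (a : A) (m : carrier),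
    coact (ract a m) = tensorOp ract (LinearMap.mul k H).flip (R.ρ a) (coact m)

namespace TwoSidedHopfModule

attribute [instance] addCommGroup module

variable {R : RightComoduleAlgebra Q A}

/-- Morphisms of two-sided Hopf modules: left `H`-linear, right `A`-linear and right `H`-colinear
maps. -/
@[ext]
structure Hom (M N : TwoSidedHopfModule.{w} R) where
  /-- the underlying linear map -/
  toLinearMap : M.carrier →ₗ[k] N.carrier
  map_lact : ∀ (h : H) (m : M.carrier), toLinearMap (M.lact h m) = N.lact h (toLinearMap m)
  map_ract : ∀ (a : A) (m : M.carrier), toLinearMap (M.ract a m) = N.ract a (toLinearMap m)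
  map_coact : ∀ m : M.carrier,
    LinearMap.rTensor H toLinearMap (M.coact m) = N.coact (toLinearMap m)

/-- The category of two-sided Hopf modules. -/
instance : Category (TwoSidedHopfModule.{w} R) where
  Hom M N := Hom M N
  id M :=
    { toLinearMap := LinearMap.id
      map_lact := fun _ _ ↦ rfl
      map_ract := fun _ _ ↦ rfl
      map_coact := fun m ↦ by simp }
  comp f g :=
    { toLinearMap := g.toLinearMap ∘ₗ f.toLinearMap
      map_lact := fun h m ↦ by simp [f.map_lact, g.map_lact]
      map_ract := fun a m ↦ by simp [f.map_ract, g.map_ract]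
      map_coact := fun m ↦ by
        rw [LinearMap.rTensor_comp, LinearMap.comp_apply, f.map_coact, g.map_coact,
          LinearMap.comp_apply] }

/-- The forgetful functor to vector spaces. -/
def forgetToModuleCat (R : RightComoduleAlgebra Q A) :
    TwoSidedHopfModule.{w} R ⥤ ModuleCat.{w} k where
  obj M := ModuleCat.of k M.carrier
  map f := ModuleCat.ofHom f.toLinearMap

end TwoSidedHopfModule

end TwoSidedHopfModule

end

end QuasiHopf

/-! The right module attached to a two-sided Hopf module `M` is built from a twisted coaction `V(m)
= f ρ_M(m) p`. Here `f ∈ H ⊗ H` is the Drinfeld twist, which satisfies `f Δ(S(h)) = (S ⊗ S)(Δᵒᵖ(h))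
f`, and `p = ∑ x¹ ⊗ x² β S(x³)` is formed from `Φρ⁻¹`. The action is `m · h = S(h) ≻ m` and `m · (a
# φ) = ∑ φ(S⁻¹(v₁)) v₀`, where `V(m ≺ a) = ∑ v₀ ⊗ v₁`. As `H` is finite dimensional and `S` is
bijective, `V` is determined by these operators, and every family linear in `φ` comes from some `V`.
The axioms of `IsTwistedCoaction` then translate one by one into the relations of the smash product:
compatibility with `H` is the rule for moving `1 # h` past `a # φ`, compatibility with `A` is the
product of `1 # φ` and `a # ε`, coassociativity is the product of `1 # φ` and `1 # ψ`, and
counitality is the unit.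

The main work is the bijection between coactions and twisted coactions. With `q = ∑ X¹ ⊗ S(X²) α X³`
formed from `Φρ`, the coaction is recovered as `f⁻¹ ∑ V(m ≺ q¹) (1 ⊗ q²)`, by the two zigzag
identities `qElt_pElt` and `pElt_qElt`. For coassociativity, the compatibility of `f` with `Φ`
(`drinfeld_cocycle`) and the identity `qElt_coherence` show that the two sides of the axiom for
`ρ_M` arise from the two sides for `V` by the same procedure: insert an element `q₂` made of two
copies of `q`, then act by the same unit of `H ⊗ H ⊗ H`. Both can be cancelled (`qElt₂_cancel`,
`twistInv_isUnit`). No formula for `f⁻¹` is needed: right multiplication by `f` is injective on a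
finite dimensional space, hence `f` is a unit.

All tensor identities are computed by evaluating tensors in one algebra `W` through commuting
algebra maps, the legs. If `W` consists of operators on an algebra `B`, left multiplication by
`S(h)` and right multiplication by `h` are both legs, and `α` becomes a vector on which the two
cancel through `∑ S(h₁) α h₂ = ε(h) α`; dually for `β`. In this way identities containing antipodes
become instances of the cocycle condition. Comments write `a⋆b` for `join`, `Φ[a,b,c]` and
`Φ⁻[a,b,c]` for `phi` and `phiInv`, and `T[b,c,d,e]` for `tau`. -/

namespace QuasiHopf

noncomputable section

/-! ### Evaluating tensors through commuting legs -/

section Legs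

variable {k W Y A B C H : Type*} [Field k] [Ring W] [Algebra k W] [AddCommGroup Y] [Module k Y]
  [Ring A] [Algebra k A] [Ring B] [Algebra k B] [Ring C] [Algebra k C] [Ring H] [Algebra k H]

/-- The linear map `x ⊗ y ↦ f x * g y`. -/
def leg (f : A →ₗ[k] W) (g : B →ₗ[k] W) : A ⊗[k] B →ₗ[k] W :=
  LinearMap.mul' k W ∘ₗ TensorProduct.map f g

@[simp]
theorem leg_tmul (f : A →ₗ[k] W) (g : B →ₗ[k] W) (x : A) (y : B) :
    leg f g (x ⊗ₜ y) = f x * g y := rfl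

/-- The composite of `leg f g` with a comultiplication `δ`. -/
def join (δ : C →ₐ[k] A ⊗[k] B) (f : A →ₗ[k] W) (g : B →ₗ[k] W) : C →ₗ[k] W :=
  leg f g ∘ₗ δ.toLinearMap

theorem join_apply (δ : C →ₐ[k] A ⊗[k] B) (f : A →ₗ[k] W) (g : B →ₗ[k] W) (x : C) :
    join δ f g x = leg f g (δ x) := rfl

/-- A linear map that is unital and multiplicative. -/
structure IsLeg (f : A →ₗ[k] W) : Prop where
  unital : f 1 = 1
  multiplicative : ∀ x y, f (x * y) = f x * f y

/-- Two linear maps whose values commute. -/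
def Comm (f : A →ₗ[k] W) (g : B →ₗ[k] W) : Prop := ∀ x y, f x * g y = g y * f x

theorem Comm.symm {f : A →ₗ[k] W} {g : B →ₗ[k] W} (h : Comm f g) : Comm g f :=
  fun x y ↦ (h y x).symm

theorem Comm.leg_right {f : A →ₗ[k] W} {g : B →ₗ[k] W} {h : C →ₗ[k] W} (hg : Comm f g)
    (hh : Comm f h) : Comm f (leg g h) := by
  intro x t
  induction t with
  | zero => simp
  | add y z hy hz => simp only [map_add, mul_add, add_mul, hy, hz]
  | tmul y z => rw [leg_tmul, ← mul_assoc, hg, mul_assoc, hh, mul_assoc]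

theorem Comm.leg_left {f : A →ₗ[k] W} {g : B →ₗ[k] W} {h : C →ₗ[k] W} (hf : Comm f h)
    (hg : Comm g h) : Comm (leg f g) h :=
  (hf.symm.leg_right hg.symm).symm

theorem Comm.join_right {D : Type*} [Ring D] [Algebra k D] {δ : D →ₐ[k] B ⊗[k] C}
    {f : A →ₗ[k] W} {g : B →ₗ[k] W} {h : C →ₗ[k] W} (hg : Comm f g)
    (hh : Comm f h) : Comm f (join δ g h) :=
  fun x y ↦ hg.leg_right hh x (δ y)

theorem Comm.join_left {D : Type*} [Ring D] [Algebra k D] {δ : D →ₐ[k] A ⊗[k] B}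
    {f : A →ₗ[k] W} {g : B →ₗ[k] W} {h : C →ₗ[k] W} (hf : Comm f h)
    (hg : Comm g h) : Comm (join δ f g) h :=
  (hf.symm.join_right hg.symm).symm

/-- In `f a * g b * (f a' * g b')` the only obstruction to multiplicativity is the order of `g b`
and `f a'`, which `Comm` removes. -/
theorem IsLeg.leg {f : A →ₗ[k] W} {g : B →ₗ[k] W} (hf : IsLeg f) (hg : IsLeg g)
    (h : Comm f g) : IsLeg (leg f g) where
  unital := by rw [Algebra.TensorProduct.one_def, leg_tmul, hf.unital, hg.unital, mul_one]
  multiplicative s t := by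
    induction s with
    | zero => simp
    | add y z hy hz => simp only [map_add, add_mul, hy, hz]
    | tmul a b =>
    induction t with
    | zero => simp
    | add y z hy hz => simp only [map_add, mul_add, hy, hz]
    | tmul a' b' =>
    rw [Algebra.TensorProduct.tmul_mul_tmul, leg_tmul, leg_tmul, leg_tmul, hf.multiplicative, hg.multiplicative,
      mul_assoc, mul_assoc, ← mul_assoc (f a'), h, mul_assoc]

theorem IsLeg.join {δ : C →ₐ[k] A ⊗[k] B} {f : A →ₗ[k] W} {g : B →ₗ[k] W} (hf : IsLeg f)
    (hg : IsLeg g) (h : Comm f g) : IsLeg (join δ f g) where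
  unital := by rw [join_apply, map_one, (hf.leg hg h).unital]
  multiplicative x y := by rw [join_apply, map_mul, (hf.leg hg h).multiplicative]; rfl

theorem IsLeg.algHom (f : A →ₐ[k] W) : IsLeg f.toLinearMap := ⟨map_one f, map_mul f⟩

theorem IsLeg.mul_inv {f : A →ₗ[k] W} (hf : IsLeg f) (x : Aˣ) : f ↑x * f ↑x⁻¹ = 1 := by
  rw [← hf.multiplicative, Units.mul_inv, hf.unital]

theorem IsLeg.inv_mul {f : A →ₗ[k] W} (hf : IsLeg f) (x : Aˣ) : f ↑x⁻¹ * f ↑x = 1 := by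
  rw [← hf.multiplicative, Units.inv_mul, hf.unital]

/-! Legs of images under the structural maps of iterated tensor products. -/

theorem leg_onRight {D : Type*} [Ring D] [Algebra k D] (f : A →ₗ[k] W) (g : D →ₗ[k] W)
    (φ : B →ₐ[k] D) (t : A ⊗[k] B) :
    leg f g (onRight A φ t) = leg f (g ∘ₗ φ.toLinearMap) t := by
  induction t with
  | zero => simp
  | add y z hy hz => simp only [map_add, hy, hz]
  | tmul a b => rfl

theorem leg_assoc (f : A →ₗ[k] W) (g : B →ₗ[k] W) (h : C →ₗ[k] W) (t : A ⊗[k] B) (c : C) :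
    leg f (leg g h) (Algebra.TensorProduct.assoc k k k A B C (t ⊗ₜ c)) = leg f g t * h c := by
  induction t with
  | zero => simp
  | add y z hy hz => simp only [map_add, add_tmul, add_mul, hy, hz]
  | tmul a b => simp [mul_assoc]

/-- This is how a comultiplication or coaction inside a tensor identity turns into a convolution of
legs; `leg_onRight` does the same for the right factor. -/
theorem leg_splitLeft {D : Type*} [Ring D] [Algebra k D] (δ : D →ₐ[k] A ⊗[k] B)
    (f : A →ₗ[k] W) (g : B →ₗ[k] W) (h : C →ₗ[k] W) (t : D ⊗[k] C) :
    leg f (leg g h) (splitLeft C δ t) = leg (join δ f g) h t := by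
  induction t with
  | zero => simp
  | add y z hy hz => simp only [map_add, hy, hz]
  | tmul a b => rw [splitLeft_tmul, leg_assoc]; rfl

theorem leg_appendOne (f : A →ₗ[k] W) (g h i : H →ₗ[k] W) (hi : i 1 = 1)
    (t : A ⊗[k] (H ⊗[k] H)) :
    leg f (leg g (leg h i)) (appendOne k A H t) = leg f (leg g h) t := by
  rw [appendOne, leg_onRight]
  congr 2
  ext x y
  simp [hi]

theorem leg_prependOne (f : A →ₗ[k] W) (g : B →ₗ[k] W) (hf : f 1 = 1) (t : B) :
    leg f g (prependOne k A B t) = g t := by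
  rw [prependOne_apply, leg_tmul, hf, one_mul]

/-! Moving an element past a leg. -/

theorem mul_leg_left {f f' : A →ₗ[k] W} {g : B →ₗ[k] W} {u : W}
    (hf : ∀ x, u * f x = f' x * u) (hg : ∀ y, u * g y = g y * u) (t : A ⊗[k] B) :
    u * leg f g t = leg f' g t * u := by
  induction t with
  | zero => simp
  | add y z hy hz => simp only [map_add, mul_add, add_mul, hy, hz]
  | tmul a b => rw [leg_tmul, leg_tmul, ← mul_assoc, hf, mul_assoc, hg, mul_assoc]

theorem mul_leg_right {f : A →ₗ[k] W} {g g' : B →ₗ[k] W} {u : W}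
    (hf : ∀ x, u * f x = f x * u) (hg : ∀ y, u * g y = g' y * u) (t : A ⊗[k] B) :
    u * leg f g t = leg f g' t * u := by
  induction t with
  | zero => simp
  | add y z hy hz => simp only [map_add, mul_add, add_mul, hy, hz]
  | tmul a b => rw [leg_tmul, leg_tmul, ← mul_assoc, hf, mul_assoc, hg, mul_assoc]

/-! Legs that a functional cannot tell apart. -/

/-- `s (f x * z) = s (f' x * z)` for all `x` and `z`. -/
def LeftAgree (s : W →ₗ[k] Y) (f f' : A →ₗ[k] W) : Prop := ∀ x z, s (f x * z) = s (f' x * z)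

/-- `s (z * f x) = s (z * f' x)` for all `x` and `z`. -/
def RightAgree (s : W →ₗ[k] Y) (f f' : A →ₗ[k] W) : Prop := ∀ x z, s (z * f x) = s (z * f' x)

theorem LeftAgree.leg_left {s : W →ₗ[k] Y} {f f' : A →ₗ[k] W} (h : LeftAgree s f f')
    (g : B →ₗ[k] W) : LeftAgree s (leg f g) (leg f' g) := by
  intro t z
  induction t with
  | zero => simp
  | add y z hy hz => simp only [map_add, add_mul, hy, hz]
  | tmul a b => simp only [leg_tmul, mul_assoc]; exact h a _

/-- The functional only sees what stands leftmost, so the second leg has to be moved in front of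
`f`; hence both versions must commute with `f`. -/
theorem LeftAgree.leg_right {s : W →ₗ[k] Y} {g g' : B →ₗ[k] W} (h : LeftAgree s g g')
    {f : A →ₗ[k] W} (hg : Comm f g) (hg' : Comm f g') : LeftAgree s (leg f g) (leg f g') := by
  intro t z
  induction t with
  | zero => simp
  | add y z hy hz => simp only [map_add, add_mul, hy, hz]
  | tmul a b => simp only [leg_tmul]; rw [hg, hg', mul_assoc, mul_assoc]; exact h b _

theorem LeftAgree.join_left {s : W →ₗ[k] Y} {f f' : A →ₗ[k] W} (h : LeftAgree s f f')
    (δ : C →ₐ[k] A ⊗[k] B) (g : B →ₗ[k] W) : LeftAgree s (join δ f g) (join δ f' g) :=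
  fun x z ↦ h.leg_left g (δ x) z

theorem LeftAgree.join_right {s : W →ₗ[k] Y} {g g' : B →ₗ[k] W} (h : LeftAgree s g g')
    (δ : C →ₐ[k] A ⊗[k] B) {f : A →ₗ[k] W} (hg : Comm f g) (hg' : Comm f g') :
    LeftAgree s (join δ f g) (join δ f g') :=
  fun x z ↦ h.leg_right hg hg' (δ x) z

theorem RightAgree.leg_right {s : W →ₗ[k] Y} {g g' : B →ₗ[k] W} (h : RightAgree s g g')
    (f : A →ₗ[k] W) : RightAgree s (leg f g) (leg f g') := by
  intro t z
  induction t with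
  | zero => simp
  | add y z hy hz => simp only [map_add, mul_add, hy, hz]
  | tmul a b => simp only [leg_tmul, ← mul_assoc]; exact h b _

theorem RightAgree.leg_left {s : W →ₗ[k] Y} {f f' : A →ₗ[k] W} (h : RightAgree s f f')
    {g : B →ₗ[k] W} (hf : Comm f g) (hf' : Comm f' g) : RightAgree s (leg f g) (leg f' g) := by
  intro t z
  induction t with
  | zero => simp
  | add y z hy hz => simp only [map_add, mul_add, hy, hz]
  | tmul a b => simp only [leg_tmul]; rw [hf, hf', ← mul_assoc, ← mul_assoc]; exact h a _

theorem RightAgree.join_right {s : W →ₗ[k] Y} {g g' : B →ₗ[k] W} (h : RightAgree s g g')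
    (δ : C →ₐ[k] A ⊗[k] B) (f : A →ₗ[k] W) : RightAgree s (join δ f g) (join δ f g') :=
  fun x z ↦ h.leg_right f (δ x) z

/-- The leg `h ↦ ε(h) 1`. -/
def counitLeg (W : Type*) [Ring W] [Algebra k W] (ε : H →ₐ[k] k) : H →ₗ[k] W :=
  ((Algebra.ofId k W).comp ε).toLinearMap

theorem counitLeg_apply (ε : H →ₐ[k] k) (h : H) : counitLeg W ε h = algebraMap k W (ε h) := rfl

theorem isLeg_counitLeg (ε : H →ₐ[k] k) : IsLeg (counitLeg W ε) := IsLeg.algHom _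

theorem comm_counitLeg (ε : H →ₐ[k] k) (f : A →ₗ[k] W) : Comm f (counitLeg W ε) :=
  fun _ _ ↦ (Algebra.commutes _ _).symm

theorem leg_counitLeg_right (ε : H →ₐ[k] k) (f : A →ₗ[k] W) (t : A ⊗[k] H) :
    leg f (counitLeg W ε) t = f (dropRight A ε t) := by
  induction t with
  | zero => simp
  | add y z hy hz => simp only [map_add, hy, hz]
  | tmul a b => 
    rw [leg_tmul, dropRight_tmul, counitLeg_apply, map_smul, Algebra.smul_def, Algebra.commutes]

theorem leg_counitLeg_left (ε : H →ₐ[k] k) (f : A →ₗ[k] W) (t : H ⊗[k] A) :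
    leg (counitLeg W ε) f t = f (dropLeft A ε t) := by
  induction t with
  | zero => simp
  | add y z hy hz => simp only [map_add, hy, hz]
  | tmul a b => rw [leg_tmul, dropLeft_tmul, counitLeg_apply, map_smul, Algebra.smul_def]

end Legs

/-! ### Reassociators evaluated on legs -/

section Cocycle

variable {k W Y A H : Type*} [Field k] [Ring W] [Algebra k W] [AddCommGroup Y] [Module k Y]
  [Ring A] [Algebra k A] [Ring H] [Algebra k H] {Q : QuasiBialgebra k H}

/-- The cocycle condition in terms of commuting legs. -/
theorem leg_cocycle {ρ : A →ₐ[k] A ⊗[k] H} {ψ : A ⊗[k] (H ⊗[k] H)}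
    (h : prependOne k A (H ⊗[k] (H ⊗[k] H)) ↑Q.Φ * onRight A (splitLeft H Q.Δ) ψ *
        appendOne k A H ψ = onRight A (onRight H Q.Δ) ψ * splitLeft (H ⊗[k] H) ρ ψ)
    {a : A →ₗ[k] W} {b c d : H →ₗ[k] W} (ha : IsLeg a) (hb : IsLeg b) (hc : IsLeg c)
    (hd : IsLeg d) (hab : Comm a b) (hac : Comm a c) (had : Comm a d) (hbc : Comm b c)
    (hbd : Comm b d) (hcd : Comm c d) :
    leg b (leg c d) ↑Q.Φ * leg a (leg (join Q.Δ b c) d) ψ * leg a (leg b c) ψ =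
      leg a (leg b (join Q.Δ c d)) ψ * leg (join ρ a b) (leg c d) ψ := by
  -- Four commuting legs make up one algebra map on the fourfold tensor product, which is applied to
  -- both sides of the cocycle condition.
  have hF : IsLeg (leg a (leg b (leg c d))) :=
    ha.leg (hb.leg (hc.leg hd hcd) (hbc.leg_right hbd)) (hab.leg_right (hac.leg_right had))
  have := congrArg (leg a (leg b (leg c d))) h
  rw [hF.multiplicative, hF.multiplicative, hF.multiplicative, leg_prependOne _ _ ha.unital,
    leg_appendOne _ _ _ _ hd.unital, leg_splitLeft, leg_onRight, leg_onRight] at this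
  have h₁ : leg b (leg c d) ∘ₗ (splitLeft H Q.Δ).toLinearMap = leg (join Q.Δ b c) d := by
    ext x y; exact leg_splitLeft Q.Δ b c d (x ⊗ₜ y)
  have h₂ : leg b (leg c d) ∘ₗ (onRight H Q.Δ).toLinearMap = leg b (join Q.Δ c d) := by
    ext x y; rfl
  rwa [h₁, h₂] at this

/-- `(id ⊗ id ⊗ ε)(Φ) = 1`. -/
theorem QuasiBialgebra.normalized_right (Q : QuasiBialgebra k H) :
    onRight H (dropRight H Q.ε) (Q.Φ : H ⊗[k] (H ⊗[k] H)) = 1 := by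
  set i : H →ₗ[k] H ⊗[k] H := (Algebra.TensorProduct.includeLeft : H →ₐ[k] H ⊗[k] H).toLinearMap
  set j : H →ₗ[k] H ⊗[k] H := (Algebra.TensorProduct.includeRight : H →ₐ[k] H ⊗[k] H).toLinearMap
  set e : H →ₗ[k] H ⊗[k] H := counitLeg (H ⊗[k] H) Q.ε
  have hi : IsLeg i := IsLeg.algHom _
  have hj : IsLeg j := IsLeg.algHom _
  have he : IsLeg e := isLeg_counitLeg _
  have hij : Comm i j := fun x y ↦ by simp [i, j]
  have hie : Comm i e := comm_counitLeg _ _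
  have hje : Comm j e := comm_counitLeg _ _
  -- This is `id ⊗ id ⊗ ε ⊗ ε` applied to the cocycle condition. With `u = (id ⊗ id ⊗ ε)(Φ)` it
  -- becomes `u * u = u`, and the unit `u` must be `1`.
  have key := leg_cocycle (Q := Q) (ρ := Q.Δ) Q.cocycle hi hj he he hij hie hie hje hje
    (comm_counitLeg _ _)
  have aux (f g : H →ₗ[k] H ⊗[k] H) (hf : IsLeg f) (hfe : Comm f e) :
      leg f (leg e e) (Q.Φ : H ⊗[k] (H ⊗[k] H)) = 1 := by
    have h₁ : leg e e = e ∘ₗ (dropLeft H Q.ε).toLinearMap := by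
      ext x y; exact leg_counitLeg_left Q.ε e (x ⊗ₜ y)
    rw [h₁, ← leg_onRight, Q.normalized, (hf.leg he hfe).unital]
  have h₂ : join Q.Δ j e = j := by
    ext x; rw [join_apply, leg_counitLeg_right, Q.counit_right]
  have h₃ : join Q.Δ e e = e := by
    ext x; rw [join_apply, leg_counitLeg_right, Q.counit_right]
  rw [aux j e hj hje, aux _ e (hi.join hj hij) (comm_counitLeg _ _), h₂, h₃, one_mul, mul_one] at key
  have hF : IsLeg (leg i (leg j e)) := hi.leg (hj.leg he hje) (hij.leg_right hie)
  have h₄ : leg i (leg j e) (Q.Φ : H ⊗[k] (H ⊗[k] H)) = 1 := by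
    calc leg i (leg j e) (Q.Φ : H ⊗[k] (H ⊗[k] H)) = leg i (leg j e) ↑Q.Φ⁻¹ *
        (leg i (leg j e) ↑Q.Φ * leg i (leg j e) ↑Q.Φ) := by
          rw [← mul_assoc, hF.inv_mul, one_mul]
      _ = 1 := by rw [key, hF.inv_mul]
  rw [← h₄]
  have h₅ : leg j e = j ∘ₗ (dropRight H Q.ε).toLinearMap := by
    ext x y; exact leg_counitLeg_right Q.ε j (x ⊗ₜ y)
  rw [h₅, ← leg_onRight]
  have h₆ : leg i j = LinearMap.id := by
    ext x y; simp [i, j]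
  rw [h₆]; rfl

/-- A quasi-bialgebra as a right comodule algebra over itself. -/
def QuasiBialgebra.self (Q : QuasiBialgebra k H) : RightComoduleAlgebra Q H where
  ρ := Q.Δ
  Φρ := Q.Φ
  quasi_coassoc h := by rw [Q.quasi_coassoc, Units.inv_mul_cancel_right]
  cocycle := Q.cocycle
  counit := Q.counit_right
  normalized_middle := Q.normalized
  normalized_right := Q.normalized_right

namespace RightComoduleAlgebra

variable (R : RightComoduleAlgebra Q A)

/-- The image of `Φρ` under three legs. -/
def phi (a : A →ₗ[k] W) (b c : H →ₗ[k] W) : W := leg a (leg b c) ↑R.Φρ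

/-- The image of the inverse of `Φρ` under three legs. -/
def phiInv (a : A →ₗ[k] W) (b c : H →ₗ[k] W) : W := leg a (leg b c) ↑R.Φρ⁻¹

variable {R} {a a' : A →ₗ[k] W} {b b' c c' d e : H →ₗ[k] W}

theorem phi_mul_phiInv (ha : IsLeg a) (hb : IsLeg b) (hc : IsLeg c) (hab : Comm a b)
    (hac : Comm a c) (hbc : Comm b c) : R.phi a b c * R.phiInv a b c = 1 :=
  (ha.leg (hb.leg hc hbc) (hab.leg_right hac)).mul_inv _

theorem phiInv_mul_phi (ha : IsLeg a) (hb : IsLeg b) (hc : IsLeg c) (hab : Comm a b)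
    (hac : Comm a c) (hbc : Comm b c) : R.phiInv a b c * R.phi a b c = 1 :=
  (ha.leg (hb.leg hc hbc) (hab.leg_right hac)).inv_mul _

theorem phi_cocycle (ha : IsLeg a) (hb : IsLeg b) (hc : IsLeg c)
    (hd : IsLeg d) (hab : Comm a b) (hac : Comm a c) (had : Comm a d) (hbc : Comm b c)
    (hbd : Comm b d) (hcd : Comm c d) :
    Q.self.phi b c d * R.phi a (join Q.Δ b c) d * R.phi a b c =
      R.phi a b (join Q.Δ c d) * R.phi (join R.ρ a b) c d :=
  leg_cocycle R.cocycle ha hb hc hd hab hac had hbc hbd hcd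

theorem phi_coassoc (ha : IsLeg a) (hb : IsLeg b) (hc : IsLeg c) (hab : Comm a b)
    (hac : Comm a c) (hbc : Comm b c) (x : A) :
    R.phi a b c * join R.ρ (join R.ρ a b) c x =
      join R.ρ a (join Q.Δ b c) x * R.phi a b c := by
  have hF : IsLeg (leg a (leg b c)) := ha.leg (hb.leg hc hbc) (hab.leg_right hac)
  have := congrArg (leg a (leg b c)) (R.quasi_coassoc x)
  rw [hF.multiplicative, hF.multiplicative, leg_splitLeft, leg_onRight] at this
  exact this

theorem phiInv_coassoc (ha : IsLeg a) (hb : IsLeg b) (hc : IsLeg c) (hab : Comm a b)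
    (hac : Comm a c) (hbc : Comm b c) (x : A) :
    R.phiInv a b c * join R.ρ a (join Q.Δ b c) x =
      join R.ρ (join R.ρ a b) c x * R.phiInv a b c := by
  have h := phi_coassoc (R := R) ha hb hc hab hac hbc x
  calc R.phiInv a b c * join R.ρ a (join Q.Δ b c) x
      = R.phiInv a b c * (join R.ρ a (join Q.Δ b c) x * R.phi a b c) * R.phiInv a b c := by
        rw [mul_assoc, mul_assoc, phi_mul_phiInv ha hb hc hab hac hbc, mul_one]
    _ = _ := by rw [← h, ← mul_assoc, phiInv_mul_phi ha hb hc hab hac hbc, one_mul]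

theorem leg_one_of_onRight {ψ : A ⊗[k] (H ⊗[k] H)} {φ : H ⊗[k] H →ₐ[k] H}
    (h : onRight A φ ψ = 1) (ha : IsLeg a) (hb : IsLeg b) (hab : Comm a b)
    (hφ : ∀ t, leg c d t = b (φ t)) : leg a (leg c d) ψ = 1 := by
  have : leg c d = b ∘ₗ φ.toLinearMap := by ext x y; exact hφ (x ⊗ₜ y)
  rw [this, ← leg_onRight, h, (ha.leg hb hab).unital]

theorem phi_counit_middle (ha : IsLeg a) (hb : IsLeg b) (hab : Comm a b) :
    R.phi a (counitLeg W Q.ε) b = 1 :=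
  leg_one_of_onRight R.normalized_middle ha hb hab (leg_counitLeg_left _ _)

theorem phi_counit_right (ha : IsLeg a) (hb : IsLeg b) (hab : Comm a b) :
    R.phi a b (counitLeg W Q.ε) = 1 :=
  leg_one_of_onRight R.normalized_right ha hb hab (leg_counitLeg_right _ _)

theorem phiInv_counit_middle (ha : IsLeg a) (hb : IsLeg b) (hab : Comm a b) :
    R.phiInv a (counitLeg W Q.ε) b = 1 :=
  leg_one_of_onRight (map_inv_eq_one _ _ R.normalized_middle) ha hb hab (leg_counitLeg_left _ _)

theorem phiInv_counit_right (ha : IsLeg a) (hb : IsLeg b) (hab : Comm a b) :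
    R.phiInv a b (counitLeg W Q.ε) = 1 :=
  leg_one_of_onRight (map_inv_eq_one _ _ R.normalized_right) ha hb hab (leg_counitLeg_right _ _)

theorem _root_.QuasiHopf.QuasiBialgebra.phi_counit_left (hb : IsLeg b) (hc : IsLeg c)
    (hbc : Comm b c) : Q.self.phi (counitLeg W Q.ε) b c = 1 := by
  refine (leg_counitLeg_left _ _ _).trans ?_
  rw [show (Q.self.Φρ : H ⊗[k] (H ⊗[k] H)) = ↑Q.Φ from rfl, Q.normalized_left,
    (hb.leg hc hbc).unital]

theorem join_counit (a : A →ₗ[k] W) : join R.ρ a (counitLeg W Q.ε) = a := by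
  ext x; rw [join_apply, leg_counitLeg_right, R.counit]

theorem _root_.QuasiHopf.QuasiBialgebra.join_counit (b : H →ₗ[k] W) :
    join Q.Δ b (counitLeg W Q.ε) = b := by
  ext x; rw [join_apply, leg_counitLeg_right, Q.counit_right]

theorem _root_.QuasiHopf.QuasiBialgebra.counit_join (b : H →ₗ[k] W) :
    join Q.Δ (counitLeg W Q.ε) b = b := by
  ext x; rw [join_apply, leg_counitLeg_left, Q.counit_left]

/-! Inverse forms of the cocycle condition. -/

/-- `Φ⁻[a,b,c⋆d] Φ[b,c,d] = Φ[a⋆b,c,d] Φ⁻[a,b,c] Φ⁻[a,b⋆c,d]` -/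
theorem phiInv_mul_phi_cocycle (ha : IsLeg a) (hb : IsLeg b) (hc : IsLeg c)
    (hd : IsLeg d) (hab : Comm a b) (hac : Comm a c) (had : Comm a d) (hbc : Comm b c)
    (hbd : Comm b d) (hcd : Comm c d) :
    R.phiInv a b (join Q.Δ c d) * Q.self.phi b c d =
      R.phi (join R.ρ a b) c d * R.phiInv a b c * R.phiInv a (join Q.Δ b c) d := by
  have h := phi_cocycle (R := R) ha hb hc hd hab hac had hbc hbd hcd
  have h₁ := phi_mul_phiInv (R := R) ha hb hc hab hac hbc
  have h₂ := phi_mul_phiInv (R := R) ha (hb.join hc hbc (δ := Q.Δ)) hd (hab.join_right hac) had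
    (hbd.join_left hcd)
  have h₃ := phiInv_mul_phi (R := R) ha hb (hc.join hd hcd (δ := Q.Δ)) hab (hac.join_right had)
    (hbc.join_right hbd)
  have h₄ : Q.self.phi b c d = R.phi a b (join Q.Δ c d) * R.phi (join R.ρ a b) c d *
      R.phiInv a b c * R.phiInv a (join Q.Δ b c) d := by
    rw [← h, mul_assoc (_ * _) (R.phi a b c), h₁, mul_one, mul_assoc, h₂, mul_one]
  rw [h₄]
  simp only [← mul_assoc]
  rw [h₃, one_mul]

/-- `Φ[a⋆b,c,d] Φ⁻[a,b,c] = Φ⁻[a,b,c⋆d] Φ[b,c,d] Φ[a,b⋆c,d]` -/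
theorem phi_mul_phiInv_cocycle (ha : IsLeg a) (hb : IsLeg b) (hc : IsLeg c)
    (hd : IsLeg d) (hab : Comm a b) (hac : Comm a c) (had : Comm a d) (hbc : Comm b c)
    (hbd : Comm b d) (hcd : Comm c d) :
    R.phi (join R.ρ a b) c d * R.phiInv a b c =
      R.phiInv a b (join Q.Δ c d) * Q.self.phi b c d * R.phi a (join Q.Δ b c) d := by
  have h₂ := phiInv_mul_phi (R := R) ha (hb.join hc hbc (δ := Q.Δ)) hd (hab.join_right hac) had
    (hbd.join_left hcd)
  rw [phiInv_mul_phi_cocycle ha hb hc hd hab hac had hbc hbd hcd,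
    mul_assoc (_ * _) _ (R.phi a _ d), h₂, mul_one]

/-- `Φ[a,b,c] Φ⁻[a⋆b,c,d] = Φ⁻[a,b⋆c,d] Φ⁻[b,c,d] Φ[a,b,c⋆d]` -/
theorem phi_mul_phiInv_cocycle' (ha : IsLeg a) (hb : IsLeg b) (hc : IsLeg c)
    (hd : IsLeg d) (hab : Comm a b) (hac : Comm a c) (had : Comm a d) (hbc : Comm b c)
    (hbd : Comm b d) (hcd : Comm c d) :
    R.phi a b c * R.phiInv (join R.ρ a b) c d =
      R.phiInv a (join Q.Δ b c) d * Q.self.phiInv b c d * R.phi a b (join Q.Δ c d) := by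
  have h := phi_cocycle (R := R) ha hb hc hd hab hac had hbc hbd hcd
  have h₁ := phi_mul_phiInv (R := R) (ha.join hb hab (δ := R.ρ)) hc hd (hac.join_left hbc)
    (had.join_left hbd) hcd
  have h₂ := phiInv_mul_phi (R := R) ha (hb.join hc hbc (δ := Q.Δ)) hd (hab.join_right hac) had
    (hbd.join_left hcd)
  have h₃ := phiInv_mul_phi (R := Q.self) hb hc hd hbc hbd hcd
  have h₄ : R.phi a b (join Q.Δ c d) = Q.self.phi b c d * R.phi a (join Q.Δ b c) d *
      R.phi a b c * R.phiInv (join R.ρ a b) c d := by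
    rw [h, mul_assoc, h₁, mul_one]
  rw [h₄]
  calc _ = R.phiInv a (join Q.Δ b c) d * (Q.self.phiInv b c d * Q.self.phi b c d) *
      R.phi a (join Q.Δ b c) d * R.phi a b c * R.phiInv (join R.ρ a b) c d := by
        rw [h₃, mul_one, h₂, one_mul]
    _ = _ := by simp only [mul_assoc]

end RightComoduleAlgebra

end Cocycle

/-! ### Functionals that absorb a convolution of legs -/

section Agree

variable {k W Y A B H : Type*} [Field k] [Ring W] [Algebra k W] [AddCommGroup Y] [Module k Y]
  [Ring A] [Algebra k A] [Ring B] [Algebra k B] [Ring H] [Algebra k H] {Q : QuasiBialgebra k H}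

theorem LeftAgree.comp_mulLeft {s : W →ₗ[k] Y} {f f' : A →ₗ[k] W} (h : LeftAgree s f f') {u : W}
    (hf : ∀ x, u * f x = f x * u) (hf' : ∀ x, u * f' x = f' x * u) :
    LeftAgree (s ∘ₗ LinearMap.mulLeft k u) f f' := by
  intro x z
  simp only [LinearMap.comp_apply, LinearMap.mulLeft_apply]
  rw [← mul_assoc, hf, ← mul_assoc, hf', mul_assoc, mul_assoc, h]

namespace RightComoduleAlgebra

variable {R : RightComoduleAlgebra Q A} {s : W →ₗ[k] Y} {a a' : A →ₗ[k] W}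
  {b b' c c' d e g : H →ₗ[k] W} {f : B →ₗ[k] W}

theorem phi_comm (ha : Comm a f) (hb : Comm b f) (hc : Comm c f) (x : B) :
    R.phi a b c * f x = f x * R.phi a b c :=
  (ha.leg_left (hb.leg_left hc)) _ x

theorem phiInv_comm (ha : Comm a f) (hb : Comm b f) (hc : Comm c f) (x : B) :
    R.phiInv a b c * f x = f x * R.phiInv a b c :=
  (ha.leg_left (hb.leg_left hc)) _ x

/-- `(T[b,c,d,e] = (Φ ⊗ 1) (Δ ⊗ id ⊗ id)(Φ⁻¹)` in terms of legs. -/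
def _root_.QuasiHopf.QuasiBialgebra.tau (Q : QuasiBialgebra k H) (b c d e : H →ₗ[k] W) : W :=
  Q.self.phi b c d * Q.self.phiInv (join Q.Δ b c) d e

/-- The pentagons for `(a, b⋆c, d, e)` and `(a, b, c, d)` rewrite the left side so that `c` and `d`
occur in its leading factors only as `c⋆d`. Since `s` absorbs `c⋆d`, these factors collapse. -/
theorem tau_phi_phi (hs : LeftAgree s (join Q.Δ c d) (counitLeg W Q.ε))
    (ha : IsLeg a) (hb : IsLeg b) (hc : IsLeg c) (hd : IsLeg d) (he : IsLeg e)
    (hab : Comm a b) (hac : Comm a c) (had : Comm a d) (hae : Comm a e) (hbc : Comm b c)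
    (hbd : Comm b d) (hbe : Comm b e) (hcd : Comm c d) (hce : Comm c e) (hde : Comm d e) (X : W) :
    s (Q.tau b c d e * (R.phi a (join Q.Δ b c) (join Q.Δ d e) *
        (R.phi (join R.ρ a (join Q.Δ b c)) d e * X))) =
      s (R.phi a b e * (R.phi (join R.ρ a b) c d * (R.phiInv a b c * X))) := by
  have hbc' : IsLeg (join Q.Δ b c) := hb.join hc hbc
  have h₁ := phi_cocycle (R := R) ha hbc' hd he (hab.join_right hac) had hae (hbd.join_left hcd)
    (hbe.join_left hce) hde
  have h₂ : Q.self.phiInv (join Q.Δ b c) d e * Q.self.phi (join Q.Δ b c) d e = 1 :=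
    phiInv_mul_phi hbc' hd he (hbd.join_left hcd) (hbe.join_left hce) hde
  have h₃ : Q.self.phi b c d * R.phi a (join Q.Δ (join Q.Δ b c) d) e =
      R.phi a (join Q.Δ b (join Q.Δ c d)) e * Q.self.phi b c d :=
    mul_leg_right (phi_comm hab.symm hac.symm had.symm)
      (mul_leg_left (phi_coassoc (R := Q.self) hb hc hd hbc hbd hcd) (phi_comm hbe hce hde)) _
  have h₄ := phi_cocycle (R := R) ha hb hc hd hab hac had hbc hbd hcd
  have h₅ := phi_mul_phiInv (R := R) ha hb hc hab hac hbc
  have h₆ : Q.self.phi b c d * R.phi a (join Q.Δ b c) d =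
      R.phi a b (join Q.Δ c d) * R.phi (join R.ρ a b) c d * R.phiInv a b c := by
    rw [← h₄, mul_assoc, h₅, mul_one]
  -- The first pentagon cancels the factor `Φ⁻[b⋆c,d,e]` of `T`. The remaining `Φ[b,c,d]` is moved
  -- right, rebracketing `(b⋆c)⋆d` into `b⋆(c⋆d)`, until the second pentagon applies.
  have h₇ : Q.tau b c d e * (R.phi a (join Q.Δ b c) (join Q.Δ d e) *
        (R.phi (join R.ρ a (join Q.Δ b c)) d e * X)) =
      R.phi a (join Q.Δ b (join Q.Δ c d)) e * (R.phi a b (join Q.Δ c d) *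
        (R.phi (join R.ρ a b) c d * (R.phiInv a b c * X))) := by
    rw [QuasiBialgebra.tau, ← mul_assoc (R.phi a _ _), ← h₁]
    simp only [← mul_assoc]
    rw [mul_assoc (Q.self.phi b c d) _ (Q.self.phi (join Q.Δ b c) d e), h₂, mul_one, h₃,
      mul_assoc (R.phi a _ e) (Q.self.phi b c d), h₆]
    simp only [mul_assoc]
  rw [h₇]
  have h₈ : LeftAgree s (join Q.Δ b (join Q.Δ c d)) b := by
    have := hs.join_right Q.Δ (hbc.join_right hbd) (comm_counitLeg Q.ε b)
    rwa [Q.join_counit] at this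
  refine (((h₈.leg_left e).leg_right ((hab.join_right (hac.join_right had)).leg_right hae)
    (hab.leg_right hae)) ↑R.Φρ _).trans ?_
  -- The factor `Φ[a,b,e]` commutes with `c⋆d`, so `s` absorbs `c⋆d` behind it as well, and
  -- `Φ[a,b,c⋆d]` becomes `Φ[a,b,ε] = 1`.
  have h₉ := hs.comp_mulLeft (u := R.phi a b e)
    (phi_comm (hac.join_right had) (hbc.join_right hbd) (hce.symm.join_right hde.symm))
    (phi_comm (comm_counitLeg _ _) (comm_counitLeg _ _) (comm_counitLeg _ _))
  refine (((h₉.leg_right (hbc.join_right hbd) (comm_counitLeg _ _)).leg_right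
    (hab.leg_right (hac.join_right had)) (hab.leg_right (comm_counitLeg _ _))) ↑R.Φρ _).trans ?_
  have h₁₀ : leg a (leg b (counitLeg W Q.ε)) ↑R.Φρ = 1 := phi_counit_right ha hb hab
  rw [h₁₀, one_mul]
  rfl

/-- `s (Φ[a⋆b,c,d] Φ⁻[a,b,c]) = s (Φ[b,c,d])` if `s` absorbs `c⋆d` on the left and `b⋆c` on the
right. -/
theorem apply_phi_mul_phiInv (hs : LeftAgree s (join Q.Δ c d) (counitLeg W Q.ε))
    (hs' : RightAgree s (join Q.Δ b c) (counitLeg W Q.ε))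
    (ha : IsLeg a) (hb : IsLeg b) (hc : IsLeg c) (hd : IsLeg d)
    (hab : Comm a b) (hac : Comm a c) (had : Comm a d) (hbc : Comm b c)
    (hbd : Comm b d) (hcd : Comm c d) :
    s (R.phi (join R.ρ a b) c d * R.phiInv a b c) = s (Q.self.phi b c d) := by
  -- The pentagon gives three factors. The outer ones contain `c⋆d` at the left end and `b⋆c` at the
  -- right end, where `s` replaces them by `ε`, so both become `1`.
  rw [phi_mul_phiInv_cocycle ha hb hc hd hab hac had hbc hbd hcd]
  have h₁ : s (R.phiInv a b (join Q.Δ c d) * Q.self.phi b c d * R.phi a (join Q.Δ b c) d) =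
      s (R.phiInv a b (join Q.Δ c d) * Q.self.phi b c d * R.phi a (counitLeg W Q.ε) d) :=
    ((hs'.leg_left (hbd.join_left hcd) (comm_counitLeg _ d).symm).leg_right a) ↑R.Φρ _
  rw [h₁, phi_counit_middle ha hd had, mul_one]
  refine (((hs.leg_right (hbc.join_right hbd) (comm_counitLeg _ _)).leg_right
    (hab.leg_right (hac.join_right had)) (hab.leg_right (comm_counitLeg _ _))) ↑R.Φρ⁻¹ _).trans ?_
  have h₂ : leg a (leg b (counitLeg W Q.ε)) ↑R.Φρ⁻¹ = 1 := phiInv_counit_right ha hb hab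
  rw [h₂, one_mul]

/-- `s (Φ[a,b,c] Φ⁻[a⋆b,c,d] X) = s (Φ⁻[b,c,d] X)` if `s` absorbs `b⋆c` on the left and `c⋆d`
on the right. -/
theorem apply_phi_mul_phiInv' (hs : LeftAgree s (join Q.Δ b c) (counitLeg W Q.ε))
    (hs' : RightAgree s (join Q.Δ c d) (counitLeg W Q.ε))
    (ha : IsLeg a) (hb : IsLeg b) (hc : IsLeg c) (hd : IsLeg d)
    (hab : Comm a b) (hac : Comm a c) (had : Comm a d) (hbc : Comm b c)
    (hbd : Comm b d) (hcd : Comm c d) :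
    s (R.phi a b c * R.phiInv (join R.ρ a b) c d) = s (Q.self.phiInv b c d) := by
  rw [phi_mul_phiInv_cocycle' ha hb hc hd hab hac had hbc hbd hcd]
  have h₁ : s (R.phiInv a (join Q.Δ b c) d * Q.self.phiInv b c d * R.phi a b (join Q.Δ c d)) =
      s (R.phiInv a (join Q.Δ b c) d * Q.self.phiInv b c d * R.phi a b (counitLeg W Q.ε)) :=
    ((hs'.leg_right b).leg_right a) ↑R.Φρ _
  rw [h₁, phi_counit_right ha hb hab, mul_one]
  refine (((hs.leg_left d).leg_right ((hab.join_right hac).leg_right had)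
    ((comm_counitLeg _ a).leg_right had)) ↑R.Φρ⁻¹ _).trans ?_
  have h₂ : leg a (leg (counitLeg W Q.ε) d) ↑R.Φρ⁻¹ = 1 := phiInv_counit_middle ha hd had
  rw [h₂, one_mul]

end RightComoduleAlgebra

namespace QuasiBialgebra

open RightComoduleAlgebra

variable {s : W →ₗ[k] Y} {a b c d e g : H →ₗ[k] W}

/-- The functional `s (T[b,c,d,e] ·)` absorbs `(b⋆c)⋆(d⋆e)` if `s` absorbs `c⋆d` and `b⋆e`. -/
theorem tau_absorb (hs : LeftAgree s (join Q.Δ c d) (counitLeg W Q.ε))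
    (hs' : LeftAgree s (join Q.Δ b e) (counitLeg W Q.ε))
    (hb : IsLeg b) (hc : IsLeg c) (hd : IsLeg d) (he : IsLeg e) (hbc : Comm b c)
    (hbd : Comm b d) (hbe : Comm b e) (hcd : Comm c d) (hce : Comm c e) (hde : Comm d e) :
    LeftAgree (s ∘ₗ LinearMap.mulLeft k (Q.tau b c d e))
      (join Q.Δ (join Q.Δ b c) (join Q.Δ d e)) (counitLeg W Q.ε) := by
  intro x X
  have hbc' : IsLeg (join Q.Δ b c) := hb.join hc hbc
  have h₁ := phiInv_coassoc (R := Q.self) hbc' hd he (hbd.join_left hcd) (hbe.join_left hce) hde x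
  have h₂ : Q.self.phi b c d * join Q.Δ (join Q.Δ (join Q.Δ b c) d) e x =
      join Q.Δ (join Q.Δ b (join Q.Δ c d)) e x * Q.self.phi b c d :=
    mul_leg_left (phi_coassoc (R := Q.self) hb hc hd hbc hbd hcd) (phi_comm hbe hce hde) _
  have h₃ : LeftAgree s (join Q.Δ b (join Q.Δ c d)) b := by
    have := hs.join_right Q.Δ (hbc.join_right hbd) (comm_counitLeg Q.ε b)
    rwa [Q.join_counit] at this
  -- Moving `T` past `(b⋆c)⋆(d⋆e)` rebrackets it into `(b⋆(c⋆d))⋆e`. Absorbing `c⋆d` leaves `b⋆e`,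
  -- which `s` absorbs too.
  have h₄ : Q.tau b c d e * (join Q.Δ (join Q.Δ b c) (join Q.Δ d e) x * X) =
      join Q.Δ (join Q.Δ b (join Q.Δ c d)) e x * (Q.tau b c d e * X) := by
    calc _ = Q.self.phi b c d * (Q.self.phiInv (join Q.Δ b c) d e *
        join Q.self.ρ (join Q.Δ b c) (join Q.Δ d e) x) * X := by
          simp only [tau, mul_assoc]; rfl
      _ = Q.self.phi b c d * join Q.Δ (join Q.Δ (join Q.Δ b c) d) e x *
          Q.self.phiInv (join Q.Δ b c) d e * X := by rw [h₁]; simp only [mul_assoc]; rfl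
      _ = _ := by rw [h₂]; simp only [tau, mul_assoc]
  simp only [LinearMap.comp_apply, LinearMap.mulLeft_apply]
  rw [h₄, h₃.join_left Q.Δ e x _, hs' x _, counitLeg_apply]
  simp only [← mul_assoc]
  rw [Algebra.commutes]

/-- The two threefold iterates of `T` agree up to `Φ`. -/
theorem tau_tau (hs : LeftAgree s (join Q.Δ c d) (counitLeg W Q.ε))
    (ha : IsLeg a) (hb : IsLeg b) (hc : IsLeg c) (hd : IsLeg d) (he : IsLeg e) (hg : IsLeg g)
    (hab : Comm a b) (hac : Comm a c) (had : Comm a d) (hae : Comm a e) (hag : Comm a g)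
    (hbc : Comm b c) (hbd : Comm b d) (hbe : Comm b e) (hbg : Comm b g)
    (hcd : Comm c d) (hce : Comm c e) (hcg : Comm c g) (hde : Comm d e) (hdg : Comm d g)
    (heg : Comm e g) :
    s (Q.tau a b e g * (Q.tau (join Q.Δ a b) c d (join Q.Δ e g) * Q.self.phi d e g)) =
      s (Q.tau b c d e * (Q.tau a (join Q.Δ b c) (join Q.Δ d e) g * Q.self.phi a b c)) := by
  have lab : IsLeg (join Q.Δ a b) := ha.join hb hab
  have lbc : IsLeg (join Q.Δ b c) := hb.join hc hbc
  have lde : IsLeg (join Q.Δ d e) := hd.join he hde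
  have lp : IsLeg (join Q.Δ (join Q.Δ a b) c) := lab.join hc (hac.join_left hbc)
  have habc : Comm (join Q.Δ a b) c := hac.join_left hbc
  have habd : Comm (join Q.Δ a b) d := had.join_left hbd
  have habe : Comm (join Q.Δ a b) e := hae.join_left hbe
  have habg : Comm (join Q.Δ a b) g := hag.join_left hbg
  have hpd : Comm (join Q.Δ (join Q.Δ a b) c) d := habd.join_left hcd
  have hpe : Comm (join Q.Δ (join Q.Δ a b) c) e := habe.join_left hce
  have hpg : Comm (join Q.Δ (join Q.Δ a b) c) g := habg.join_left hcg
  set P := join Q.Δ (join Q.Δ a b) c with hP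
  set Z := Q.self.phiInv P d e * Q.self.phiInv P (join Q.Δ d e) g with hZ
  -- Both sides are brought to a common form in which the remaining inverse reassociators `Z` start
  -- from the triple `P = (a⋆b)⋆c`.
  trans s (Q.self.phi a b e * (Q.self.phi (join Q.Δ a b) c d * Z))
  · have h₁ : Q.self.phiInv P d (join Q.Δ e g) * Q.self.phi d e g =
        Q.self.phi (join Q.Δ P d) e g * Z := by
      rw [hZ, ← mul_assoc]
      exact phiInv_mul_phi_cocycle (R := Q.self) lp hd he hg hpd hpe hpg hde hdg heg
    have h₂ : Q.self.phi (join Q.Δ a b) c d * Q.self.phi (join Q.Δ P d) e g =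
        Q.self.phi (join Q.Δ (join Q.Δ a b) (join Q.Δ c d)) e g *
          Q.self.phi (join Q.Δ a b) c d := by
      refine mul_leg_left (phi_coassoc (R := Q.self) lab hc hd habc habd hcd) ?_ _
      exact phi_comm (habe.leg_right habg) (hce.leg_right hcg) (hde.leg_right hdg)
    have h₃ : Q.tau (join Q.Δ a b) c d (join Q.Δ e g) * Q.self.phi d e g =
        Q.self.phi (join Q.Δ (join Q.Δ a b) (join Q.Δ c d)) e g *
          (Q.self.phi (join Q.Δ a b) c d * Z) := by
      rw [tau, mul_assoc, h₁, ← mul_assoc, h₂, mul_assoc]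
    rw [h₃]
    -- The leg `c⋆d` commutes with `T[a,b,e,g]`, so it is absorbed behind it; then `Φ[a⋆b,e,g]`
    -- cancels the inverse factor of `T[a,b,e,g]`.
    have h₄ := hs.comp_mulLeft (u := Q.tau a b e g)
      (fun x ↦ by
        have u₁ := phi_comm (R := Q.self) (f := join Q.Δ c d) (hac.join_right had)
          (hbc.join_right hbd) (hce.symm.join_right hde.symm) x
        have u₂ := phiInv_comm (R := Q.self) (f := join Q.Δ c d) (habc.join_right habd)
          (hce.symm.join_right hde.symm) (hcg.symm.join_right hdg.symm) x
        rw [tau, mul_assoc, u₂, ← mul_assoc, u₁, mul_assoc])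
      (fun x ↦ (Algebra.commutes _ _).symm)
    have h₅ : LeftAgree (s ∘ₗ LinearMap.mulLeft k (Q.tau a b e g))
        (join Q.Δ (join Q.Δ a b) (join Q.Δ c d)) (join Q.Δ a b) := by
      have := h₄.join_right Q.Δ (habc.join_right habd) (comm_counitLeg Q.ε (join Q.Δ a b))
      rwa [Q.join_counit] at this
    refine ((h₅.leg_left (leg e g)) ↑Q.Φ _).trans ?_
    have h₆ : Q.self.phiInv (join Q.Δ a b) e g * Q.self.phi (join Q.Δ a b) e g = 1 :=
      phiInv_mul_phi lab he hg habe habg heg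
    simp only [LinearMap.comp_apply, LinearMap.mulLeft_apply]
    rw [show leg (join Q.Δ a b) (leg e g) ↑Q.Φ = Q.self.phi (join Q.Δ a b) e g from rfl, tau,
      mul_assoc, ← mul_assoc (Q.self.phiInv _ _ _), h₆, one_mul]
  · have hq : IsLeg (join Q.Δ a (join Q.Δ b c)) := ha.join lbc (hab.join_right hac)
    have hqd : Comm (join Q.Δ a (join Q.Δ b c)) d := had.join_left (hbd.join_left hcd)
    have hqe : Comm (join Q.Δ a (join Q.Δ b c)) e := hae.join_left (hbe.join_left hce)
    have h₁ (x : H) : Q.self.phi a b c * P x =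
        join Q.Δ a (join Q.Δ b c) x * Q.self.phi a b c :=
      phi_coassoc (R := Q.self) ha hb hc hab hac hbc x
    have i₁ : Q.self.phi a b c * Q.self.phiInv P (join Q.Δ d e) g =
        Q.self.phiInv (join Q.Δ a (join Q.Δ b c)) (join Q.Δ d e) g * Q.self.phi a b c :=
      mul_leg_left h₁ (phi_comm ((had.join_right hae).leg_right hag)
        ((hbd.join_right hbe).leg_right hbg) ((hcd.join_right hce).leg_right hcg)) _
    have i₂ : Q.self.phi a b c * Q.self.phiInv P d e =
        Q.self.phiInv (join Q.Δ a (join Q.Δ b c)) d e * Q.self.phi a b c :=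
      mul_leg_left h₁ (phi_comm (had.leg_right hae) (hbd.leg_right hbe) (hcd.leg_right hce)) _
    have i₃ : Q.self.phi (join Q.Δ a (join Q.Δ b c)) d e *
        Q.self.phiInv (join Q.Δ a (join Q.Δ b c)) d e = 1 := phi_mul_phiInv hq hd he hqd hqe hde
    have i₄ : Q.self.phiInv a b c * Q.self.phi a b c = 1 := phiInv_mul_phi ha hb hc hab hac hbc
    -- The vector `X = Φ[a,b,c] Z` is chosen to cancel the `Φ⁻[a,b,c]` that `tau_phi_phi` produces.
    have key := tau_phi_phi (R := Q.self) hs ha hb hc hd he hab hac had hae hbc hbd hbe hcd hce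
      hde (Q.self.phi a b c * Z)
    have i₅ : Q.self.phi (join Q.Δ a (join Q.Δ b c)) d e * (Q.self.phi a b c * Z) =
        Q.self.phi a b c * Q.self.phiInv P (join Q.Δ d e) g := by
      rw [hZ, ← mul_assoc (Q.self.phi a b c), i₂, mul_assoc, ← mul_assoc, i₃, one_mul]
    rw [show Q.self.ρ = Q.Δ from rfl, i₅, i₁, ← mul_assoc (Q.self.phiInv a b c), i₄, one_mul]
      at key
    rw [← key, tau, tau]
    simp only [mul_assoc]

end QuasiBialgebra

end Agree

/-! ### Left and right multiplications as legs -/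

section Operators

variable {k A B C D H : Type*} [Field k] [Ring A] [Algebra k A] [Ring B] [Algebra k B]
  [Ring C] [Algebra k C] [Ring D] [Algebra k D] [Ring H] [Algebra k H]

/-- Operators on `B`, composed from left to right. -/
abbrev Opr (k B : Type*) [Field k] [Ring B] [Algebra k B] : Type _ := (Module.End k B)ᵐᵒᵖ

/-- Right multiplication as an operator. -/
def rt (f : A →ₗ[k] B) : A →ₗ[k] Opr k B :=
  (opLinearEquiv k).toLinearMap ∘ₗ (LinearMap.mul k B).flip ∘ₗ f

/-- Left multiplication as an operator. -/
def lt (f : A →ₗ[k] B) : A →ₗ[k] Opr k B :=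
  (opLinearEquiv k).toLinearMap ∘ₗ LinearMap.mul k B ∘ₗ f

/-- The operators applied to `v`. -/
def act (v : B) : Opr k B →ₗ[k] B :=
  LinearMap.applyₗ v ∘ₗ (opLinearEquiv k).symm.toLinearMap

@[simp]
theorem act_mul (v : B) (X Y : Opr k B) : act v (X * Y) = act (act v X) Y := rfl

@[simp]
theorem act_one (v : B) : act v (1 : Opr k B) = v := rfl

@[simp]
theorem act_rt (v : B) (f : A →ₗ[k] B) (x : A) : act v (rt f x) = v * f x := rfl

@[simp]
theorem act_lt (v : B) (f : A →ₗ[k] B) (x : A) : act v (lt f x) = f x * v := rfl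

theorem opr_ext {X Y : Opr k B} (h : ∀ v, act v X = act v Y) : X = Y :=
  unop_injective (LinearMap.ext h)

theorem act_add (v w : B) (X : Opr k B) : act (v + w) X = act v X + act w X :=
  map_add (unop X) v w

theorem act_smul (c : k) (v : B) (X : Opr k B) : act (c • v) X = c • act v X :=
  map_smul (unop X) c v

theorem act_zero (X : Opr k B) : act (0 : B) X = 0 := map_zero (unop X)

theorem IsLeg.rt {f : A →ₗ[k] B} (hf : IsLeg f) : IsLeg (rt f) where
  unital := opr_ext fun v ↦ by rw [act_rt, hf.unital, mul_one, act_one]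
  multiplicative x y := opr_ext fun v ↦ by
    rw [act_rt, hf.multiplicative, act_mul, act_rt, act_rt, mul_assoc]

/-- A linear map that is unital and reverses products. -/
structure IsAntiLeg (f : A →ₗ[k] B) : Prop where
  unital : f 1 = 1
  multiplicative : ∀ x y, f (x * y) = f y * f x

/-- Operators compose from left to right, so left multiplication reverses products and undoes the
reversal by an antihomomorphism. Thus the antipode becomes admissible as a leg. -/
theorem IsAntiLeg.lt {f : A →ₗ[k] B} (hf : IsAntiLeg f) : IsLeg (lt f) where
  unital := opr_ext fun v ↦ by rw [act_lt, hf.unital, one_mul, act_one]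
  multiplicative x y := opr_ext fun v ↦ by
    rw [act_lt, hf.multiplicative, act_mul, act_lt, act_lt, mul_assoc]

theorem IsLeg.comp_anti {g : B →ₗ[k] C} (hg : IsLeg g) {f : A →ₗ[k] B} (hf : IsAntiLeg f) :
    IsAntiLeg (g ∘ₗ f) where
  unital := by rw [LinearMap.comp_apply, hf.unital, hg.unital]
  multiplicative x y := by
    simp only [LinearMap.comp_apply]; rw [hf.multiplicative, hg.multiplicative]

theorem IsLeg.comp {g : B →ₗ[k] C} (hg : IsLeg g) {f : A →ₗ[k] B} (hf : IsLeg f) :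
    IsLeg (g ∘ₗ f) where
  unital := by rw [LinearMap.comp_apply, hf.unital, hg.unital]
  multiplicative x y := by
    simp only [LinearMap.comp_apply]; rw [hf.multiplicative, hg.multiplicative]

theorem IsAntiLeg.join {f : A →ₗ[k] B} {g : C →ₗ[k] B} (hf : IsAntiLeg f) (hg : IsAntiLeg g)
    (h : Comm f g) (δ : D →ₐ[k] A ⊗[k] C) : IsAntiLeg (join δ f g) where
  unital := by
    rw [join_apply, map_one, Algebra.TensorProduct.one_def, leg_tmul, hf.unital, hg.unital, mul_one]
  multiplicative x y := by
    simp only [join_apply, map_mul]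
    induction δ x with
    | zero => simp
    | add y z hy hz => simp only [map_add, tensor_add_mul, mul_add, hy, hz]
    | tmul a c =>
    induction δ y with
    | zero => simp
    | add y z hy hz => simp only [map_add, tensor_mul_add, add_mul, hy, hz]
    | tmul a' c' =>
    rw [Algebra.TensorProduct.tmul_mul_tmul, leg_tmul, leg_tmul, leg_tmul, hf.multiplicative,
      hg.multiplicative, mul_assoc, mul_assoc, ← mul_assoc (f a), ← mul_assoc (g c'), h, mul_assoc]

theorem comm_rt_lt (f : A →ₗ[k] B) (g : C →ₗ[k] B) : Comm (rt f) (lt g) :=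
  fun x y ↦ opr_ext fun v ↦ by simp [mul_assoc]

theorem comm_lt_rt (f : A →ₗ[k] B) (g : C →ₗ[k] B) : Comm (lt f) (rt g) := (comm_rt_lt g f).symm

theorem Comm.rt {f : A →ₗ[k] B} {g : C →ₗ[k] B} (h : Comm f g) : Comm (rt f) (rt g) :=
  fun x y ↦ opr_ext fun v ↦ by simp only [act_mul, act_rt]; rw [mul_assoc, mul_assoc, h]

theorem Comm.lt {f : A →ₗ[k] B} {g : C →ₗ[k] B} (h : Comm f g) : Comm (lt f) (lt g) :=
  fun x y ↦ opr_ext fun v ↦ by simp only [act_mul, act_lt]; rw [← mul_assoc, ← mul_assoc, h]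

theorem Comm.comp_right {f : A →ₗ[k] B} {g : C →ₗ[k] B} (h : Comm f g) (φ : D →ₗ[k] C) :
    Comm f (g ∘ₗ φ) := fun x y ↦ h x (φ y)

theorem Comm.comp_left {f : A →ₗ[k] B} {g : C →ₗ[k] B} (h : Comm f g) (φ : D →ₗ[k] A) :
    Comm (f ∘ₗ φ) g := fun x y ↦ h (φ x) y

theorem rt_leg (f : A →ₗ[k] B) (g : C →ₗ[k] B) : rt (leg f g) = leg (rt f) (rt g) := by
  ext x y : 3
  exact opr_ext fun v ↦ by simp [mul_assoc]

/-- Applying `f x` first and `g y` second puts `g y` outermost, so the factors come out in the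
opposite order; right multiplication needs no such hypothesis. -/
theorem lt_leg {f : A →ₗ[k] B} {g : C →ₗ[k] B} (h : Comm f g) :
    lt (leg f g) = leg (lt f) (lt g) := by
  ext x y : 3
  refine opr_ext fun v ↦ ?_
  simp only [AlgebraTensorModule.curry_apply, LinearMap.restrictScalars_self, curry_apply, leg_tmul,
    act_lt, act_mul]
  rw [h, mul_assoc]

theorem rt_join (δ : D →ₐ[k] A ⊗[k] C) (f : A →ₗ[k] B) (g : C →ₗ[k] B) :
    rt (join δ f g) = join δ (rt f) (rt g) := by
  ext x; exact LinearMap.congr_fun (rt_leg f g) (δ x)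

theorem lt_join (δ : D →ₐ[k] A ⊗[k] C) {f : A →ₗ[k] B} {g : C →ₗ[k] B} (h : Comm f g) :
    lt (join δ f g) = join δ (lt f) (lt g) := by
  ext x; exact LinearMap.congr_fun (lt_leg h) (δ x)

/-- `f` as a map into the first factor of `B ⊗ C`. -/
def inl (C : Type*) [Ring C] [Algebra k C] (f : A →ₗ[k] B) : A →ₗ[k] B ⊗[k] C :=
  (Algebra.TensorProduct.includeLeft : B →ₐ[k] B ⊗[k] C).toLinearMap ∘ₗ f

/-- `f` as a map into the second factor of `B ⊗ C`. -/
def inr (B : Type*) [Ring B] [Algebra k B] (f : A →ₗ[k] C) : A →ₗ[k] B ⊗[k] C :=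
  (Algebra.TensorProduct.includeRight : C →ₐ[k] B ⊗[k] C).toLinearMap ∘ₗ f

theorem inl_apply (f : A →ₗ[k] B) (x : A) : inl C f x = f x ⊗ₜ 1 := rfl

theorem inr_apply (f : A →ₗ[k] C) (x : A) : inr B f x = 1 ⊗ₜ f x := rfl

theorem IsLeg.inl {f : A →ₗ[k] B} (hf : IsLeg f) : IsLeg (inl C f) := (IsLeg.algHom _).comp hf

theorem IsLeg.inr {f : A →ₗ[k] C} (hf : IsLeg f) : IsLeg (inr B f) := (IsLeg.algHom _).comp hf

theorem Comm.inl {f : A →ₗ[k] B} {g : D →ₗ[k] B} (h : Comm f g) : Comm (inl C f) (inl C g) :=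
  fun x y ↦ by
    simp only [inl_apply, Algebra.TensorProduct.tmul_mul_tmul]; rw [h]

theorem Comm.inr {f : A →ₗ[k] C} {g : D →ₗ[k] C} (h : Comm f g) : Comm (inr B f) (inr B g) :=
  fun x y ↦ by
    simp only [inr_apply, Algebra.TensorProduct.tmul_mul_tmul]; rw [h]

theorem comm_inl_inr (f : A →ₗ[k] B) (g : D →ₗ[k] C) : Comm (inl C f) (inr B g) := fun x y ↦ by
  simp [inl_apply, inr_apply]

theorem inl_join (δ : D →ₐ[k] A ⊗[k] H) (f : A →ₗ[k] B) (g : H →ₗ[k] B) :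
    inl C (join δ f g) = join δ (inl C f) (inl C g) := by
  rw [join, join, inl, ← LinearMap.comp_assoc]
  congr 1
  ext x y
  simp [inl_apply]

theorem inr_join (δ : D →ₐ[k] A ⊗[k] H) (f : A →ₗ[k] C) (g : H →ₗ[k] C) :
    inr B (join δ f g) = join δ (inr B f) (inr B g) := by
  rw [join, join, inr, ← LinearMap.comp_assoc]
  congr 1
  ext x y
  simp [inr_apply]

/-- The map `b ↦ b ⊗ 1`. -/
abbrev slot₁ (k B C : Type*) [Field k] [Ring B] [Algebra k B] [Ring C] [Algebra k C] :
    B →ₗ[k] B ⊗[k] C := inl C LinearMap.id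

/-- The map `c ↦ 1 ⊗ c`. -/
abbrev slot₂ (k B C : Type*) [Field k] [Ring B] [Algebra k B] [Ring C] [Algebra k C] :
    C →ₗ[k] B ⊗[k] C := inr B LinearMap.id

theorem isLeg_id : IsLeg (LinearMap.id : A →ₗ[k] A) := ⟨rfl, fun _ _ ↦ rfl⟩

theorem leg_slot : leg (slot₁ k B C) (slot₂ k B C) = LinearMap.id := by
  ext x y; simp [inl_apply, inr_apply]

end Operators

/-! ### The antipode axioms as absorption by α and β -/

namespace QuasiHopfAlgebra

variable {k A B C H : Type*} [Field k] [Ring A] [Algebra k A] [Ring B] [Algebra k B]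
  [Ring C] [Algebra k C] [Ring H] [Algebra k H] (Q : QuasiHopfAlgebra k H)

/-- The antipode as a linear map. -/
def Sl : H →ₗ[k] H := (opLinearEquiv k).symm.toLinearMap ∘ₗ Q.S.toLinearMap

theorem Sl_apply (h : H) : Q.Sl h = unop (Q.S h) := rfl

theorem isAntiLeg_Sl : IsAntiLeg Q.Sl where
  unital := by simp [Sl_apply]
  multiplicative x y := by simp [Sl_apply]

/-- The inverse of the antipode. -/
def Si : H →ₗ[k] H := Q.S.symm.toLinearMap ∘ₗ (opLinearEquiv k).toLinearMap

theorem Sl_Si (h : H) : Q.Sl (Q.Si h) = h := by simp [Sl_apply, Si]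

theorem Si_Sl (h : H) : Q.Si (Q.Sl h) = h := by simp [Sl_apply, Si]

/-- The linear map `x ⊗ y ↦ S(x) α y`. -/
def evα : H ⊗[k] H →ₗ[k] H := TensorProduct.lift ((LinearMap.mul k H) ∘ₗ
  (LinearMap.mul k H).flip Q.α ∘ₗ Q.Sl)

@[simp]
theorem evα_tmul (x y : H) : Q.evα (x ⊗ₜ y) = Q.Sl x * Q.α * y := rfl

theorem evα_Δ (h : H) : Q.evα (Q.Δ h) = Q.ε h • Q.α := Q.antipode_left h

/-- The linear map `x ⊗ y ↦ x β S(y)`. -/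
def coevβ : H ⊗[k] H →ₗ[k] H := TensorProduct.lift
  (((LinearMap.mul k H).compl₂ Q.Sl) ∘ₗ (LinearMap.mul k H).flip Q.β)

@[simp]
theorem coevβ_tmul (x y : H) : Q.coevβ (x ⊗ₜ y) = x * Q.β * Q.Sl y := rfl

theorem coevβ_Δ (h : H) : Q.coevβ (Q.Δ h) = Q.ε h • Q.β := Q.antipode_right h

/-- The axiom `∑ X¹ β S(X²) α X³ = 1` is transported along an arbitrary linear map `G`, so that it
can be used inside any algebra. -/
theorem zigzag (F : H ⊗[k] (H ⊗[k] H) →ₗ[k] B) (G : H →ₗ[k] B)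
    (hF : ∀ x y z, F (x ⊗ₜ (y ⊗ₜ z)) = G (x * Q.β * (Q.Sl y * Q.α * z))) :
    F (Q.Φ : H ⊗[k] (H ⊗[k] H)) = G 1 := by
  rw [← Q.antipode_reassociator, ← LinearMap.comp_apply G]
  congr 1
  ext x y z
  exact hF x y z

theorem zigzag_inv (F : H ⊗[k] (H ⊗[k] H) →ₗ[k] B) (G : H →ₗ[k] B)
    (hF : ∀ x y z, F (x ⊗ₜ (y ⊗ₜ z)) = G (Q.Sl x * Q.α * (y * Q.β * Q.Sl z))) :
    F (↑Q.Φ⁻¹ : H ⊗[k] (H ⊗[k] H)) = G 1 := by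
  rw [← Q.antipode_reassociator_inv, ← LinearMap.comp_apply G]
  congr 1
  ext x y z
  exact hF x y z

/-- `(S(h₁) ·)(· h₂)` preserves `d(α) w` up to `ε(h)` if `w` commutes with the values of `d`. -/
theorem leftAgree_alpha {d : H →ₗ[k] B} (hd : IsLeg d) {w : B} (hw : ∀ x, w * d x = d x * w) :
    LeftAgree (act (d Q.α * w)) (join Q.Δ (lt (d ∘ₗ Q.Sl)) (rt d)) (counitLeg (Opr k B) Q.ε) := by
  intro x X
  have aux (t : H ⊗[k] H) : act (d Q.α * w) (leg (lt (d ∘ₗ Q.Sl)) (rt d) t) = d (Q.evα t) * w := by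
    induction t with
    | zero => simp
    | add y z hy hz => simp only [map_add, add_mul, hy, hz]
    | tmul y z =>
    simp only [leg_tmul, act_mul, act_lt, act_rt, LinearMap.comp_apply, evα_tmul]
    rw [hd.multiplicative, hd.multiplicative]
    simp only [mul_assoc]
    rw [hw]
  rw [act_mul, join_apply, aux, evα_Δ, counitLeg_apply, map_smul, smul_mul_assoc, act_smul,
    ← Algebra.smul_def, map_smul]

/-- The functional `X ⊗ c ↦ (v X) F(β ν(c))`. -/
def pairing (v : B) (F : H →ₗ[k] B) (ν : C →ₗ[k] H) : Opr k B ⊗[k] C →ₗ[k] B :=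
  leg (act v) (F ∘ₗ LinearMap.mulLeft k Q.β ∘ₗ ν)

@[simp]
theorem pairing_tmul (v : B) (F : H →ₗ[k] B) (ν : C →ₗ[k] H) (X : Opr k B) (c : C) :
    Q.pairing v F ν (X ⊗ₜ c) = act v X * F (Q.β * ν c) := rfl

theorem pairing_inl_mul (v : B) (F : H →ₗ[k] B) (ν : C →ₗ[k] H) (f : A →ₗ[k] Opr k B) (x : A)
    (Y : Opr k B ⊗[k] C) :
    Q.pairing v F ν (inl C f x * Y) = Q.pairing (act v (f x)) F ν Y := by
  induction Y with
  | zero => simp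
  | add y z hy hz => simp only [map_add, tensor_mul_add, hy, hz]
  | tmul X c => simp [inl_apply]

theorem leftAgree_pairing {v : B} (F : H →ₗ[k] B) (ν : C →ₗ[k] H) {f g : A →ₗ[k] Opr k B}
    (h : LeftAgree (act v) f g) : LeftAgree (Q.pairing v F ν) (inl C f) (inl C g) := by
  intro x Y
  have := h x 1
  rw [mul_one, mul_one] at this
  rw [pairing_inl_mul, pairing_inl_mul, this]

theorem inl_counitLeg : inl C (counitLeg (Opr k B) Q.ε) = counitLeg (Opr k B ⊗[k] C) Q.ε := by
  ext x
  exact AlgHom.commutes (Algebra.TensorProduct.includeLeft : Opr k B →ₐ[k] Opr k B ⊗[k] C) _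

/-- A final factor `x` in the leg `F` lands just left of `β`, and by `hi` the companion `y` lands as
`S(y)` just right of it. So `x β S(y)` appears and the axiom for `β` applies. -/
theorem rightAgree_pairing (v : B) {F : H →ₗ[k] B} (hF : IsLeg F) {ν : C →ₗ[k] H} {i : H →ₗ[k] C}
    (hi : ∀ c h, ν (c * i h) = Q.Sl h * ν c) :
    RightAgree (Q.pairing v F ν) (join Q.Δ (inl C (rt F)) (inr (Opr k B) i))
      (counitLeg (Opr k B ⊗[k] C) Q.ε) := by
  intro x Y
  induction Y with
  | zero => simp
  | add y z hy hz => simp only [map_add, tensor_add_mul, hy, hz]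
  | tmul X c =>
  have aux (t : H ⊗[k] H) : Q.pairing v F ν (X ⊗ₜ c * leg (inl C (rt F)) (inr (Opr k B) i) t) =
      act v X * F (Q.coevβ t * ν c) := by
    induction t with
    | zero => simp
    | add y z hy hz => simp only [map_add, mul_add, add_mul, hy, hz]
    | tmul y z =>
    simp only [leg_tmul, inl_apply, inr_apply, Algebra.TensorProduct.tmul_mul_tmul, one_mul,
      mul_one, pairing_tmul, act_mul, act_rt, coevβ_tmul, hi]
    rw [mul_assoc, ← hF.multiplicative]
    simp only [mul_assoc]
  rw [join_apply, aux, coevβ_Δ, counitLeg_apply, ← Algebra.commutes, ← Algebra.smul_def, map_smul,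
    pairing_tmul, smul_mul_assoc, map_smul, mul_smul_comm]

theorem pairing_mul_rt (v : B) (F : H →ₗ[k] B) (ν : C →ₗ[k] H) {f : A →ₗ[k] B} (hf : Comm F f)
    (x : A) (Y : Opr k B ⊗[k] C) :
    Q.pairing v F ν (Y * inl C (rt f) x) = Q.pairing v F ν Y * f x := by
  induction Y with
  | zero => simp
  | add y z hy hz => simp only [map_add, add_mul, hy, hz]
  | tmul X c =>
  simp only [inl_apply, Algebra.TensorProduct.tmul_mul_tmul, mul_one, pairing_tmul, act_mul, act_rt]
  rw [mul_assoc, mul_assoc, hf]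

theorem pairing_mul_lt (v : B) (F : H →ₗ[k] B) (ν : C →ₗ[k] H) (f : A →ₗ[k] B)
    (x : A) (Y : Opr k B ⊗[k] C) :
    Q.pairing v F ν (Y * inl C (lt f) x) = f x * Q.pairing v F ν Y := by
  induction Y with
  | zero => simp
  | add y z hy hz => simp only [map_add, tensor_add_mul, mul_add, hy, hz]
  | tmul X c => simp [inl_apply, mul_assoc]

theorem pairing_Sl_inr_mul (v : B) {F : H →ₗ[k] B} (hF : IsLeg F) (h : H)
    (Y : Opr k B ⊗[k] H) :
    Q.pairing v F Q.Sl (inr (Opr k B) LinearMap.id h * Y) =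
      Q.pairing v F Q.Sl Y * F (Q.Sl h) := by
  induction Y with
  | zero => simp
  | add y z hy hz => simp only [map_add, tensor_mul_add, add_mul, hy, hz]
  | tmul X c =>
  simp only [inr_apply, Algebra.TensorProduct.tmul_mul_tmul, one_mul, pairing_tmul,
    LinearMap.id_apply]
  rw [Q.isAntiLeg_Sl.multiplicative, ← mul_assoc Q.β, hF.multiplicative, mul_assoc]

/-- Inside `evα` an initial factor `x₁ ⊗ x₂` surrounds `α` as `S(x₁) α x₂`. -/
theorem leftAgree_pairing_evα (v : B) (F : H →ₗ[k] B) :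
    LeftAgree (Q.pairing v F Q.evα)
      (join Q.Δ (inr (Opr k B) (slot₁ k H H)) (inr (Opr k B) (slot₂ k H H)))
      (counitLeg (Opr k B ⊗[k] (H ⊗[k] H)) Q.ε) := by
  intro x Y
  rw [← inr_join]
  induction Y with
  | zero => simp
  | add y z hy hz => simp only [map_add, tensor_mul_add, hy, hz]
  | tmul X c =>
  induction c with
  | zero => simp
  | add y z hy hz => simp only [map_add, tmul_add, tensor_mul_add, hy, hz]
  | tmul c d =>
  have aux (t : H ⊗[k] H) : Q.evα (t * (c ⊗ₜ d)) = Q.Sl c * Q.evα t * d := by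
    induction t with
    | zero => simp
    | add y z hy hz => simp only [map_add, add_mul, mul_add, hy, hz]
    | tmul y z =>
    rw [Algebra.TensorProduct.tmul_mul_tmul, evα_tmul, evα_tmul, Q.isAntiLeg_Sl.multiplicative]
    simp only [mul_assoc]
  rw [inr_apply, join, leg_slot, LinearMap.id_comp, AlgHom.toLinearMap_apply,
    Algebra.TensorProduct.tmul_mul_tmul, one_mul, pairing_tmul, aux, evα_Δ, counitLeg_apply,
    ← Algebra.smul_def, map_smul, pairing_tmul, evα_tmul]
  simp only [mul_smul_comm, smul_mul_assoc, map_smul]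

end QuasiHopfAlgebra

namespace QuasiHopfAlgebra

open RightComoduleAlgebra

/-! ### Twisting elements between a homomorphism and an antihomomorphism -/

section Twist

variable {k A B C H : Type*} [Field k] [Ring A] [Algebra k A] [Ring B] [Algebra k B]
  [Ring C] [Algebra k C] [Ring H] [Algebra k H] (Q : QuasiHopfAlgebra k H)

/-- The element `∑ T(x¹) γ F(x² β S(x³))`, where `Φ⁻¹ = ∑ x¹ ⊗ x² ⊗ x³`. -/
def twist (F T : H →ₗ[k] B) (γ : B) : B :=
  Q.pairing γ F Q.Sl (Q.self.phiInv (inl H (lt T)) (inl H (rt F)) (inr (Opr k B) LinearMap.id))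

variable {F T : H →ₗ[k] B} {γ : B}

/-- Evaluate quasi-coassociativity of `Φ⁻¹` on the legs `T`, `F` and the argument of `S`. On one
side `β` absorbs the last two legs and leaves `T(h)` outside; on the other `γ` absorbs the first two
and leaves `F(S(h))`. -/
theorem twist_mul_S (hF : IsLeg F) (hT : IsAntiLeg T)
    (hγ : LeftAgree (act γ) (join Q.Δ (lt T) (rt F)) (counitLeg (Opr k B) Q.ε)) (h : H) :
    Q.twist F T γ * F (Q.Sl h) = T h * Q.twist F T γ := by
  have key := congrArg (Q.pairing γ F Q.Sl)
    (phiInv_coassoc (R := Q.self) (hT.lt.inl (C := H)) (hF.rt.inl (C := H))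
      (isLeg_id.inr (B := Opr k B)) (comm_lt_rt T F).inl (comm_inl_inr _ _) (comm_inl_inr _ _) h)
  have r : RightAgree (Q.pairing γ F Q.Sl)
      (join Q.Δ (inl H (lt T)) (join Q.Δ (inl H (rt F)) (inr (Opr k B) LinearMap.id)))
      (inl H (lt T)) := by
    have := (Q.rightAgree_pairing γ hF (ν := Q.Sl) (i := LinearMap.id)
      (fun c h ↦ Q.isAntiLeg_Sl.multiplicative c h)).join_right Q.Δ (inl H (lt T))
    rwa [Q.join_counit] at this
  have l : LeftAgree (Q.pairing γ F Q.Sl)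
      (join Q.Δ (join Q.Δ (inl H (lt T)) (inl H (rt F))) (inr (Opr k B) LinearMap.id))
      (inr (Opr k B) LinearMap.id) := by
    have := Q.leftAgree_pairing (C := H) F Q.Sl hγ
    rw [inl_join, inl_counitLeg] at this
    have := this.join_left Q.Δ (inr (Opr k B) LinearMap.id)
    rwa [Q.counit_join] at this
  refine Eq.trans ?_ (key.symm.trans ?_)
  · exact ((l h _).trans (Q.pairing_Sl_inr_mul γ hF h _)).symm
  · exact (r h _).trans (Q.pairing_mul_lt γ F Q.Sl T h _)

/-- The factor `F(α)` completes `β S(x³)` to `β S(x³) α`, to which the pentagon applies: one side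
reduces to `twist * F α`, the other to `γ F(∑ X¹ β S(X²) α X³) = γ`. -/
theorem twist_mul_α (hF : IsLeg F) (hT : IsAntiLeg T)
    (hγ : LeftAgree (act γ) (join Q.Δ (lt T) (rt F)) (counitLeg (Opr k B) Q.ε)) :
    Q.twist F T γ * F Q.α = γ := by
  have key := apply_phi_mul_phiInv (R := Q.self) (Q.leftAgree_pairing_evα γ F)
    (Q.rightAgree_pairing γ hF (ν := Q.evα) (i := slot₁ k H H) (fun t h ↦ by
      rw [inl_apply, LinearMap.id_apply]
      induction t with
      | zero => simp
      | add y z hy hz => simp only [map_add, tensor_add_mul, mul_add, hy, hz]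
      | tmul y z =>
        rw [Algebra.TensorProduct.tmul_mul_tmul, evα_tmul, evα_tmul,
          Q.isAntiLeg_Sl.multiplicative, mul_one]
        simp only [mul_assoc]))
    (hT.lt.inl (C := H ⊗[k] H)) (hF.rt.inl (C := H ⊗[k] H))
    (isLeg_id.inl.inr (B := Opr k B)) (isLeg_id.inr.inr (B := Opr k B))
    (comm_lt_rt T F).inl (comm_inl_inr _ _) (comm_inl_inr _ _) (comm_inl_inr _ _)
    (comm_inl_inr _ _) (comm_inl_inr _ _).inr
  -- Since `γ` absorbs `T⋆F`, the factor `Φ[T⋆F, ·, ·]` becomes `Φ[ε, ·, ·] = 1`.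
  have l := (Q.leftAgree_pairing (C := H ⊗[k] H) F Q.evα hγ).leg_left
    (leg (inr (Opr k B) (slot₁ k H H)) (inr (Opr k B) (slot₂ k H H))) ↑Q.Φ
    (Q.self.phiInv (inl (H ⊗[k] H) (lt T)) (inl (H ⊗[k] H) (rt F)) (inr (Opr k B) (slot₁ k H H)))
  rw [inl_join, inl_counitLeg] at l
  have l' := l.symm.trans key
  have h₁ : leg (counitLeg (Opr k B ⊗[k] (H ⊗[k] H)) Q.ε)
      (leg (inr (Opr k B) (slot₁ k H H)) (inr (Opr k B) (slot₂ k H H))) ↑Q.Φ = 1 :=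
    Q.phi_counit_left isLeg_id.inl.inr isLeg_id.inr.inr (comm_inl_inr _ _).inr
  rw [h₁, one_mul] at l'
  have h₂ : Q.pairing γ F Q.evα (Q.self.phiInv (inl (H ⊗[k] H) (lt T)) (inl (H ⊗[k] H) (rt F))
      (inr (Opr k B) (slot₁ k H H))) = Q.twist F T γ * F Q.α := by
    rw [twist, phiInv, phiInv]
    induction (↑Q.self.Φρ⁻¹ : H ⊗[k] (H ⊗[k] H)) with
    | zero => simp
    | add y z hy hz => simp only [map_add, add_mul, hy, hz]
    | tmul x t =>
    induction t with
    | zero => simp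
    | add y z hy hz => simp only [map_add, tmul_add, add_mul, hy, hz]
    | tmul y z =>
    simp only [leg_tmul, inl_apply, inr_apply, Algebra.TensorProduct.tmul_mul_tmul, one_mul,
      mul_one, pairing_tmul, act_mul, act_rt, act_lt, LinearMap.id_apply, evα_tmul]
    rw [mul_assoc _ (F (Q.β * Q.Sl z)), ← hF.multiplicative]
    simp only [mul_assoc]
  rw [← h₂, l']
  have h₃ := Q.zigzag (Q.pairing γ F Q.evα ∘ₗ leg (inl (H ⊗[k] H) (rt F))
    (leg (inr (Opr k B) (slot₁ k H H)) (inr (Opr k B) (slot₂ k H H)))) (LinearMap.mulLeft k γ ∘ₗ F)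
    (fun x y z ↦ by
      simp only [LinearMap.comp_apply, leg_tmul, inl_apply, inr_apply, mul_one, one_mul,
        Algebra.TensorProduct.tmul_mul_tmul, pairing_tmul, act_rt, LinearMap.mulLeft_apply,
        LinearMap.id_apply, evα_tmul]
      rw [mul_assoc, ← hF.multiplicative]
      simp only [mul_assoc])
  rw [LinearMap.comp_apply, LinearMap.comp_apply, hF.unital, LinearMap.mulLeft_apply, mul_one] at h₃
  exact h₃

/-- Such a `w` is recovered from `w F(α)`: moving `T(x¹)` through `w` gives `∑ T(x¹) w F(α) F(x² β
S(x³)) = w F(∑ S(x¹) α x² β S(x³)) = w`. -/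
theorem eq_of_mul_S {u v : B} (hF : IsLeg F) (hu : ∀ h, u * F (Q.Sl h) = T h * u)
    (hv : ∀ h, v * F (Q.Sl h) = T h * v) (h : u * F Q.α = v * F Q.α) : u = v := by
  have aux (w : B) (hw : ∀ h, w * F (Q.Sl h) = T h * w) :
      leg T (LinearMap.mulLeft k (w * F Q.α) ∘ₗ F ∘ₗ Q.coevβ) (↑Q.Φ⁻¹ : H ⊗[k] (H ⊗[k] H)) = w := by
    have := Q.zigzag_inv (leg T (LinearMap.mulLeft k (w * F Q.α) ∘ₗ F ∘ₗ Q.coevβ))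
      (LinearMap.mulLeft k w ∘ₗ F) (fun x y z ↦ by
        simp only [leg_tmul, LinearMap.comp_apply, LinearMap.mulLeft_apply, coevβ_tmul]
        rw [hF.multiplicative (Q.Sl x * Q.α), hF.multiplicative (Q.Sl x), ← mul_assoc w,
          ← mul_assoc w, hw]
        simp only [mul_assoc])
    rwa [LinearMap.comp_apply, hF.unital, LinearMap.mulLeft_apply, mul_one] at this
  rw [← aux u hu, ← aux v hv, h]

end Twist

end QuasiHopfAlgebra

/-! ### Linear maps that intertwine operators -/

section Intertwine

variable {k A A' B B' H : Type*} [Field k] [Ring A] [Algebra k A] [Ring A'] [Algebra k A']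
  [Ring B] [Algebra k B] [Ring B'] [Algebra k B'] [Ring H] [Algebra k H]

/-- `φ` intertwines the operators `f x` on `B` with the operators `f' x` on `B'`. -/
def Intertwines (φ : B →ₗ[k] B') (f : A →ₗ[k] Opr k B) (f' : A →ₗ[k] Opr k B') : Prop :=
  ∀ x v, φ (act v (f x)) = act (φ v) (f' x)

theorem Intertwines.leg {φ : B →ₗ[k] B'} {f : A →ₗ[k] Opr k B} {f' : A →ₗ[k] Opr k B'}
    {g : A' →ₗ[k] Opr k B} {g' : A' →ₗ[k] Opr k B'} (hf : Intertwines φ f f')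
    (hg : Intertwines φ g g') : Intertwines φ (leg f g) (leg f' g') := by
  intro t v
  induction t with
  | zero => simp
  | add y z hy hz => simp only [map_add, hy, hz]
  | tmul a b => rw [leg_tmul, leg_tmul, act_mul, act_mul, hg, hf]

theorem Intertwines.join {C : Type*} [Ring C] [Algebra k C] {φ : B →ₗ[k] B'}
    {f : A →ₗ[k] Opr k B} {f' : A →ₗ[k] Opr k B'}
    {g : A' →ₗ[k] Opr k B} {g' : A' →ₗ[k] Opr k B'} (hf : Intertwines φ f f')
    (hg : Intertwines φ g g') (δ : C →ₐ[k] A ⊗[k] A') :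
    Intertwines φ (join δ f g) (join δ f' g') :=
  fun x v ↦ hf.leg hg (δ x) v

theorem Intertwines.tau {Q : QuasiBialgebra k H} {φ : B →ₗ[k] B'} {b c d e : H →ₗ[k] Opr k B}
    {b' c' d' e' : H →ₗ[k] Opr k B'} (hb : Intertwines φ b b') (hc : Intertwines φ c c')
    (hd : Intertwines φ d d') (he : Intertwines φ e e') (v : B) :
    φ (act v (Q.tau b c d e)) = act (φ v) (Q.tau b' c' d' e') := by
  refine (((hb.join hc Q.Δ).leg (hd.leg he)) ↑Q.Φ⁻¹ _).trans ?_
  exact congrArg (fun w ↦ act w (Q.self.phiInv (QuasiHopf.join Q.Δ b' c') d' e'))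
    ((hb.leg (hc.leg hd)) ↑Q.Φ v)

theorem intertwines_rt {φ : B →ₗ[k] B'} {f : A →ₗ[k] B} {f' : A →ₗ[k] B'}
    (h : ∀ v x, φ (v * f x) = φ v * f' x) : Intertwines φ (rt f) (rt f') := fun x v ↦ h v x

theorem intertwines_lt {φ : B →ₗ[k] B'} {f : A →ₗ[k] B} {f' : A →ₗ[k] B'}
    (h : ∀ v x, φ (f x * v) = f' x * φ v) : Intertwines φ (lt f) (lt f') := fun x v ↦ h v x

end Intertwine

namespace QuasiHopfAlgebra

open RightComoduleAlgebra

/-! ### The Drinfeld twist and its defining relations -/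

section Gamma

variable {k A B B' H : Type*} [Field k] [Ring A] [Algebra k A] [Ring B] [Algebra k B]
  [Ring B'] [Algebra k B'] [Ring H] [Algebra k H] (Q : QuasiHopfAlgebra k H)

/-- The map `h ↦ d(S(h₂)) e(S(h₁))`. -/
def antiS (d e : H →ₗ[k] B) : H →ₗ[k] B := join Q.Δ (e ∘ₗ Q.Sl) (d ∘ₗ Q.Sl)

/-- The element `γ` with `γ = f Δ(α)` for the Drinfeld twist `f`, in terms of two legs. -/
def gam (d e : H →ₗ[k] B) : B :=
  act (d Q.α * e Q.α) (Q.tau (lt (e ∘ₗ Q.Sl)) (lt (d ∘ₗ Q.Sl)) (rt d) (rt e))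

/-- The Drinfeld twist. -/
def drinfeld : H ⊗[k] H :=
  Q.twist Q.Δ.toLinearMap (Q.antiS (slot₁ k H H) (slot₂ k H H)) (Q.gam (slot₁ k H H) (slot₂ k H H))

variable {d e : H →ₗ[k] B}

theorem isAntiLeg_antiS (hd : IsLeg d) (he : IsLeg e) (hde : Comm d e) :
    IsAntiLeg (Q.antiS d e) :=
  (he.comp_anti Q.isAntiLeg_Sl).join (hd.comp_anti Q.isAntiLeg_Sl)
    ((hde.symm.comp_right _).comp_left _) _

theorem lt_antiS (hde : Comm d e) :
    lt (Q.antiS d e) = join Q.Δ (lt (e ∘ₗ Q.Sl)) (lt (d ∘ₗ Q.Sl)) :=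
  lt_join _ ((hde.symm.comp_right _).comp_left _)

/-- This is the hypothesis on `γ` in the section on twisting elements. By `tau_absorb` it reduces to
two instances of the axiom for `α`: the inner pair of legs meets `d(α)`, the outer pair `e(α)`. -/
theorem leftAgree_gam (hd : IsLeg d) (he : IsLeg e) (hde : Comm d e) :
    LeftAgree (act (Q.gam d e)) (join Q.Δ (lt (Q.antiS d e)) (rt (join Q.Δ d e)))
      (counitLeg (Opr k B) Q.ε) := by
  rw [Q.lt_antiS hde, rt_join]
  have h₁ := Q.leftAgree_alpha hd (w := e Q.α) (fun x ↦ (hde _ _).symm)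
  have h₂ := Q.leftAgree_alpha he (w := d Q.α) (fun x ↦ hde _ _)
  rw [← hde] at h₂
  exact Q.tau_absorb h₁ h₂ (he.comp_anti Q.isAntiLeg_Sl).lt (hd.comp_anti Q.isAntiLeg_Sl).lt hd.rt
    he.rt ((hde.symm.comp_right _).comp_left _).lt (comm_lt_rt _ _) (comm_lt_rt _ _)
    (comm_lt_rt _ _) (comm_lt_rt _ _) hde.rt

theorem map_gam {φ : B →ₗ[k] B'} (hφ : IsLeg φ) :
    φ (Q.gam d e) = Q.gam (φ ∘ₗ d) (φ ∘ₗ e) := by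
  rw [gam, gam, (intertwines_lt fun v x ↦ ?_ : Intertwines φ (lt (e ∘ₗ Q.Sl))
    (lt ((φ ∘ₗ e) ∘ₗ Q.Sl))).tau (intertwines_lt fun v x ↦ ?_)
    (intertwines_rt fun v x ↦ ?_) (intertwines_rt fun v x ↦ ?_), hφ.multiplicative]
  · rfl
  all_goals rw [hφ.multiplicative]; rfl

theorem leg_gam (hd : IsLeg d) (he : IsLeg e) (hde : Comm d e) :
    leg d e (Q.gam (slot₁ k H H) (slot₂ k H H)) = Q.gam d e := by
  rw [Q.map_gam (hd.leg he hde)]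
  congr 1
  · ext x; simp [inl_apply, he.unital]
  · ext x; simp [inr_apply, hd.unital]

theorem leg_antiS (hd : IsLeg d) (he : IsLeg e) (hde : Comm d e) (h : H) :
    leg d e (Q.antiS (slot₁ k H H) (slot₂ k H H) h) = Q.antiS d e h := by
  rw [antiS, antiS, join_apply, join_apply]
  induction Q.Δ h with
  | zero => simp
  | add y z hy hz => simp only [map_add, hy, hz]
  | tmul x y =>
  rw [leg_tmul, leg_tmul, (hd.leg he hde).multiplicative]
  simp [inl_apply, inr_apply, he.unital, hd.unital]

theorem Δ_eq : Q.Δ.toLinearMap = join Q.Δ (slot₁ k H H) (slot₂ k H H) := by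
  rw [join, leg_slot]; rfl

/-- The case `F = Δ` of `twist_mul_S` in `H ⊗ H`, pushed forward along the algebra map `leg d e`.
Arbitrary commuting legs are needed to apply it inside threefold tensors. -/
theorem drinfeld_mul_S (hd : IsLeg d) (he : IsLeg e) (hde : Comm d e) (h : H) :
    leg d e Q.drinfeld * join Q.Δ d e (Q.Sl h) = Q.antiS d e h * leg d e Q.drinfeld := by
  have hs : Comm (slot₁ k H H) (slot₂ k H H) := comm_inl_inr _ _
  have hl := Q.leftAgree_gam isLeg_id.inl isLeg_id.inr hs
  rw [← Q.Δ_eq] at hl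
  have := congrArg (leg d e) (Q.twist_mul_S (IsLeg.algHom Q.Δ)
    (Q.isAntiLeg_antiS isLeg_id.inl isLeg_id.inr hs) hl h)
  rw [(hd.leg he hde).multiplicative, (hd.leg he hde).multiplicative, Q.leg_antiS hd he hde] at this
  exact this

theorem drinfeld_mul_α (hd : IsLeg d) (he : IsLeg e) (hde : Comm d e) :
    leg d e Q.drinfeld * join Q.Δ d e Q.α = Q.gam d e := by
  have hs : Comm (slot₁ k H H) (slot₂ k H H) := comm_inl_inr _ _
  have hl := Q.leftAgree_gam isLeg_id.inl isLeg_id.inr hs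
  rw [← Q.Δ_eq] at hl
  have := congrArg (leg d e) (Q.twist_mul_α (IsLeg.algHom Q.Δ)
    (Q.isAntiLeg_antiS isLeg_id.inl isLeg_id.inr hs) hl)
  rw [(hd.leg he hde).multiplicative, Q.leg_gam hd he hde] at this
  exact this

end Gamma

/-! ### Compatibility of the Drinfeld twist with the reassociator -/

section Coherence

variable {k B H : Type*} [Field k] [Ring B] [Algebra k B] [Ring H] [Algebra k H]
  (Q : QuasiHopfAlgebra k H) {d₁ d₂ d₃ : H →ₗ[k] B}

theorem act_leg_rt (v : B) (t : H ⊗[k] (H ⊗[k] H)) :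
    act v (leg (rt d₁) (leg (rt d₂) (rt d₃)) t) = v * leg d₁ (leg d₂ d₃) t := by
  rw [← rt_leg, ← rt_leg, act_rt]

theorem act_leg_lt (h₁₂ : Comm d₁ d₂) (h₁₃ : Comm d₁ d₃) (h₂₃ : Comm d₂ d₃) (v : B)
    (t : H ⊗[k] (H ⊗[k] H)) :
    act v (leg (lt d₁) (leg (lt d₂) (lt d₃)) t) = leg d₁ (leg d₂ d₃) t * v := by
  rw [← lt_leg h₂₃, ← lt_leg (h₁₂.leg_right h₁₃), act_lt]

/-- Under left multiplication the antihomomorphisms are legs. Reading the operator identity back in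
`B` reverses products, so the two bracketings change sides. -/
theorem phi_coassoc_anti (h₁ : IsAntiLeg d₁) (h₂ : IsAntiLeg d₂) (h₃ : IsAntiLeg d₃)
    (h₁₂ : Comm d₁ d₂) (h₁₃ : Comm d₁ d₃) (h₂₃ : Comm d₂ d₃) (x : H) :
    leg d₁ (leg d₂ d₃) ↑Q.Φ * join Q.Δ d₁ (join Q.Δ d₂ d₃) x =
      join Q.Δ (join Q.Δ d₁ d₂) d₃ x * leg d₁ (leg d₂ d₃) ↑Q.Φ := by
  have h := congrArg (act (1 : B)) (phi_coassoc (R := Q.self) h₁.lt h₂.lt h₃.lt h₁₂.lt h₁₃.lt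
    h₂₃.lt x)
  rw [show Q.self.ρ = Q.Δ from rfl, ← lt_join _ h₁₂, ← lt_join _ (h₁₃.join_left h₂₃),
    ← lt_join _ h₂₃, ← lt_join _ (h₁₂.join_right h₁₃), act_mul, act_mul, phi,
    act_leg_lt h₁₂ h₁₃ h₂₃, act_leg_lt h₁₂ h₁₃ h₂₃, act_lt, act_lt, mul_one, mul_one] at h
  exact h.symm

/-- The compatibility of the Drinfeld twist with the reassociator. -/
theorem drinfeld_cocycle (h₁ : IsLeg d₁) (h₂ : IsLeg d₂) (h₃ : IsLeg d₃) (h₁₂ : Comm d₁ d₂)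
    (h₁₃ : Comm d₁ d₃) (h₂₃ : Comm d₂ d₃) :
    leg d₂ d₃ Q.drinfeld * (leg d₁ (join Q.Δ d₂ d₃) Q.drinfeld * leg d₁ (leg d₂ d₃) ↑Q.Φ) =
      leg (d₃ ∘ₗ Q.Sl) (leg (d₂ ∘ₗ Q.Sl) (d₁ ∘ₗ Q.Sl)) ↑Q.Φ *
        (leg d₁ d₂ Q.drinfeld * leg (join Q.Δ d₁ d₂) d₃ Q.drinfeld) := by
  have l₁₂ : IsLeg (join Q.Δ d₁ d₂) := h₁.join h₂ h₁₂
  have l₂₃ : IsLeg (join Q.Δ d₂ d₃) := h₂.join h₃ h₂₃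
  have c₁ : Comm d₁ (join Q.Δ d₂ d₃) := h₁₂.join_right h₁₃
  have c₃ : Comm (join Q.Δ d₁ d₂) d₃ := h₁₃.join_left h₂₃
  have a₁ := h₁.comp_anti Q.isAntiLeg_Sl
  have a₂ := h₂.comp_anti Q.isAntiLeg_Sl
  have a₃ := h₃.comp_anti Q.isAntiLeg_Sl
  have a₂₁ : Comm (d₂ ∘ₗ Q.Sl) (d₁ ∘ₗ Q.Sl) := (h₁₂.symm.comp_left _).comp_right _
  have a₃₁ : Comm (d₃ ∘ₗ Q.Sl) (d₁ ∘ₗ Q.Sl) := (h₁₃.symm.comp_left _).comp_right _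
  have a₃₂ : Comm (d₃ ∘ₗ Q.Sl) (d₂ ∘ₗ Q.Sl) := (h₂₃.symm.comp_left _).comp_right _
  have m₁ (h : H) : leg d₂ d₃ Q.drinfeld * Q.antiS d₁ (join Q.Δ d₂ d₃) h =
      join Q.Δ (join Q.Δ (d₃ ∘ₗ Q.Sl) (d₂ ∘ₗ Q.Sl)) (d₁ ∘ₗ Q.Sl) h * leg d₂ d₃ Q.drinfeld :=
    mul_leg_left (Q.drinfeld_mul_S h₂ h₃ h₂₃)
      (fun y ↦ (h₁₂.symm.leg_left h₁₃.symm).comp_right Q.Sl _ y) _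
  have m₂ (h : H) : leg d₁ d₂ Q.drinfeld * Q.antiS (join Q.Δ d₁ d₂) d₃ h =
      join Q.Δ (d₃ ∘ₗ Q.Sl) (join Q.Δ (d₂ ∘ₗ Q.Sl) (d₁ ∘ₗ Q.Sl)) h * leg d₁ d₂ Q.drinfeld :=
    mul_leg_right (fun y ↦ (h₁₃.leg_left h₂₃).comp_right Q.Sl _ y)
      (Q.drinfeld_mul_S h₁ h₂ h₁₂) _
  have p₁ (h : H) : leg d₁ (leg d₂ d₃) ↑Q.Φ * join Q.Δ (join Q.Δ d₁ d₂) d₃ h =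
      join Q.Δ d₁ (join Q.Δ d₂ d₃) h * leg d₁ (leg d₂ d₃) ↑Q.Φ :=
    phi_coassoc (R := Q.self) h₁ h₂ h₃ h₁₂ h₁₃ h₂₃ h
  have p₂ := Q.phi_coassoc_anti a₃ a₂ a₁ a₃₂ a₃₁ a₂₁
  -- Here `c` and `d` are `lt (d₁ ∘ S)` and `rt d₁`, which the vector `d₁(α) d₂(α) d₃(α)` absorbs.
  have key := Q.tau_tau (s := act (d₁ Q.α * (d₂ Q.α * d₃ Q.α)))
    (Q.leftAgree_alpha h₁ fun x ↦ by rw [mul_assoc, ← h₁₃, ← mul_assoc, ← h₁₂, mul_assoc])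
    a₃.lt a₂.lt a₁.lt h₁.rt h₂.rt h₃.rt a₃₂.lt a₃₁.lt (comm_lt_rt _ _) (comm_lt_rt _ _)
    (comm_lt_rt _ _) a₂₁.lt (comm_lt_rt _ _) (comm_lt_rt _ _) (comm_lt_rt _ _) (comm_lt_rt _ _)
    (comm_lt_rt _ _) (comm_lt_rt _ _) h₁₂.rt h₁₃.rt h₂₃.rt
  -- Both sides intertwine the same homomorphism and antihomomorphism, so by uniqueness it suffices
  -- to compare them after multiplication by the image of `α`.
  refine Q.eq_of_mul_S (F := join Q.Δ (join Q.Δ d₁ d₂) d₃)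
    (T := join Q.Δ (join Q.Δ (d₃ ∘ₗ Q.Sl) (d₂ ∘ₗ Q.Sl)) (d₁ ∘ₗ Q.Sl)) (l₁₂.join h₃ c₃) ?_ ?_ ?_
  · intro h
    rw [mul_assoc, mul_assoc, p₁, ← mul_assoc (leg d₁ _ _), Q.drinfeld_mul_S h₁ l₂₃ c₁,
      mul_assoc, ← mul_assoc, m₁, mul_assoc]
  · intro h
    rw [mul_assoc, mul_assoc, Q.drinfeld_mul_S l₁₂ h₃ c₃, ← mul_assoc (leg d₁ d₂ _), m₂,
      mul_assoc, ← mul_assoc, p₂, mul_assoc]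
  · rw [mul_assoc, mul_assoc, p₁, ← mul_assoc (leg d₁ _ _), Q.drinfeld_mul_α h₁ l₂₃ c₁,
      mul_assoc, mul_assoc, Q.drinfeld_mul_α l₁₂ h₃ c₃, ← mul_assoc]
    -- Multiplication by `f` on the legs `d₂`, `d₃` changes `(d₂⋆d₃) ∘ S` into the convolution of
    -- the two antipode legs and `(d₂⋆d₃)(α)` into `γ`. The result is a composite of two `T`'s
    -- acting on the three copies of `α`, as in `tau_tau`.
    have g₁ : leg d₂ d₃ Q.drinfeld * Q.gam d₁ (join Q.Δ d₂ d₃) =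
        act (d₁ Q.α * (d₂ Q.α * d₃ Q.α))
          (Q.tau (lt (d₃ ∘ₗ Q.Sl)) (lt (d₂ ∘ₗ Q.Sl)) (rt d₂) (rt d₃) *
            Q.tau (join Q.Δ (lt (d₃ ∘ₗ Q.Sl)) (lt (d₂ ∘ₗ Q.Sl))) (lt (d₁ ∘ₗ Q.Sl)) (rt d₁)
              (join Q.Δ (rt d₂) (rt d₃))) := by
      have i₁ : Intertwines (LinearMap.mulLeft k (leg d₂ d₃ Q.drinfeld))
          (lt (join Q.Δ d₂ d₃ ∘ₗ Q.Sl)) (lt (Q.antiS d₂ d₃)) := intertwines_lt fun v x ↦ by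
        simp only [LinearMap.mulLeft_apply, LinearMap.comp_apply]
        rw [← mul_assoc, Q.drinfeld_mul_S h₂ h₃ h₂₃, mul_assoc]
      have i₂ : Intertwines (LinearMap.mulLeft k (leg d₂ d₃ Q.drinfeld))
          (lt (d₁ ∘ₗ Q.Sl)) (lt (d₁ ∘ₗ Q.Sl)) := intertwines_lt fun v x ↦ by
        simp only [LinearMap.mulLeft_apply, LinearMap.comp_apply]
        rw [← mul_assoc, (h₁₂.symm.leg_left h₁₃.symm), mul_assoc]
      have i₃ (f : H →ₗ[k] B) : Intertwines (LinearMap.mulLeft k (leg d₂ d₃ Q.drinfeld))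
          (rt f) (rt f) := intertwines_rt fun v x ↦ by simp [mul_assoc]
      have j₁ (f : H →ₗ[k] B) : Intertwines (LinearMap.mulLeft k (d₁ Q.α))
          (rt f) (rt f) := intertwines_rt fun v x ↦ by simp [mul_assoc]
      have j₂ (f : H →ₗ[k] B) (hf : Comm d₁ f) : Intertwines (LinearMap.mulLeft k (d₁ Q.α))
          (lt (f ∘ₗ Q.Sl)) (lt (f ∘ₗ Q.Sl)) := intertwines_lt fun v x ↦ by
        simp only [LinearMap.mulLeft_apply, LinearMap.comp_apply]
        rw [← mul_assoc, hf, mul_assoc]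
      have e₁ := i₁.tau (Q := Q.toQuasiBialgebra) i₂ (i₃ d₁) (i₃ (join Q.Δ d₂ d₃))
        (d₁ Q.α * join Q.Δ d₂ d₃ Q.α)
      have e₂ := (j₂ d₃ h₁₃).tau (Q := Q.toQuasiBialgebra) (j₂ d₂ h₁₂) (j₁ d₂) (j₁ d₃)
        (d₂ Q.α * d₃ Q.α)
      rw [LinearMap.mulLeft_apply, LinearMap.mulLeft_apply, ← mul_assoc,
        (h₁₂.symm.leg_left h₁₃.symm), mul_assoc, Q.drinfeld_mul_α h₂ h₃ h₂₃, Q.lt_antiS h₂₃,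
        rt_join] at e₁
      rw [act_mul, gam, rt_join, e₁]
      exact congrArg (fun w ↦ act w _) e₂
    have g₂ : leg d₁ d₂ Q.drinfeld * Q.gam (join Q.Δ d₁ d₂) d₃ =
        act (d₁ Q.α * (d₂ Q.α * d₃ Q.α))
          (Q.tau (lt (d₂ ∘ₗ Q.Sl)) (lt (d₁ ∘ₗ Q.Sl)) (rt d₁) (rt d₂) *
            Q.tau (lt (d₃ ∘ₗ Q.Sl)) (join Q.Δ (lt (d₂ ∘ₗ Q.Sl)) (lt (d₁ ∘ₗ Q.Sl)))
              (join Q.Δ (rt d₁) (rt d₂)) (rt d₃)) := by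
      have i₁ : Intertwines (LinearMap.mulLeft k (leg d₁ d₂ Q.drinfeld))
          (lt (join Q.Δ d₁ d₂ ∘ₗ Q.Sl)) (lt (Q.antiS d₁ d₂)) := intertwines_lt fun v x ↦ by
        simp only [LinearMap.mulLeft_apply, LinearMap.comp_apply]
        rw [← mul_assoc, Q.drinfeld_mul_S h₁ h₂ h₁₂, mul_assoc]
      have i₂ : Intertwines (LinearMap.mulLeft k (leg d₁ d₂ Q.drinfeld))
          (lt (d₃ ∘ₗ Q.Sl)) (lt (d₃ ∘ₗ Q.Sl)) := intertwines_lt fun v x ↦ by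
        simp only [LinearMap.mulLeft_apply, LinearMap.comp_apply]
        rw [← mul_assoc, (h₁₃.leg_left h₂₃), mul_assoc]
      have i₃ (f : H →ₗ[k] B) : Intertwines (LinearMap.mulLeft k (leg d₁ d₂ Q.drinfeld))
          (rt f) (rt f) := intertwines_rt fun v x ↦ by simp [mul_assoc]
      have j₁ (f : H →ₗ[k] B) (hf : Comm f d₃) : Intertwines (LinearMap.mulRight k (d₃ Q.α))
          (rt f) (rt f) := intertwines_rt fun v x ↦ by
        simp only [LinearMap.mulRight_apply]
        rw [mul_assoc, hf, mul_assoc]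
      have j₂ (f : H →ₗ[k] B) : Intertwines (LinearMap.mulRight k (d₃ Q.α))
          (lt (f ∘ₗ Q.Sl)) (lt (f ∘ₗ Q.Sl)) := intertwines_lt fun v x ↦ by simp [mul_assoc]
      have e₁ := i₂.tau (Q := Q.toQuasiBialgebra) i₁ (i₃ (join Q.Δ d₁ d₂)) (i₃ d₃)
        (join Q.Δ d₁ d₂ Q.α * d₃ Q.α)
      have e₂ := (j₂ d₂).tau (Q := Q.toQuasiBialgebra) (j₂ d₁) (j₁ d₁ h₁₃) (j₁ d₂ h₂₃)
        (d₁ Q.α * d₂ Q.α)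
      rw [LinearMap.mulLeft_apply, LinearMap.mulLeft_apply, ← mul_assoc,
        Q.drinfeld_mul_α h₁ h₂ h₁₂, Q.lt_antiS h₁₂, rt_join] at e₁
      rw [LinearMap.mulRight_apply, LinearMap.mulRight_apply, mul_assoc] at e₂
      rw [act_mul, ← e₂, gam, rt_join, e₁]
      rfl
    rw [← mul_assoc] at key
    rw [g₁, g₂, ← act_leg_rt, ← act_leg_lt a₃₂ a₃₁ a₂₁]
    simp only [← act_mul]
    rw [mul_assoc] at key ⊢
    rw [mul_assoc]
    exact key

end Coherence

end QuasiHopfAlgebra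

namespace QuasiHopfAlgebra

open RightComoduleAlgebra

/-! ### Counit values of α, β, the antipode and the twist -/

section Counit

variable {k A B H : Type*} [Field k] [Ring A] [Algebra k A] [Ring B] [Algebra k B]
  [Ring H] [Algebra k H] (Q : QuasiHopfAlgebra k H)

theorem lt_counitLeg : lt (counitLeg B Q.ε) = counitLeg (Opr k B) Q.ε := by
  ext x : 1
  exact opr_ext fun v ↦ by
    rw [act_lt, counitLeg_apply, counitLeg_apply, ← Algebra.smul_def, Algebra.algebraMap_eq_smul_one,
      map_smul, act_one]

theorem rt_counitLeg : rt (counitLeg B Q.ε) = counitLeg (Opr k B) Q.ε := by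
  rw [← lt_counitLeg]
  ext x : 1
  exact opr_ext fun v ↦ comm_counitLeg Q.ε LinearMap.id v x

/-- Apply `ε` to `∑ X¹ β S(X²) α X³ = 1`. Since `(ε ⊗ id ⊗ id)(Φ) = 1`, the antipode is only
evaluated at `1`, so `ε ∘ S = ε` is not needed here. -/
theorem counit_alpha_mul_counit_beta : Q.ε Q.α * Q.ε Q.β = 1 := by
  have h := Q.zigzag (leg (counitLeg k Q.ε) (leg (LinearMap.mulLeft k (Q.ε Q.β * Q.ε Q.α) ∘ₗ
    (Q.ε.toLinearMap ∘ₗ Q.Sl)) (counitLeg k Q.ε))) Q.ε.toLinearMap fun x y z ↦ by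
      simp [counitLeg_apply]; ring
  rw [AlgHom.toLinearMap_apply, map_one Q.ε, leg_counitLeg_left, Q.normalized_left,
    Algebra.TensorProduct.one_def, leg_tmul] at h
  simpa [Q.isAntiLeg_Sl.unital, mul_comm, counitLeg_apply] using h

/-- Applying `ε` to the axiom for `α` gives `ε(S(h)) ε(α) = ε(h) ε(α)`, and `ε(α)` is invertible
with inverse `ε(β)`. -/
theorem counit_Sl (h : H) : Q.ε (Q.Sl h) = Q.ε h := by
  have h₁ := congrArg Q.ε (Q.evα_Δ h)
  have h₂ (t : H ⊗[k] H) : Q.ε (Q.evα t) = Q.ε (Q.Sl (dropRight H Q.ε t)) * Q.ε Q.α := by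
    induction t with
    | zero => simp
    | add y z hy hz => simp only [map_add, add_mul, hy, hz]
    | tmul y z => simp; ring
  rw [h₂, Q.counit_right, map_smul, smul_eq_mul] at h₁
  have h₃ := congrArg (· * Q.ε Q.β) h₁
  simpa only [mul_assoc, Q.counit_alpha_mul_counit_beta, mul_one] using h₃

theorem counit_Si (h : H) : Q.ε (Q.Si h) = Q.ε h := by
  rw [← Q.counit_Sl, Q.Sl_Si]

theorem counitLeg_comp_Sl : counitLeg B Q.ε ∘ₗ Q.Sl = counitLeg B Q.ε := by
  ext x; rw [LinearMap.comp_apply, counitLeg_apply, Q.counit_Sl, counitLeg_apply]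

/-- `(id ⊗ ε)(f) = ε(α)`. -/
theorem drinfeld_counit_right : dropRight H Q.ε Q.drinfeld = Q.ε Q.α • 1 := by
  have hc := comm_counitLeg Q.ε (LinearMap.id : H →ₗ[k] H)
  have hε := isLeg_counitLeg (W := H) Q.ε
  have e : leg LinearMap.id (counitLeg H Q.ε) Q.drinfeld = dropRight H Q.ε Q.drinfeld :=
    leg_counitLeg_right _ _ _
  rw [← e]
  -- Uniqueness is used with `F = id` and `T = S`: a scalar satisfies `u S(h) = S(h) u`, and with `e
  -- = ε` the element `γ` degenerates to `ε(α) α`.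
  refine Q.eq_of_mul_S (T := Q.Sl) (isLeg_id (A := H)) (fun h ↦ ?_) (fun h ↦ ?_) ?_
  · have := Q.drinfeld_mul_S isLeg_id hε hc h
    rwa [Q.join_counit, antiS, counitLeg_comp_Sl, Q.counit_join] at this
  · simp
  · have := Q.drinfeld_mul_α isLeg_id hε hc
    rw [Q.join_counit, gam, counitLeg_comp_Sl, lt_counitLeg, rt_counitLeg, QuasiBialgebra.tau,
      Q.counit_join, LinearMap.id_comp, Q.phi_counit_left (Q.isAntiLeg_Sl.lt) isLeg_id.rt (comm_lt_rt _ _),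
      phiInv_counit_right (R := Q.self) (Q.isAntiLeg_Sl.lt) isLeg_id.rt (comm_lt_rt _ _),
      mul_one, act_one, counitLeg_apply, ← Algebra.commutes, ← Algebra.smul_def] at this
    simpa using this

end Counit

/-! ### Invertibility of the Drinfeld twist -/

section Invertible

variable {k B H : Type*} [Field k] [Ring B] [Algebra k B] [Ring H] [Algebra k H]
  (Q : QuasiHopfAlgebra k H) {d e : H →ₗ[k] B}

theorem inl_leg {A B C D : Type*} [Ring A] [Algebra k A] [Ring B] [Algebra k B] [Ring C]
    [Algebra k C] [Ring D] [Algebra k D] (f : A →ₗ[k] B) (g : D →ₗ[k] B) :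
    inl C (leg f g) = leg (inl C f) (inl C g) := by
  ext x y
  simp [inl_apply]

/-- On pure tensors the pairing only adds a right factor `F(β S(y))`. It is itself a value of `rt F`
and commutes with `X`, so it can be merged with `rt F x`. -/
theorem mul_pairing_eq_zero {C : Type*} [Ring C] [Algebra k C] {z ξ : B} {F : H →ₗ[k] B}
    (hF : IsLeg F) {f : C →ₗ[k] Opr k B} {u X : Opr k B} (hX : ∀ x, X * rt F x = rt F x * X)
    (h : ∀ c x, z * act ξ (u * (f c * rt F x * X)) = 0) (t : C ⊗[k] (H ⊗[k] H)) :
    z * Q.pairing ξ F Q.Sl (u ⊗ₜ 1 * leg (inl H f) (leg (inl H (rt F))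
      (inr (Opr k B) LinearMap.id)) t * X ⊗ₜ 1) = 0 := by
  induction t with
  | zero => simp
  | add y z hy hz => simp only [map_add, mul_add, add_mul, hy, hz, add_zero]
  | tmul c t =>
  induction t with
  | zero => simp
  | add y z hy hz => simp only [map_add, tmul_add, mul_add, add_mul, hy, hz, add_zero]
  | tmul x y =>
  simp only [leg_tmul, inl_apply, inr_apply, Algebra.TensorProduct.tmul_mul_tmul, one_mul, mul_one,
    pairing_tmul, LinearMap.id_apply]
  have := h c (x * (Q.β * Q.Sl y))
  rw [hF.rt.multiplicative, mul_assoc (f c), mul_assoc (rt F x), ← hX, ← mul_assoc (rt F x),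
    ← mul_assoc (f c), ← mul_assoc u, act_mul, act_rt] at this
  simpa only [mul_assoc] using this

/-- The relation `∑ S(x¹) α x² β S(x³) = 1` in the leg `F`, in the presence of a bystander vector
`w` and operator `X` that commute with this leg. -/
theorem pairing_phiInv_zigzag {w : B} {F : H →ₗ[k] B} (hF : IsLeg F) (hw : ∀ x, w * F x = F x * w)
    {X : Opr k B} (hX : ∀ x, X * rt F x = rt F x * X) :
    Q.pairing (F Q.α * w) F Q.Sl (Q.self.phiInv (inl H (lt (F ∘ₗ Q.Sl))) (inl H (rt F))
      (inr (Opr k B) LinearMap.id) * X ⊗ₜ 1) = act w X := by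
  have h := Q.zigzag_inv (Q.pairing (F Q.α * w) F Q.Sl ∘ₗ LinearMap.mulRight k (X ⊗ₜ 1) ∘ₗ
    leg (inl H (lt (F ∘ₗ Q.Sl))) (leg (inl H (rt F)) (inr (Opr k B) LinearMap.id)))
    (LinearMap.flip (LinearMap.mul k B) (1 : B) ∘ₗ (unop X) ∘ₗ (LinearMap.mulRight k w) ∘ₗ F)
    (fun x y z ↦ ?_)
  · simp only [LinearMap.comp_apply, hF.unital, LinearMap.mulRight_apply, LinearMap.flip_apply,
      LinearMap.mul_apply_apply, one_mul, mul_one] at h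
    exact h
  · simp only [LinearMap.comp_apply, leg_tmul, inl_apply, inr_apply, LinearMap.mulRight_apply,
      Algebra.TensorProduct.tmul_mul_tmul, one_mul, mul_one, pairing_tmul, LinearMap.id_apply,
      LinearMap.flip_apply, LinearMap.mul_apply_apply]
    change _ = act _ X
    rw [← act_rt, ← act_mul, mul_assoc, mul_assoc, hX, ← mul_assoc, ← mul_assoc, act_mul]
    simp only [act_mul, act_lt, act_rt, LinearMap.comp_apply, mul_assoc]
    rw [hF.multiplicative (Q.Sl x), hF.multiplicative Q.α, hF.multiplicative y]
    simp only [mul_assoc]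
    rw [← mul_assoc w, hw, mul_assoc (F y), hw]

theorem phi_mul_leg {W A C : Type*} [Ring W] [Algebra k W] [Ring A] [Algebra k A] [Ring C]
    [Algebra k C] {Q : QuasiBialgebra k H} {R : RightComoduleAlgebra Q A}
    {a : A →ₗ[k] W} {b c : H →ₗ[k] W} {g : C →ₗ[k] W} (ha : IsLeg a) (hb : IsLeg b) (hc : IsLeg c)
    (hab : Comm a b) (hac : Comm a c) (hbc : Comm b c) (hag : Comm a g) (hbg : Comm b g)
    (hcg : Comm c g) (t : A ⊗[k] C) :
    R.phi a b c * leg (join R.ρ (join R.ρ a b) c) g t =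
      leg (join R.ρ a (join Q.Δ b c)) g t * R.phi a b c :=
  mul_leg_left (phi_coassoc ha hb hc hab hac hbc) (phi_comm hag hbg hcg) _

/-- The ingredients of `γ` are stripped off one at a time: first the inverse reassociator in `T`,
then `e(α)`, then `d(α)`, each copy of `α` by a zigzag with `β`. What remains is `z * 1 = 0`. -/
theorem eq_zero_of_mul_antiS_mul_gam (hd : IsLeg d) (he : IsLeg e) (hde : Comm d e) {z : B}
    (hz : ∀ h x y, z * (Q.antiS d e h * (Q.gam d e * (d x * e y))) = 0) : z = 0 := by
  have hb : IsLeg (lt (e ∘ₗ Q.Sl)) := (he.comp_anti Q.isAntiLeg_Sl).lt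
  have hc : IsLeg (lt (d ∘ₗ Q.Sl)) := (hd.comp_anti Q.isAntiLeg_Sl).lt
  have hbc : Comm (lt (e ∘ₗ Q.Sl)) (lt (d ∘ₗ Q.Sl)) :=
    ((hde.symm.comp_right _).comp_left _).lt
  have hl : IsLeg (lt (Q.antiS d e)) := (Q.isAntiLeg_antiS hd he hde).lt
  have hL : IsLeg (leg (lt (Q.antiS d e)) (leg (rt d) (rt e))) :=
    hl.leg (hd.rt.leg he.rt hde.rt) ((comm_lt_rt _ _).leg_right (comm_lt_rt _ _))
  have z₁ (t : H ⊗[k] (H ⊗[k] H)) : z * act (d Q.α * e Q.α)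
      (Q.self.phi (lt (e ∘ₗ Q.Sl)) (lt (d ∘ₗ Q.Sl)) (rt d) *
        leg (lt (Q.antiS d e)) (leg (rt d) (rt e)) t) = 0 := by
    have aux (t : H ⊗[k] (H ⊗[k] H)) :
        z * act (Q.gam d e) (leg (lt (Q.antiS d e)) (leg (rt d) (rt e)) t) = 0 := by
      induction t with
      | zero => simp
      | add y z hy hz => simp only [map_add, mul_add, hy, hz, add_zero]
      | tmul c t =>
      induction t with
      | zero => simp
      | add y z hy hz => simp only [map_add, tmul_add, mul_add, hy, hz, add_zero]
      | tmul x y =>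
        rw [← hz c x y]; simp [mul_assoc]
    -- Putting `Φ` in front of `t` cancels the factor `Φ⁻` of `T`.
    have := aux (↑Q.Φ * t)
    rw [gam, ← act_mul, QuasiBialgebra.tau, ← Q.lt_antiS hde, hL.multiplicative, mul_assoc,
      ← mul_assoc (Q.self.phiInv _ _ _)] at this
    rwa [show Q.self.phiInv (lt (Q.antiS d e)) (rt d) (rt e) *
      leg (lt (Q.antiS d e)) (leg (rt d) (rt e)) ↑Q.Φ = 1 from hL.inv_mul Q.Φ, one_mul] at this
  have z₂ (t : H ⊗[k] H) : z * act (d Q.α) (Q.self.phi (lt (e ∘ₗ Q.Sl)) (lt (d ∘ₗ Q.Sl)) (rt d) *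
      leg (lt (Q.antiS d e)) (rt d) t) = 0 := by
    have hA : LeftAgree (Q.pairing (d Q.α * e Q.α) e Q.Sl)
        (join Q.Δ (inl H (lt (d ∘ₗ Q.Sl))) (inl H (rt d)))
        (counitLeg (Opr k B ⊗[k] H) Q.ε) := by
      have := Q.leftAgree_pairing (C := H) e Q.Sl
        (Q.leftAgree_alpha hd (w := e Q.α) fun x ↦ (hde _ _).symm)
      rwa [inl_join, inl_counitLeg] at this
    have hX (x : H) : leg (lt (Q.antiS d e)) (rt d) t * rt e x =
        rt e x * leg (lt (Q.antiS d e)) (rt d) t :=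
      (comm_lt_rt _ _).leg_left hde.rt t x
    have hx := Q.mul_pairing_eq_zero he (z := z) (ξ := d Q.α * e Q.α)
      (f := join Q.Δ (lt (Q.antiS d e)) (rt d))
      (u := Q.self.phi (lt (e ∘ₗ Q.Sl)) (lt (d ∘ₗ Q.Sl)) (rt d)) hX (fun c x ↦ by
        rw [← z₁ (Algebra.TensorProduct.assoc k k k H H H (Q.Δ c ⊗ₜ x) *
          Algebra.TensorProduct.assoc k k k H H H (t ⊗ₜ 1)), hL.multiplicative, leg_assoc,
          leg_assoc, he.rt.unital, mul_one]
        rfl) ↑Q.Φ⁻¹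
    -- Moving `Φ` to the right turns `(b⋆c)⋆d` into `b⋆(c⋆d)`, and `d(α)` absorbs `c⋆d`. The leg `e`
    -- then stands in the position required by the zigzag.
    have hp := phi_mul_leg (R := Q.self) (hb.inl (C := H)) hc.inl hd.rt.inl hbc.inl
      (comm_lt_rt _ _).inl (comm_lt_rt _ _).inl
      (g := leg (inl H (rt e)) (inr (Opr k B) LinearMap.id))
      ((comm_lt_rt _ _).inl.leg_right (comm_inl_inr _ _))
      ((comm_lt_rt _ _).inl.leg_right (comm_inl_inr _ _))
      (hde.rt.inl.leg_right (comm_inl_inr _ _)) ↑Q.Φ⁻¹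
    rw [show Q.self.ρ = Q.Δ from rfl, phi, ← inl_leg, ← inl_leg, ← inl_join, ← inl_join, ← Q.lt_antiS hde, inl_apply] at hp
    rw [inl_join, phi] at hx
    rw [inl_join] at hp
    refine Eq.trans ?_ ((congrArg (fun Y ↦ z * Q.pairing (d Q.α * e Q.α) e Q.Sl
      (Y * (leg (lt (Q.antiS d e)) (rt d) t) ⊗ₜ 1)) hp).symm.trans hx)
    have hr := ((hA.join_right Q.Δ (f := inl H (lt (e ∘ₗ Q.Sl))) (hbc.inl.join_right
      (comm_lt_rt _ _).inl) (comm_counitLeg _ _)).leg_left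
        (leg (inl H (rt e)) (inr (Opr k B) LinearMap.id))) ↑Q.Φ⁻¹
        ((leg (lt (e ∘ₗ Q.Sl)) (leg (lt (d ∘ₗ Q.Sl)) (rt d)) ↑Q.Φ *
        leg (lt (Q.antiS d e)) (rt d) t) ⊗ₜ 1)
    rw [Q.join_counit, hde] at hr
    have hz := Q.pairing_phiInv_zigzag he (w := d Q.α) (fun x ↦ hde _ _)
      (X := leg (lt (e ∘ₗ Q.Sl)) (leg (lt (d ∘ₗ Q.Sl)) (rt d)) ↑Q.Φ *
        leg (lt (Q.antiS d e)) (rt d) t) (fun x ↦ by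
          rw [mul_assoc, hX, ← mul_assoc, ((comm_lt_rt _ _).leg_left
            ((comm_lt_rt _ _).leg_left hde.rt)), mul_assoc])
    refine (congrArg (z * ·) hz.symm).trans ?_
    refine (congrArg (z * ·) hr.symm).trans ?_
    rw [hde, mul_assoc (leg (join Q.Δ _ (join Q.Δ _ _)) _ _), Algebra.TensorProduct.tmul_mul_tmul, one_mul]
    rfl
  have hx := Q.mul_pairing_eq_zero hd (z := z) (ξ := d Q.α)
    (f := lt (Q.antiS d e)) (X := 1)
    (u := Q.self.phi (lt (e ∘ₗ Q.Sl)) (lt (d ∘ₗ Q.Sl)) (rt d)) (fun x ↦ by simp) (fun c x ↦ by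
      rw [← z₂ (c ⊗ₜ x), leg_tmul, mul_one]) ↑Q.Φ⁻¹
  have hA : LeftAgree (Q.pairing (d Q.α) d Q.Sl)
      (join Q.Δ (inl H (lt (d ∘ₗ Q.Sl))) (inl H (rt d)))
      (counitLeg (Opr k B ⊗[k] H) Q.ε) := by
    have := Q.leftAgree_pairing (C := H) d Q.Sl
      (Q.leftAgree_alpha hd (w := 1) fun x ↦ by simp)
    rwa [inl_join, inl_counitLeg, mul_one] at this
  -- The pentagon leaves `Φ⁻` on `lt (d ∘ S)`, `rt d` and the argument of `S`, which is exactly the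
  -- zigzag that cancels `d(α)`.
  have hp := apply_phi_mul_phiInv' (R := Q.self) hA (Q.rightAgree_pairing (d Q.α) hd (ν := Q.Sl)
    (i := LinearMap.id) (fun c h ↦ Q.isAntiLeg_Sl.multiplicative c h)) (hb.inl (C := H))
    (hc.inl (C := H)) (hd.rt.inl (C := H)) (isLeg_id.inr (B := Opr k B)) hbc.inl
    (comm_lt_rt _ _).inl (comm_inl_inr _ _) (comm_lt_rt _ _).inl (comm_inl_inr _ _)
    (comm_inl_inr _ _)
  have hz := Q.pairing_phiInv_zigzag hd (w := 1) (fun x ↦ by simp) (X := 1) (fun x ↦ by simp)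
  rw [mul_one, ← Algebra.TensorProduct.one_def, mul_one, act_one] at hz
  rw [hz, show Q.self.ρ = Q.Δ from rfl, ← inl_join, ← Q.lt_antiS hde, phi, ← inl_leg, ← inl_leg,
    inl_apply] at hp
  rw [← Algebra.TensorProduct.one_def, mul_one] at hx
  exact (mul_one z).symm.trans ((congrArg (z * ·) hp.symm).trans hx)

/-- If `z f = 0`, then `z (S ⊗ S)(Δᵒᵖ(h)) γ = z f Δ(S(h) α) = 0` for all `h`, whence `z = 0`.
Injectivity of right multiplication gives a left inverse `g` by finite dimension, and `(f g - 1) f =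
0` makes it two-sided. -/
theorem isUnit_drinfeld [FiniteDimensional k H] : IsUnit Q.drinfeld := by
  have inj (z : H ⊗[k] H) (hz : z * Q.drinfeld = 0) : z = 0 := by
    have hs : Comm (slot₁ k H H) (slot₂ k H H) := comm_inl_inr _ _
    refine Q.eq_zero_of_mul_antiS_mul_gam isLeg_id.inl isLeg_id.inr hs fun h x y ↦ ?_
    have h₁ := Q.drinfeld_mul_S isLeg_id.inl isLeg_id.inr hs h
    have h₂ := Q.drinfeld_mul_α isLeg_id.inl isLeg_id.inr hs
    rw [leg_slot, LinearMap.id_apply] at h₁ h₂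
    rw [← h₂, mul_assoc Q.drinfeld, ← mul_assoc (Q.antiS _ _ h), ← h₁, mul_assoc, ← mul_assoc z, hz,
      zero_mul]
  have inj' : Function.Injective (LinearMap.mulRight k Q.drinfeld) :=
    (injective_iff_map_eq_zero _).mpr fun z hz ↦ inj z hz
  obtain ⟨g, hg⟩ := LinearMap.injective_iff_surjective.mp inj' 1
  have hg' : g * Q.drinfeld = 1 := hg
  refine ⟨⟨Q.drinfeld, g, ?_, hg'⟩, rfl⟩
  refine sub_eq_zero.mp (inj _ ?_)
  rw [sub_mul, mul_assoc, hg', mul_one, one_mul, sub_self]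

/-- The Drinfeld twist as a unit. -/
def twistUnit [FiniteDimensional k H] : (H ⊗[k] H)ˣ := Q.isUnit_drinfeld.unit

theorem twistUnit_val [FiniteDimensional k H] : (Q.twistUnit : H ⊗[k] H) = Q.drinfeld := rfl

end Invertible

end QuasiHopfAlgebra

namespace QuasiHopfAlgebra

open RightComoduleAlgebra

section Pairing

variable {k A B C H : Type*} [Field k] [Ring A] [Algebra k A] [Ring B] [Algebra k B] [Ring C]
  [Algebra k C] [Ring H] [Algebra k H] (Q : QuasiHopfAlgebra k H)

theorem pairing_rt_phiInv (v : B) {F g : H →ₗ[k] B} {f : A →ₗ[k] B} {ν : C →ₗ[k] H}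
    {i : H →ₗ[k] C} (t : A ⊗[k] (H ⊗[k] H)) :
    Q.pairing v F ν (leg (inl C (rt f)) (leg (inl C (rt g)) (inr (Opr k B) i)) t) =
      v * Q.pairing 1 F ν (leg (inl C (rt f)) (leg (inl C (rt g)) (inr (Opr k B) i)) t) := by
  induction t with
  | zero => simp
  | add y z hy hz => simp only [map_add, mul_add, hy, hz]
  | tmul x t =>
  induction t with
  | zero => simp
  | add y z hy hz => simp only [map_add, tmul_add, mul_add, hy, hz]
  | tmul y z => simp [inl_apply, inr_apply, mul_assoc]

theorem evα_mul_slot₁ (t : H ⊗[k] H) (h : H) : Q.evα (t * slot₁ k H H h) = Q.Sl h * Q.evα t := by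
  rw [inl_apply, LinearMap.id_apply]
  induction t with
  | zero => simp
  | add y z hy hz => simp only [map_add, tensor_add_mul, mul_add, hy, hz]
  | tmul y z =>
    rw [Algebra.TensorProduct.tmul_mul_tmul, evα_tmul, evα_tmul,
      Q.isAntiLeg_Sl.multiplicative, mul_one]
    simp only [mul_assoc]

end Pairing

/-! ### The elements p and q of a comodule algebra -/

section ComoduleElements

variable {k A H : Type*} [Field k] [Ring A] [Algebra k A] [Ring H] [Algebra k H]
  (Q : QuasiHopfAlgebra k H) (R : RightComoduleAlgebra Q.toQuasiBialgebra A)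

/-- The operator `x ↦ ∑ x (a₀ ⊗ 1)` combined with left multiplication by `1 ⊗ S(a₁)`. -/
def conjRight : A →ₗ[k] Opr k (A ⊗[k] H) :=
  join R.ρ (rt (slot₁ k A H)) (lt (slot₂ k A H ∘ₗ Q.Sl))

/-- The element `∑ x¹ ⊗ x² β S(x³)`, where `Φρ⁻¹ = ∑ x¹ ⊗ x² ⊗ x³`. -/
def pElt : A ⊗[k] H :=
  Q.pairing 1 (slot₂ k A H) Q.Sl (R.phiInv (inl H (rt (slot₁ k A H))) (inl H (rt (slot₂ k A H)))
    (inr (Opr k (A ⊗[k] H)) LinearMap.id))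

/-- The element `∑ X¹ ⊗ S(X²) α X³`, where `Φρ = ∑ X¹ ⊗ X² ⊗ X³`. -/
def qElt : A ⊗[k] H :=
  act (slot₂ k A H Q.α) (R.phi (rt (slot₁ k A H)) (lt (slot₂ k A H ∘ₗ Q.Sl)) (rt (slot₂ k A H)))

theorem isLeg_slot₁ : IsLeg (slot₁ k A H) := isLeg_id.inl

theorem isLeg_slot₂ : IsLeg (slot₂ k A H) := isLeg_id.inr

theorem comm_slot : Comm (slot₁ k A H) (slot₂ k A H) := comm_inl_inr _ _

/-- `∑ ρ(a₀) p (1 ⊗ S(a₁)) = p (a ⊗ 1)` -/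
theorem coact_mul_pElt (a : A) :
    act (Q.pElt R) (join R.ρ (lt R.ρ.toLinearMap) (rt (slot₂ k A H ∘ₗ Q.Sl)) a) =
      Q.pElt R * slot₁ k A H a := by
  have h₁ : IsLeg (slot₁ k A H) := isLeg_slot₁
  have h₂ : IsLeg (slot₂ k A H) := isLeg_slot₂
  have h₁₂ : Comm (slot₁ k A H) (slot₂ k A H) := comm_slot
  have key := congrArg (Q.pairing 1 (slot₂ k A H) Q.Sl)
    (phiInv_coassoc (R := R) (h₁.rt.inl (C := H)) (h₂.rt.inl (C := H))
      (isLeg_id.inr (B := Opr k (A ⊗[k] H))) h₁₂.rt.inl (comm_inl_inr _ _) (comm_inl_inr _ _) a)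
  -- The axiom for `β` absorbs the last two legs, so only right multiplication by `a ⊗ 1` survives
  -- on this side.
  have r := ((Q.rightAgree_pairing 1 h₂ (ν := Q.Sl) (i := LinearMap.id)
      (fun c h ↦ Q.isAntiLeg_Sl.multiplicative c h)).join_right R.ρ
      (inl H (rt (slot₁ k A H))) a (R.phiInv (inl H (rt (slot₁ k A H)))
        (inl H (rt (slot₂ k A H))) (inr (Opr k (A ⊗[k] H)) LinearMap.id)))
  rw [join_counit, pairing_mul_rt _ _ _ _ h₁₂.symm] at r
  refine Eq.trans ?_ (key.symm.trans r)
  rw [join_apply, join_apply, pElt]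
  induction R.ρ a with
  | zero => simp
  | add y z hy hz => simp only [map_add, add_mul, hy, hz]
  | tmul x y =>
  rw [leg_tmul, leg_tmul, act_mul, act_lt, act_rt, ← inl_join, ← rt_join, join, leg_slot,
    LinearMap.id_comp, mul_assoc (inl H _ x), pairing_inl_mul, Q.pairing_Sl_inr_mul _ h₂, act_rt, one_mul, phiInv,
    Q.pairing_rt_phiInv (R.ρ.toLinearMap x)]
  rfl

/-- `∑ ρ(q¹) p (1 ⊗ q²) = 1` -/
theorem qElt_pElt : act (Q.pElt R) (leg (lt R.ρ.toLinearMap) (rt (slot₂ k A H)) (Q.qElt R)) = 1 := by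
  have h₁ : IsLeg (slot₁ k A H) := isLeg_slot₁
  have h₂ : IsLeg (slot₂ k A H) := isLeg_slot₂
  have h₁₂ : Comm (slot₁ k A H) (slot₂ k A H) := comm_slot
  -- The left side of this pentagon is the claimed expression, because the join of the first two
  -- legs is right multiplication by `ρ`. Its right side is the zigzag for `Φ`, in which `A` no
  -- longer occurs.
  have key := apply_phi_mul_phiInv (R := R) (Q.leftAgree_pairing_evα (1 : A ⊗[k] H) (slot₂ k A H))
    (Q.rightAgree_pairing 1 h₂ (ν := Q.evα) (i := slot₁ k H H) Q.evα_mul_slot₁)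
    (h₁.rt.inl (C := H ⊗[k] H)) (h₂.rt.inl (C := H ⊗[k] H))
    (isLeg_id.inl.inr (B := Opr k (A ⊗[k] H))) (isLeg_id.inr.inr (B := Opr k (A ⊗[k] H)))
    h₁₂.rt.inl (comm_inl_inr _ _) (comm_inl_inr _ _) (comm_inl_inr _ _)
    (comm_inl_inr _ _) (comm_inl_inr _ _).inr
  have hz := Q.zigzag (Q.pairing 1 (slot₂ k A H) Q.evα ∘ₗ leg (inl (H ⊗[k] H) (rt (slot₂ k A H)))
    (leg (inr (Opr k (A ⊗[k] H)) (slot₁ k H H)) (inr (Opr k (A ⊗[k] H)) (slot₂ k H H))))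
    (slot₂ k A H) (fun x y z ↦ by
      simp only [LinearMap.comp_apply, leg_tmul, inl_apply, inr_apply, mul_one, one_mul,
        Algebra.TensorProduct.tmul_mul_tmul, pairing_tmul, act_rt,
        LinearMap.id_apply, evα_tmul, mul_assoc])
  rw [h₂.unital] at hz
  refine Eq.trans ?_ (key.trans hz)
  rw [← inl_join, ← rt_join, join, leg_slot, LinearMap.id_comp, pElt, qElt, phi, phi, phiInv,
    phiInv]
  induction (↑R.Φρ⁻¹ : A ⊗[k] (H ⊗[k] H)) with
  | zero => simp [act_zero]
  | add y z hy hz => simp only [map_add, act_add, mul_add, hy, hz]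
  | tmul x t =>
  induction t with
  | zero => simp [act_zero]
  | add y z hy hz => simp only [map_add, tmul_add, act_add, mul_add, hy, hz]
  | tmul y z =>
  induction (↑R.Φρ : A ⊗[k] (H ⊗[k] H)) with
  | zero => simp
  | add y z hy hz => simp only [map_add, tensor_add_mul, hy, hz]
  | tmul X t =>
  induction t with
  | zero => simp
  | add y z hy hz => simp only [map_add, tmul_add, tensor_add_mul, hy, hz]
  | tmul Y Z =>
  simp [inl_apply, inr_apply, Q.isAntiLeg_Sl.multiplicative, mul_assoc]

/-- `∑ q¹ a₀₀ ⊗ S(a₀₁) q² a₁ = (a ⊗ 1) q` -/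
theorem qElt_conjRight (a : A) :
    act (Q.qElt R) (join R.ρ (Q.conjRight R) (rt (slot₂ k A H)) a) =
      slot₁ k A H a * Q.qElt R := by
  have h₁ : IsLeg (slot₁ k A H) := isLeg_slot₁
  have h₂ : IsLeg (slot₂ k A H) := isLeg_slot₂
  have h₁₂ : Comm (slot₁ k A H) (slot₂ k A H) := comm_slot
  have hs : LeftAgree (act (slot₂ k A H Q.α))
      (join Q.Δ (lt (slot₂ k A H ∘ₗ Q.Sl)) (rt (slot₂ k A H)))
      (counitLeg (Opr k (A ⊗[k] H)) Q.ε) := by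
    have := Q.leftAgree_alpha h₂ (w := 1) (fun x ↦ by simp)
    rwa [mul_one] at this
  have key := congrArg (act (slot₂ k A H Q.α)) (phi_coassoc (R := R) h₁.rt
    (h₂.comp_anti Q.isAntiLeg_Sl).lt h₂.rt (comm_rt_lt _ _) h₁₂.rt (comm_lt_rt _ _) a)
  rw [act_mul] at key
  refine key.trans ?_
  -- `Φρ` has rebracketed the legs so that left multiplication by `S` and right multiplication meet
  -- around `α`, which absorbs them.
  have r := hs.join_right R.ρ (f := rt (slot₁ k A H)) ((comm_rt_lt _ _).join_right h₁₂.rt)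
    (comm_counitLeg _ _) a
  rw [join_counit] at r
  refine (r _).trans ?_
  rw [act_mul, act_rt, ← h₁₂, qElt]
  have i₁ : Intertwines (LinearMap.mulLeft k (slot₁ k A H a)) (lt (slot₂ k A H ∘ₗ Q.Sl))
      (lt (slot₂ k A H ∘ₗ Q.Sl)) := intertwines_lt fun v x ↦ by
    simp only [LinearMap.mulLeft_apply, LinearMap.comp_apply]
    rw [← mul_assoc, h₁₂, mul_assoc]
  have i₂ (f : H →ₗ[k] A ⊗[k] H) : Intertwines (LinearMap.mulLeft k (slot₁ k A H a)) (rt f)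
    (rt f) := intertwines_rt fun v x ↦ by simp [mul_assoc]
  have i₃ : Intertwines (LinearMap.mulLeft k (slot₁ k A H a)) (rt (slot₁ k A H))
    (rt (slot₁ k A H)) := intertwines_rt fun v x ↦ by simp [mul_assoc]
  exact ((i₃.leg (i₁.leg (i₂ _))) _ _).symm

/-- The element `p` undoes `Φρ` combined with `α`. -/
theorem act_phi_pElt {B : Type*} [Ring B] [Algebra k B] {a : A →ₗ[k] Opr k B} {d : H →ₗ[k] B}
    {w : B} {X : Opr k B} (ha : IsLeg a) (hd : IsLeg d) (h₁ : Comm a (lt (d ∘ₗ Q.Sl)))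
    (h₂ : Comm a (rt d)) (hw : ∀ x, w * d x = d x * w) (hX : ∀ x, X * rt d x = rt d x * X) :
    act (d Q.α * w) (R.phi a (lt (d ∘ₗ Q.Sl)) (rt d) *
      leg (join R.ρ a (lt (d ∘ₗ Q.Sl))) (rt d) (Q.pElt R) * X) = act w X := by
  have hA : LeftAgree (Q.pairing (d Q.α * w) d Q.Sl ∘ₗ LinearMap.mulRight k (X ⊗ₜ 1))
      (join Q.Δ (inl H (lt (d ∘ₗ Q.Sl))) (inl H (rt d)))
      (counitLeg (Opr k B ⊗[k] H) Q.ε) := by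
    have := Q.leftAgree_pairing (C := H) d Q.Sl (Q.leftAgree_alpha hd hw)
    rw [inl_join, inl_counitLeg] at this
    intro x z
    simp only [LinearMap.comp_apply, LinearMap.mulRight_apply]
    rw [mul_assoc, this, ← mul_assoc]
  have hB : RightAgree (Q.pairing (d Q.α * w) d Q.Sl ∘ₗ LinearMap.mulRight k (X ⊗ₜ 1))
      (join Q.Δ (inl H (rt d)) (inr (Opr k B) LinearMap.id))
      (counitLeg (Opr k B ⊗[k] H) Q.ε) := by
    have hc : Comm (inl H (LinearMap.mulRight k X ∘ₗ Algebra.linearMap k (Opr k B)))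
        (join Q.Δ (inl H (rt d)) (inr (Opr k B) LinearMap.id)) :=
      Comm.join_right (Comm.inl fun c x ↦ by
        simp only [LinearMap.comp_apply, LinearMap.mulRight_apply, Algebra.linearMap_apply]
        rw [mul_assoc, hX, ← mul_assoc, Algebra.commutes, mul_assoc]) (comm_inl_inr _ _)
    have hc' (x : H) : join Q.Δ (inl H (rt d)) (inr (Opr k B) LinearMap.id) x * X ⊗ₜ 1 =
        X ⊗ₜ 1 * join Q.Δ (inl H (rt d)) (inr (Opr k B) LinearMap.id) x := by
      simpa [inl_apply] using (hc 1 x).symm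
    intro x z
    simp only [LinearMap.comp_apply, LinearMap.mulRight_apply]
    rw [mul_assoc, hc', ← mul_assoc, Q.rightAgree_pairing _ hd (ν := Q.Sl) (i := LinearMap.id)
      (fun c h ↦ Q.isAntiLeg_Sl.multiplicative c h), mul_assoc, mul_assoc, counitLeg_apply,
      ← Algebra.commutes]
  -- The operator `X` commutes with the leg `rt d`, so it can be kept as a last factor without
  -- disturbing either absorption.
  have hp := apply_phi_mul_phiInv' (R := R) hA hB (ha.inl (C := H))
    ((hd.comp_anti Q.isAntiLeg_Sl).lt.inl (C := H)) (hd.rt.inl (C := H))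
    (isLeg_id.inr (B := Opr k B)) h₁.inl h₂.inl (comm_inl_inr _ _) (comm_lt_rt _ _).inl
    (comm_inl_inr _ _) (comm_inl_inr _ _)
  simp only [LinearMap.comp_apply, LinearMap.mulRight_apply] at hp
  rw [Q.pairing_phiInv_zigzag hd hw hX, phi, ← inl_leg, ← inl_leg, inl_apply, ← inl_join] at hp
  refine Eq.trans ?_ hp
  rw [pElt, phi, phiInv, phiInv]
  induction (↑R.Φρ⁻¹ : A ⊗[k] (H ⊗[k] H)) with
  | zero => simp
  | add y z hy hz => simp only [map_add, mul_add, add_mul, hy, hz]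
  | tmul x t =>
  induction t with
  | zero => simp
  | add y z hy hz => simp only [map_add, tmul_add, mul_add, add_mul, hy, hz]
  | tmul y z =>
  have e : Q.pairing 1 (slot₂ k A H) Q.Sl (leg (inl H (rt (slot₁ k A H)))
      (leg (inl H (rt (slot₂ k A H))) (inr (Opr k (A ⊗[k] H)) LinearMap.id)) (x ⊗ₜ (y ⊗ₜ z))) =
      x ⊗ₜ (y * (Q.β * Q.Sl z)) := by
    simp [inl_apply, inr_apply]
  rw [e]
  simp only [leg_tmul, inl_apply, inr_apply]
  simp only [Algebra.TensorProduct.tmul_mul_tmul, one_mul, mul_one, pairing_tmul,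
    LinearMap.id_apply]
  rw [hd.rt.multiplicative, ← act_rt (act _ _) d, ← act_mul]
  simp only [mul_assoc]
  rw [hX]

/-- `∑ q¹ p¹₀ ⊗ S(p¹₁) q² p² = 1` -/
theorem pElt_qElt :
    act (Q.qElt R) (leg (Q.conjRight R) (rt (slot₂ k A H)) (Q.pElt R)) = 1 := by
  have := Q.act_phi_pElt R (isLeg_slot₁ (k := k) (A := A) (H := H)).rt isLeg_slot₂ (w := 1)
    (X := 1) (comm_rt_lt _ _) comm_slot.rt (fun x ↦ by simp) (fun x ↦ by simp)
  rw [mul_one, mul_one, act_mul] at this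
  exact this

/-- `(id ⊗ ε)(q) = ε(α)` -/
theorem dropRight_qElt : dropRight A Q.ε (Q.qElt R) = Q.ε Q.α • 1 := by
  have key (t : A ⊗[k] (H ⊗[k] H)) : dropRight A Q.ε (act (slot₂ k A H Q.α)
      (leg (rt (slot₁ k A H)) (leg (lt (slot₂ k A H ∘ₗ Q.Sl)) (rt (slot₂ k A H))) t)) =
      Q.ε Q.α • dropRight A Q.ε (onRight A (dropRight H Q.ε) t) := by
    induction t with
    | zero => simp
    | add y z hy hz => simp only [map_add, smul_add, hy, hz]
    | tmul x t =>
    induction t with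
    | zero => simp
    | add y z hy hz => simp only [map_add, tmul_add, smul_add, hy, hz]
    | tmul y z =>
      simp [inl_apply, inr_apply, counit_Sl, smul_smul, mul_comm, mul_left_comm]
  rw [qElt, phi, key, R.normalized_right, map_one]

/-- `(id ⊗ ε)(p) = ε(β)` -/
theorem dropRight_pElt : dropRight A Q.ε (Q.pElt R) = Q.ε Q.β • 1 := by
  have key (t : A ⊗[k] (H ⊗[k] H)) : dropRight A Q.ε (Q.pairing 1 (slot₂ k A H) Q.Sl
      (leg (inl H (rt (slot₁ k A H))) (leg (inl H (rt (slot₂ k A H)))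
        (inr (Opr k (A ⊗[k] H)) LinearMap.id)) t)) =
      Q.ε Q.β • dropRight A Q.ε (onRight A (dropRight H Q.ε) t) := by
    induction t with
    | zero => simp
    | add y z hy hz => simp only [map_add, smul_add, hy, hz]
    | tmul x t =>
    induction t with
    | zero => simp
    | add y z hy hz => simp only [map_add, tmul_add, smul_add, hy, hz]
    | tmul y z =>
      simp [inl_apply, inr_apply, counit_Sl, smul_smul, mul_comm, mul_left_comm]
  rw [pElt, phiInv, key, map_inv_eq_one _ _ R.normalized_right, map_one]

end ComoduleElements

/-! ### Coherence of q with the Drinfeld twist -/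

section Coherence

variable {k A H : Type*} [Field k] [Ring A] [Algebra k A] [Ring H] [Algebra k H]
  (Q : QuasiHopfAlgebra k H) (R : RightComoduleAlgebra Q.toQuasiBialgebra A)

variable (k A H) in
/-- The map `h ↦ 1 ⊗ h ⊗ 1`. -/
abbrev mid : H →ₗ[k] A ⊗[k] (H ⊗[k] H) := inr A (slot₁ k H H)

variable (k A H) in
/-- The map `h ↦ 1 ⊗ 1 ⊗ h`. -/
abbrev last : H →ₗ[k] A ⊗[k] (H ⊗[k] H) := inr A (slot₂ k H H)

/-- The operators `x ↦ ∑ (1 ⊗ 1 ⊗ S(a₁)) x (a₀ ⊗ 1 ⊗ 1)`. -/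
def conjLast : A →ₗ[k] Opr k (A ⊗[k] (H ⊗[k] H)) :=
  join R.ρ (rt (slot₁ k A (H ⊗[k] H))) (lt (last k A H ∘ₗ Q.Sl))

/-- The element `∑ q¹ q'¹₀ ⊗ q'² ⊗ S(q'¹₁) q²` for two copies of `q`. -/
def qElt₂ : A ⊗[k] (H ⊗[k] H) :=
  act (onRight A (Algebra.TensorProduct.includeRight : H →ₐ[k] H ⊗[k] H) (Q.qElt R))
    (leg (Q.conjLast R) (rt (mid k A H)) (Q.qElt R))

/-- This exhibits the two copies of `q` as two copies of `Φρ` acting on `α ⊗ α`, the form produced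
by `tau_phi_phi`. -/
theorem qElt₂_eq : Q.qElt₂ R = act (mid k A H Q.α * last k A H Q.α)
    (R.phi (rt (slot₁ k A (H ⊗[k] H))) (lt (last k A H ∘ₗ Q.Sl)) (rt (last k A H)) *
      R.phi (Q.conjLast R) (lt (mid k A H ∘ₗ Q.Sl)) (rt (mid k A H))) := by
  rw [qElt₂, qElt, phi, phi, phi, act_mul]
  generalize (R.Φρ : A ⊗[k] (H ⊗[k] H)) = s
  have aux (t : A ⊗[k] (H ⊗[k] H)) :
      act (onRight A (Algebra.TensorProduct.includeRight : H →ₐ[k] H ⊗[k] H)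
        (act (slot₂ k A H Q.α) (leg (rt (slot₁ k A H)) (leg (lt (slot₂ k A H ∘ₗ Q.Sl))
          (rt (slot₂ k A H))) t)))
        (leg (Q.conjLast R) (rt (mid k A H)) (act (slot₂ k A H Q.α)
          (leg (rt (slot₁ k A H)) (leg (lt (slot₂ k A H ∘ₗ Q.Sl)) (rt (slot₂ k A H))) s))) =
      act (act (mid k A H Q.α * last k A H Q.α) (leg (rt (slot₁ k A (H ⊗[k] H)))
        (leg (lt (last k A H ∘ₗ Q.Sl)) (rt (last k A H))) t))
          (leg (Q.conjLast R) (leg (lt (mid k A H ∘ₗ Q.Sl)) (rt (mid k A H))) s) := by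
    induction t with
    | zero => simp [act_zero]
    | add y z hy hz => simp only [map_add, act_add, hy, hz]
    | tmul x t =>
    induction t with
    | zero => simp [act_zero]
    | add y z hy hz => simp only [map_add, tmul_add, act_add, hy, hz]
    | tmul y z =>
    induction s with
    | zero => simp
    | add y z hy hz => simp only [map_add, hy, hz]
    | tmul x' s =>
    induction s with
    | zero => simp
    | add y z hy hz => simp only [map_add, tmul_add, hy, hz]
    | tmul y' z' =>
    have e : act (slot₂ k A H Q.α) (leg (rt (slot₁ k A H)) (leg (lt (slot₂ k A H ∘ₗ Q.Sl))
      (rt (slot₂ k A H))) (x' ⊗ₜ (y' ⊗ₜ z'))) = x' ⊗ₜ (Q.Sl y' * Q.α * z') := by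
      simp [inl_apply, inr_apply, mul_assoc]
    rw [e]
    simp only [leg_tmul, conjLast, join_apply]
    induction R.ρ x' with
    | zero => simp
    | add y z hy hz => simp only [map_add, add_mul, hy, hz]
    | tmul u v => simp [inl_apply, inr_apply, mul_assoc]
  exact aux s

/-- `∑ q¹ X¹ Y¹₀₀ ⊗ S(X³ Y¹₁) f₁ q²₁ Y² ⊗ S(X² Y¹₀₁) f₂ q²₂ Y³ = q₂`, where `Φρ = ∑ X = ∑ Y`. -/
theorem qElt_coherence :
    act (inr A LinearMap.id Q.drinfeld * onRight A Q.Δ (Q.qElt R))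
      (R.phi (rt (slot₁ k A (H ⊗[k] H))) (lt (last k A H ∘ₗ Q.Sl)) (lt (mid k A H ∘ₗ Q.Sl)) *
        R.phi (join R.ρ (Q.conjLast R) (lt (mid k A H ∘ₗ Q.Sl)))
          (rt (mid k A H)) (rt (last k A H))) = Q.qElt₂ R := by
  have h₁ : IsLeg (slot₁ k A (H ⊗[k] H)) := isLeg_id.inl
  have h₂ : IsLeg (mid k A H) := isLeg_id.inl.inr
  have h₃ : IsLeg (last k A H) := isLeg_id.inr.inr
  have h₁₂ : Comm (slot₁ k A (H ⊗[k] H)) (mid k A H) := comm_inl_inr _ _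
  have h₁₃ : Comm (slot₁ k A (H ⊗[k] H)) (last k A H) := comm_inl_inr _ _
  have h₂₃ : Comm (mid k A H) (last k A H) := (comm_inl_inr _ _).inr
  -- `X` is the reassociator inverse to the factor `Φ⁻[a,b,c]` on the right of `tau_phi_phi`, so
  -- that only the product from `qElt₂_eq` remains there.
  have key := tau_phi_phi (R := R) (s := act (mid k A H Q.α * last k A H Q.α))
    (c := lt (mid k A H ∘ₗ Q.Sl)) (d := rt (mid k A H))
    (Q.leftAgree_alpha h₂ (w := last k A H Q.α) (fun x ↦ (h₂₃ _ _).symm))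
    (a := rt (slot₁ k A (H ⊗[k] H))) (b := lt (last k A H ∘ₗ Q.Sl)) (e := rt (last k A H))
    (X := R.phi (rt (slot₁ k A (H ⊗[k] H))) (lt (last k A H ∘ₗ Q.Sl)) (lt (mid k A H ∘ₗ Q.Sl)))
    h₁.rt (h₃.comp_anti Q.isAntiLeg_Sl).lt (h₂.comp_anti Q.isAntiLeg_Sl).lt h₂.rt h₃.rt
    (comm_rt_lt _ _) (comm_rt_lt _ _) h₁₂.rt h₁₃.rt ((h₂₃.symm.comp_right _).comp_left _).lt
    (comm_lt_rt _ _) (comm_lt_rt _ _) (comm_lt_rt _ _) (comm_lt_rt _ _) h₂₃.rt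
  have hg : IsLeg (leg (mid k A H) (last k A H)) := h₂.leg h₃ h₂₃
  have e₀ : inr A LinearMap.id Q.drinfeld = leg (mid k A H) (last k A H) Q.drinfeld := by
    induction Q.drinfeld with
    | zero => simp
    | add y z hy hz => simp only [map_add, hy, hz]
    | tmul y z => simp [inr_apply, inl_apply]
  have e₁ (t : A ⊗[k] H) :
      onRight A Q.Δ t = leg (slot₁ k A (H ⊗[k] H)) (join Q.Δ (mid k A H) (last k A H)) t := by
    induction t with
    | zero => simp
    | add y z hy hz => simp only [map_add, hy, hz]
    | tmul y z =>
    rw [onRight_tmul, leg_tmul, ← inr_join, join, leg_slot]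
    simp [inl_apply, inr_apply]
  -- From `f Δ(S(y) α z) = (S ⊗ S)(Δᵒᵖ(y)) γ Δ(z)`: the twist replaces `Δ(α)` by `γ` and the
  -- antipode leg by a convolution of two.
  have e₂ : inr A LinearMap.id Q.drinfeld * onRight A Q.Δ (Q.qElt R) =
      act (Q.gam (mid k A H) (last k A H)) (R.phi (rt (slot₁ k A (H ⊗[k] H)))
        (join Q.Δ (lt (last k A H ∘ₗ Q.Sl)) (lt (mid k A H ∘ₗ Q.Sl)))
        (join Q.Δ (rt (mid k A H)) (rt (last k A H)))) := by
    rw [← rt_join, ← Q.lt_antiS h₂₃, e₀, qElt, phi, phi]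
    induction (R.Φρ : A ⊗[k] (H ⊗[k] H)) with
    | zero => simp
    | add y z hy hz => simp only [map_add, mul_add, hy, hz]
    | tmul x t =>
    induction t with
    | zero => simp
    | add y z hy hz => simp only [map_add, tmul_add, mul_add, hy, hz]
    | tmul y z =>
    have e : act (slot₂ k A H Q.α) (leg (rt (slot₁ k A H)) (leg (lt (slot₂ k A H ∘ₗ Q.Sl))
      (rt (slot₂ k A H))) (x ⊗ₜ (y ⊗ₜ z))) = x ⊗ₜ (Q.Sl y * Q.α * z) := by
      simp [inl_apply, inr_apply, mul_assoc]
    have hJ : IsLeg (join Q.Δ (mid k A H) (last k A H)) := h₂.join h₃ h₂₃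
    rw [e, e₁, leg_tmul, leg_tmul, leg_tmul, act_mul, act_mul, act_rt, act_lt, act_rt,
      ← mul_assoc, ← (h₁₂.leg_right h₁₃), ← Q.drinfeld_mul_α h₂ h₃ h₂₃, hJ.multiplicative,
      hJ.multiplicative]
    have hc : Comm (slot₁ k A _) (Q.antiS (mid k A H) (last k A H)) :=
      (h₁₃.comp_right Q.Sl).join_right (h₁₂.comp_right Q.Sl)
    rw [mul_assoc _ (join _ _ _ _) (slot₁ k A _ x), ← (h₁₂.join_right h₁₃),
      ← mul_assoc _ (slot₁ k A _ x), ← (h₁₂.leg_right h₁₃), mul_assoc (slot₁ k A _ x),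
      mul_assoc (slot₁ k A _ x), ← mul_assoc (Q.antiS _ _ y), ← hc]
    have hf := Q.drinfeld_mul_S h₂ h₃ h₂₃ y
    simp only [mul_assoc]
    rw [← mul_assoc (leg _ _ Q.drinfeld) (join _ _ _ (Q.Sl y)), hf]
    simp only [mul_assoc]
  rw [phiInv_mul_phi h₁.rt (h₃.comp_anti Q.isAntiLeg_Sl).lt (h₂.comp_anti Q.isAntiLeg_Sl).lt
    (comm_rt_lt _ _) (comm_rt_lt _ _) ((h₂₃.symm.comp_right _).comp_left _).lt, mul_one] at key
  rw [e₂, gam, qElt₂_eq]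
  refine Eq.trans ?_ key
  rw [← act_mul, ← act_mul]
  refine congrArg (fun Y ↦ act _ (_ * (_ * Y))) ?_
  exact phi_mul_leg h₁.rt (h₃.comp_anti Q.isAntiLeg_Sl).lt (h₂.comp_anti Q.isAntiLeg_Sl).lt
    (comm_rt_lt _ _) (comm_rt_lt _ _) ((h₂₃.symm.comp_right _).comp_left _).lt
    (h₁₂.rt.leg_right h₁₃.rt) ((comm_lt_rt _ _).leg_right (comm_lt_rt _ _))
    ((comm_lt_rt _ _).leg_right (comm_lt_rt _ _)) _

end Coherence

end QuasiHopfAlgebra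

namespace QuasiHopfAlgebra

open RightComoduleAlgebra

/-! ### Cancelling two copies of q -/

section CoherenceCancel

variable {k A H : Type*} [Field k] [Ring A] [Algebra k A] [Ring H] [Algebra k H]
  (Q : QuasiHopfAlgebra k H) (R : RightComoduleAlgebra Q.toQuasiBialgebra A)

/-- Moving the second `Φρ` past the first `p` makes `d₂(α)` absorb the legs of `d₂` there. Then one
application of `act_phi_pElt` removes the pair for `d₃` and another the pair for `d₂`. -/
theorem act_phi_phi_pElt {B : Type*} [Ring B] [Algebra k B] {a : A →ₗ[k] Opr k B} {d₂ d₃ : H →ₗ[k] B}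
    (ha : IsLeg a) (h₂ : IsLeg d₂) (h₃ : IsLeg d₃) (h₂₃ : Comm d₂ d₃) (b₂ : Comm a (lt (d₂ ∘ₗ Q.Sl)))
    (b₃ : Comm a (lt (d₃ ∘ₗ Q.Sl))) (a₂ : Comm a (rt d₂)) (a₃ : Comm a (rt d₃)) :
    act (d₂ Q.α * d₃ Q.α) (R.phi a (lt (d₃ ∘ₗ Q.Sl)) (rt d₃) *
      R.phi (join R.ρ a (lt (d₃ ∘ₗ Q.Sl))) (lt (d₂ ∘ₗ Q.Sl)) (rt d₂) *
      (leg (join R.ρ (join R.ρ (join R.ρ a (lt (d₃ ∘ₗ Q.Sl))) (lt (d₂ ∘ₗ Q.Sl))) (rt d₂)) (rt d₃)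
          (Q.pElt R) *
        leg (join R.ρ (join R.ρ a (lt (d₃ ∘ₗ Q.Sl))) (lt (d₂ ∘ₗ Q.Sl))) (rt d₂) (Q.pElt R))) = 1 := by
  have s₃₂ : Comm (lt (d₃ ∘ₗ Q.Sl)) (lt (d₂ ∘ₗ Q.Sl)) :=
    ((h₂₃.symm.comp_right _).comp_left _).lt
  have hc : IsLeg (join R.ρ a (lt (d₃ ∘ₗ Q.Sl))) := ha.join (h₃.comp_anti Q.isAntiLeg_Sl).lt b₃
  have c₂ : Comm (join R.ρ a (lt (d₃ ∘ₗ Q.Sl))) (lt (d₂ ∘ₗ Q.Sl)) := b₂.join_left s₃₂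
  have c₃ : Comm (join R.ρ a (lt (d₃ ∘ₗ Q.Sl))) (rt (d₂)) := a₂.join_left (comm_lt_rt _ _)
  have c₄ : Comm (join R.ρ a (lt (d₃ ∘ₗ Q.Sl))) (rt (d₃)) := a₃.join_left (comm_lt_rt _ _)
  have e₁ := phi_mul_leg (R := R) hc (h₂.comp_anti Q.isAntiLeg_Sl).lt h₂.rt c₂ c₃ (comm_lt_rt _ _)
    c₄ (comm_lt_rt _ _) h₂₃.rt (Q.pElt R)
  have hs := (Q.leftAgree_alpha h₂ (w := d₃ Q.α) (fun x ↦ (h₂₃ _ _).symm)).comp_mulLeft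
    (u := R.phi (a) (lt (d₃ ∘ₗ Q.Sl)) (rt (d₃)))
    (phi_comm (b₂.join_right a₂) (s₃₂.join_right (comm_lt_rt _ _))
      ((comm_rt_lt _ _).join_right h₂₃.symm.rt))
    (phi_comm (comm_counitLeg _ _) (comm_counitLeg _ _) (comm_counitLeg _ _))
  have hs' := ((hs.join_right R.ρ (f := join R.ρ a (lt (d₃ ∘ₗ Q.Sl))) (c₂.join_right c₃)
    (comm_counitLeg _ _)).leg_left (rt d₃)) (Q.pElt R)
  rw [join_counit] at hs'
  rw [mul_assoc, ← mul_assoc (phi _ _ _ _) (leg _ _ _), e₁, mul_assoc]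
  have hs'' := hs' (R.phi (join R.ρ a (lt (d₃ ∘ₗ Q.Sl))) (lt (d₂ ∘ₗ Q.Sl)) (rt d₂) *
    leg (join R.ρ (join R.ρ a (lt (d₃ ∘ₗ Q.Sl))) (lt (d₂ ∘ₗ Q.Sl))) (rt d₂) (Q.pElt R))
  simp only [LinearMap.comp_apply, LinearMap.mulLeft_apply] at hs''
  rw [hs'']
  have g₁ := Q.act_phi_pElt R (w := d₂ Q.α)
    (X := R.phi (join R.ρ a (lt (d₃ ∘ₗ Q.Sl))) (lt (d₂ ∘ₗ Q.Sl)) (rt (d₂)) *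
      leg (join R.ρ (join R.ρ a (lt (d₃ ∘ₗ Q.Sl))) (lt (d₂ ∘ₗ Q.Sl))) (rt (d₂)) (Q.pElt R))
    ha h₃ b₃ a₃ (fun x ↦ h₂₃ _ _) (fun x ↦ by
      rw [mul_assoc, (c₄.join_left (comm_lt_rt _ _)).leg_left h₂₃.rt, ← mul_assoc,
        phi_comm c₄ (comm_lt_rt _ _) h₂₃.rt, mul_assoc])
  have g₂ := Q.act_phi_pElt R (w := 1) (X := 1) hc h₂ c₂ c₃ (fun x ↦ by simp) (fun x ↦ by simp)
  rw [mul_one, mul_one, act_one] at g₂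
  rw [← h₂₃, mul_assoc, g₂] at g₁
  exact g₁

/-- It makes `T` recoverable from `slide T q₂`, so an equation may be checked after inserting `q₂`.
-/
theorem qElt₂_cancel :
    act (Q.qElt₂ R) (leg (join R.ρ (join R.ρ (Q.conjLast R) (lt (mid k A H ∘ₗ Q.Sl)))
        (rt (mid k A H))) (rt (last k A H)) (Q.pElt R) *
      leg (join R.ρ (Q.conjLast R) (lt (mid k A H ∘ₗ Q.Sl))) (rt (mid k A H)) (Q.pElt R)) = 1 := by
  have h₁ : IsLeg (slot₁ k A (H ⊗[k] H)) := isLeg_id.inl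
  have h₂₃ : Comm (mid k A H) (last k A H) := (comm_inl_inr _ _).inr
  have h₁₂ : Comm (slot₁ k A (H ⊗[k] H)) (mid k A H) := comm_inl_inr _ _
  have h₁₃ : Comm (slot₁ k A (H ⊗[k] H)) (last k A H) := comm_inl_inr _ _
  rw [qElt₂_eq, ← act_mul]
  exact Q.act_phi_phi_pElt R h₁.rt isLeg_id.inl.inr isLeg_id.inr.inr h₂₃ (comm_rt_lt _ _)
    (comm_rt_lt _ _) h₁₂.rt h₁₃.rt

end CoherenceCancel

end QuasiHopfAlgebra

/-- Commuting left `H`-action and right `A`-action on `M`. -/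
structure BiAction (k H A M : Type*) [Field k] [Ring H] [Algebra k H] [Ring A] [Algebra k A]
    [AddCommGroup M] [Module k M] where
  /-- the left action -/
  L : H →ₐ[k] Module.End k M
  /-- the right action -/
  R : A →ₗ[k] Module.End k M
  R_one : ∀ m, R 1 m = m
  R_mul : ∀ a b m, R (a * b) m = R b (R a m)
  comm : ∀ h a m, R a (L h m) = L h (R a m)

/-! ### Actions on M ⊗ C and twisted commutation relations -/

namespace BiAction

section Basic

variable {k H A M C E : Type*} [Field k] [Ring H] [Algebra k H] [Ring A] [Algebra k A]
  [AddCommGroup M] [Module k M] [Ring C] [Algebra k C] [Ring E] [Algebra k E]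
  (X : BiAction k H A M)

/-- The left action of `H ⊗ C` on `M ⊗ C`. -/
def lop : H ⊗[k] C →ₗ[k] Module.End k (M ⊗[k] C) :=
  tensorOp X.L.toLinearMap (LinearMap.mul k C)

/-- The right action of `A ⊗ C` on `M ⊗ C`. -/
def rop : A ⊗[k] C →ₗ[k] Module.End k (M ⊗[k] C) :=
  tensorOp X.R (LinearMap.mul k C).flip

@[simp]
theorem lop_tmul (h : H) (c : C) (m : M) (d : C) :
    X.lop (h ⊗ₜ c) (m ⊗ₜ d) = X.L h m ⊗ₜ[k] (c * d) := rfl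

@[simp]
theorem rop_tmul (a : A) (c : C) (m : M) (d : C) :
    X.rop (a ⊗ₜ c) (m ⊗ₜ d) = X.R a m ⊗ₜ[k] (d * c) := rfl

theorem lop_one (v : M ⊗[k] C) : X.lop 1 v = v := by
  rw [Algebra.TensorProduct.one_def]
  induction v with
  | zero => simp
  | add y z hy hz => simp only [map_add, hy, hz]
  | tmul m d => simp

theorem rop_one (v : M ⊗[k] C) : X.rop 1 v = v := by
  rw [Algebra.TensorProduct.one_def]
  induction v with
  | zero => simp
  | add y z hy hz => simp only [map_add, hy, hz]
  | tmul m d => simp [X.R_one]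

theorem lop_mul (s t : H ⊗[k] C) (v : M ⊗[k] C) : X.lop (s * t) v = X.lop s (X.lop t v) := by
  induction v with
  | zero => simp
  | add y z hy hz => simp only [map_add, hy, hz]
  | tmul m d =>
  induction s with
  | zero => simp
  | add y z hy hz => simp only [map_add, tensor_add_mul, LinearMap.add_apply, hy, hz]
  | tmul h c =>
  induction t with
  | zero => simp
  | add y z hy hz => simp only [map_add, tensor_mul_add, LinearMap.add_apply, hy, hz]
  | tmul h' c' => simp [mul_assoc]

theorem rop_mul (s t : A ⊗[k] C) (v : M ⊗[k] C) : X.rop (s * t) v = X.rop t (X.rop s v) := by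
  induction v with
  | zero => simp
  | add y z hy hz => simp only [map_add, hy, hz]
  | tmul m d =>
  induction s with
  | zero => simp
  | add y z hy hz => simp only [map_add, tensor_add_mul, LinearMap.add_apply, hy, hz]
  | tmul h c =>
  induction t with
  | zero => simp
  | add y z hy hz => simp only [map_add, tensor_mul_add, LinearMap.add_apply, hy, hz]
  | tmul h' c' => simp [mul_assoc, X.R_mul]

theorem rop_lop (s : A ⊗[k] C) (t : H ⊗[k] C) (v : M ⊗[k] C) :
    X.rop s (X.lop t v) = X.lop t (X.rop s v) := by
  induction v with
  | zero => simp
  | add y z hy hz => simp only [map_add, hy, hz]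
  | tmul m d =>
  induction s with
  | zero => simp
  | add y z hy hz => simp only [map_add, LinearMap.add_apply, hy, hz]
  | tmul h c =>
  induction t with
  | zero => simp
  | add y z hy hz => simp only [map_add, LinearMap.add_apply, hy, hz]
  | tmul h' c' => simp [mul_assoc, X.comm]

theorem lop_inv_lop (t : (H ⊗[k] C)ˣ) (v : M ⊗[k] C) : X.lop ↑t⁻¹ (X.lop ↑t v) = v := by
  rw [← lop_mul, Units.inv_mul, lop_one]

theorem lTensor_lop (g : C →ₗ[k] E) (δ : C →ₗ[k] E) (hg : ∀ c d, g (c * d) = δ c * g d)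
    (t : H ⊗[k] C) (v : M ⊗[k] C) :
    LinearMap.lTensor M g (X.lop t v) = X.lop (LinearMap.lTensor H δ t) (LinearMap.lTensor M g v) := by
  induction v with
  | zero => simp
  | add y z hy hz => simp only [map_add, hy, hz]
  | tmul m d =>
  induction t with
  | zero => simp
  | add y z hy hz => simp only [map_add, LinearMap.add_apply, hy, hz]
  | tmul h c => simp [hg]

theorem lTensor_rop (g : C →ₗ[k] E) (δ : C →ₗ[k] E) (hg : ∀ c d, g (d * c) = g d * δ c)
    (t : A ⊗[k] C) (v : M ⊗[k] C) :
    LinearMap.lTensor M g (X.rop t v) = X.rop (LinearMap.lTensor A δ t) (LinearMap.lTensor M g v) := by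
  induction v with
  | zero => simp
  | add y z hy hz => simp only [map_add, hy, hz]
  | tmul m d =>
  induction t with
  | zero => simp
  | add y z hy hz => simp only [map_add, LinearMap.add_apply, hy, hz]
  | tmul h c => simp [hg]

/-- `(id ⊗ ε)` as a map `M ⊗ H → M`. -/
def drop (M : Type*) [AddCommGroup M] [Module k M] (ε : H →ₐ[k] k) : M ⊗[k] H →ₗ[k] M :=
  (TensorProduct.rid k M).toLinearMap ∘ₗ LinearMap.lTensor M ε.toLinearMap

@[simp]
theorem drop_tmul (ε : H →ₐ[k] k) (m : M) (h : H) : drop M ε (m ⊗ₜ h) = ε h • m := rfl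

theorem drop_lop (ε : H →ₐ[k] k) (t : H ⊗[k] H) (v : M ⊗[k] H) :
    drop M ε (X.lop t v) = X.L (dropRight H ε t) (drop M ε v) := by
  induction v with
  | zero => simp
  | add y z hy hz => simp only [map_add, hy, hz]
  | tmul m d =>
  induction t with
  | zero => simp
  | add y z hy hz => simp only [map_add, LinearMap.add_apply, hy, hz]
  | tmul h c => simp [smul_smul, mul_comm]

theorem drop_rop (ε : H →ₐ[k] k) (t : A ⊗[k] H) (v : M ⊗[k] H) :
    drop M ε (X.rop t v) = X.R (dropRight A ε t) (drop M ε v) := by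
  induction v with
  | zero => simp
  | add y z hy hz => simp only [map_add, hy, hz]
  | tmul m d =>
  induction t with
  | zero => simp
  | add y z hy hz => simp only [map_add, LinearMap.add_apply, hy, hz]
  | tmul h c => simp [smul_smul]

/-- For `T : M → M ⊗ C`, the map `a ⊗ c ↦ (m ↦ T(m a) (1 ⊗ c))`. -/
def slide (T : M →ₗ[k] M ⊗[k] C) : A ⊗[k] C →ₗ[k] M →ₗ[k] M ⊗[k] C :=
  TensorProduct.lift <| LinearMap.mk₂ k
    (fun (a : A) (c : C) ↦ X.rop (slot₂ k A C c) ∘ₗ T ∘ₗ X.R a)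
    (by intros; ext; simp) (by intros; ext; simp) (by intros; ext; simp) (by intros; ext; simp)

@[simp]
theorem slide_tmul (T : M →ₗ[k] M ⊗[k] C) (a : A) (c : C) (m : M) :
    X.slide T (a ⊗ₜ c) m = X.rop (slot₂ k A C c) (T (X.R a m)) := rfl

theorem slide_one (T : M →ₗ[k] M ⊗[k] C) : X.slide T 1 = T := by
  ext m
  rw [Algebra.TensorProduct.one_def, slide_tmul, X.R_one, isLeg_id.inr.unital, rop_one]

theorem slide_slot₁_mul (T : M →ₗ[k] M ⊗[k] C) (a : A) (x : A ⊗[k] C) (m : M) :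
    X.slide T (slot₁ k A C a * x) m = X.slide T x (X.R a m) := by
  induction x with
  | zero => simp
  | add y z hy hz => simp only [map_add, tensor_mul_add, LinearMap.add_apply, hy, hz]
  | tmul b c => simp [inl_apply, X.R_mul]

theorem slide_mul_slot₂ (T : M →ₗ[k] M ⊗[k] C) (c : C) (x : A ⊗[k] C) (m : M) :
    X.slide T (x * slot₂ k A C c) m = X.rop (slot₂ k A C c) (X.slide T x m) := by
  induction x with
  | zero => simp
  | add y z hy hz => simp only [map_add, tensor_add_mul, LinearMap.add_apply, hy, hz]
  | tmul b d =>
  rw [inr_apply, Algebra.TensorProduct.tmul_mul_tmul, mul_one, slide_tmul, slide_tmul, ← rop_mul]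
  simp [inr_apply]

theorem slide_lop (T : M →ₗ[k] M ⊗[k] C) (t : H ⊗[k] C) (x : A ⊗[k] C) (m : M) :
    X.slide (X.lop t ∘ₗ T) x m = X.lop t (X.slide T x m) := by
  induction x with
  | zero => simp
  | add y z hy hz => simp only [map_add, LinearMap.add_apply, hy, hz]
  | tmul b d => simp [rop_lop]

/-- An operator that is applied between `slot₁` on the left and `slot₂` on the right. -/
def IsInner (O : Opr k (A ⊗[k] C)) : Prop :=
  ∀ a c x, act (slot₁ k A C a * x * slot₂ k A C c) O = slot₁ k A C a * act x O * slot₂ k A C c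

/-- An inner operator is determined by its value at `1`: at `b ⊗ d` it is `(b ⊗ 1) O(1) (1 ⊗ d)`,
and a slide by `b ⊗ d` surrounds the inner slide in the same way. -/
theorem slide_slide (T : M →ₗ[k] M ⊗[k] C) {O : Opr k (A ⊗[k] C)} (hO : IsInner O)
    (x : A ⊗[k] C) : X.slide (X.slide T (act 1 O)) x = X.slide T (act x O) := by
  ext m
  induction x with
  | zero => simp [act_zero]
  | add y z hy hz => simp only [map_add, act_add, LinearMap.add_apply, hy, hz]
  | tmul b d =>
    have := hO b d 1
    rw [mul_one] at this
    rw [slide_tmul, ← slide_mul_slot₂, ← slide_slot₁_mul, ← mul_assoc, ← this]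
    simp [inl_apply, inr_apply]

/-- `T(m) (a ⊗ 1) = ∑ T(m x) (1 ⊗ c)`, where `∑ x ⊗ c` is the element `1` acted on by `σ a`. -/
def IsTwisted (T : M →ₗ[k] M ⊗[k] C) (σ : A →ₗ[k] Opr k (A ⊗[k] C)) : Prop :=
  ∀ a m, X.rop (slot₁ k A C a) (T m) = X.slide T (act 1 (σ a)) m

theorem IsTwisted.slide {T : M →ₗ[k] M ⊗[k] C} {σ : A →ₗ[k] Opr k (A ⊗[k] C)}
    (h : X.IsTwisted T σ) (hσ : ∀ a, IsInner (σ a)) (a : A) (x : A ⊗[k] C) (m : M) :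
    X.rop (slot₁ k A C a) (X.slide T x m) = X.slide T (act x (σ a)) m := by
  rw [← slide_slide _ _ (hσ a)]
  induction x with
  | zero => simp
  | add y z hy hz => simp only [map_add, LinearMap.add_apply, hy, hz]
  | tmul b d =>
    rw [slide_tmul, slide_tmul, ← h, ← rop_mul, ← rop_mul,
      (comm_inl_inr _ _ : Comm (slot₁ k A C) (slot₂ k A C))]

/-- Right multiplication on the values of `T` is traded for operators on the argument `x ∈ A ⊗ C`.
This reduces statements about twisted coactions to the identities for `p`, `q` and `Φρ`. -/
theorem IsTwisted.rop_slide {T : M →ₗ[k] M ⊗[k] C} {σ : A →ₗ[k] Opr k (A ⊗[k] C)}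
    (h : X.IsTwisted T σ) (hσ : ∀ a, IsInner (σ a)) (t x : A ⊗[k] C) (m : M) :
    X.rop t (X.slide T x m) = X.slide T (act x (leg σ (rt (slot₂ k A C)) t)) m := by
  induction t with
  | zero => simp
  | add y z hy hz => simp only [map_add, LinearMap.add_apply, hy, hz]
  | tmul b d =>
    rw [leg_tmul, act_mul, act_rt, slide_mul_slot₂, ← h.slide X hσ, ← rop_mul]
    simp [inl_apply, inr_apply]

theorem IsInner.mul {O O' : Opr k (A ⊗[k] C)} (h : IsInner O) (h' : IsInner O') :
    IsInner (O * O') := fun a c x ↦ by rw [act_mul, h, h', act_mul]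

theorem isInner_leg {B B' : Type*} [Ring B] [Algebra k B] [Ring B'] [Algebra k B']
    {f : B →ₗ[k] Opr k (A ⊗[k] C)} {g : B' →ₗ[k] Opr k (A ⊗[k] C)} (hf : ∀ b, IsInner (f b))
    (hg : ∀ b, IsInner (g b)) (t : B ⊗[k] B') : IsInner (leg f g t) := by
  induction t with
  | zero => intro a c x; simp
  | add y z hy hz => intro a c x; simp only [map_add, mul_add, add_mul, hy a c x, hz a c x]
  | tmul y z => exact (hf y).mul (hg z)

theorem isInner_rt_slot₁ (a : A) : IsInner (rt (slot₁ k A C) a) := fun b c x ↦ by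
  rw [act_rt, act_rt, mul_assoc, ← (comm_inl_inr _ _ : Comm (slot₁ k A C) (slot₂ k A C))]
  simp only [mul_assoc]

theorem isInner_lt_inr {B : Type*} [Ring B] [Algebra k B] (g : B →ₗ[k] C) (b : B) :
    IsInner (lt (inr A g) b) := fun a c x ↦ by
  rw [act_lt, act_lt, ← mul_assoc, ← mul_assoc,
    ← (comm_inl_inr _ _ : Comm (slot₁ k A C) (inr A g))]
  simp only [mul_assoc]

/-- `T ⊗ id` as a map to `M ⊗ (C ⊗ E)`. -/
def up (E : Type*) [Ring E] [Algebra k E] (T : M →ₗ[k] M ⊗[k] C) :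
    M ⊗[k] E →ₗ[k] M ⊗[k] (C ⊗[k] E) :=
  (TensorProduct.assoc k M C E).toLinearMap ∘ₗ LinearMap.rTensor E T

theorem up_tmul (T : M →ₗ[k] M ⊗[k] C) (m : M) (e : E) :
    up E T (m ⊗ₜ e) = TensorProduct.assoc k M C E (T m ⊗ₜ e) := rfl

theorem assoc_rop (a : A) (c : C) (v : M ⊗[k] C) (e e' : E) :
    TensorProduct.assoc k M C E (X.rop (a ⊗ₜ c) v ⊗ₜ (e * e')) =
      X.rop (a ⊗ₜ (c ⊗ₜ e')) (TensorProduct.assoc k M C E (v ⊗ₜ e)) := by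
  induction v with
  | zero => simp
  | add y z hy hz => simp only [map_add, add_tmul, hy, hz]
  | tmul m d => simp

theorem assoc_lop (h : H) (c : C) (v : M ⊗[k] C) (e e' : E) :
    TensorProduct.assoc k M C E (X.lop (h ⊗ₜ c) v ⊗ₜ (e * e')) =
      X.lop (h ⊗ₜ (c ⊗ₜ e)) (TensorProduct.assoc k M C E (v ⊗ₜ e')) := by
  induction v with
  | zero => simp
  | add y z hy hz => simp only [map_add, add_tmul, hy, hz]
  | tmul m d => simp

theorem up_rop_slot₂ (T : M →ₗ[k] M ⊗[k] C) (e : E) (v : M ⊗[k] E) :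
    up E T (X.rop (slot₂ k A E e) v) = X.rop (inr A (slot₂ k C E) e) (up E T v) := by
  induction v with
  | zero => simp
  | add y z hy hz => simp only [map_add, hy, hz]
  | tmul m d =>
    have := X.assoc_rop 1 1 (T m) d e
    rw [← Algebra.TensorProduct.one_def, rop_one] at this
    simp [inr_apply, up_tmul, X.R_one, this]

theorem up_lop (T : M →ₗ[k] M ⊗[k] C) (t : H ⊗[k] C) (v : M ⊗[k] E) :
    up E (X.lop t ∘ₗ T) v = X.lop (Algebra.TensorProduct.assoc k k k H C E (t ⊗ₜ 1)) (up E T v) := by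
  induction v with
  | zero => simp
  | add y z hy hz => simp only [map_add, hy, hz]
  | tmul m d =>
  induction t with
  | zero => simp [up_tmul]
  | add y z hy hz =>
    simp only [map_add, add_tmul, LinearMap.add_apply, ← hy, ← hz]
    simp [up_tmul, add_tmul]
  | tmul h c =>
    rw [up_tmul, LinearMap.comp_apply, Algebra.TensorProduct.assoc_tmul, ← one_mul d, up_tmul,
      assoc_lop]
    simp

theorem up_splitLeft {D : M →ₗ[k] M ⊗[k] H} {Δ : H →ₐ[k] H ⊗[k] H}
    (hD : ∀ h m, D (X.L h m) = X.lop (Δ h) (D m)) (t : H ⊗[k] E) (v : M ⊗[k] E) :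
    up E D (X.lop t v) = X.lop (splitLeft E Δ t) (up E D v) := by
  induction v with
  | zero => simp
  | add y z hy hz => simp only [map_add, hy, hz]
  | tmul m d =>
  induction t with
  | zero => simp
  | add y z hy hz => simp only [map_add, LinearMap.add_apply, hy, hz]
  | tmul h e =>
  rw [lop_tmul, up_tmul, hD, splitLeft_tmul]
  induction Δ h with
  | zero => simp
  | add y z hy hz => simp only [map_add, add_tmul, LinearMap.add_apply, hy, hz]
  | tmul h c => rw [assoc_lop, Algebra.TensorProduct.assoc_tmul, up_tmul]

/-- For an honest coaction the compatibility with `A` turns the slide into right multiplication by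
`∑ ρ(x¹) p (1 ⊗ x²)`, the expression in `qElt_pElt`. -/
theorem slide_rop {D : M →ₗ[k] M ⊗[k] H} {ρ : A →ₐ[k] A ⊗[k] H}
    (hD : ∀ a m, D (X.R a m) = X.rop (ρ a) (D m)) (p x : A ⊗[k] H) (m : M) :
    X.slide (X.rop p ∘ₗ D) x m =
      X.rop (act p (leg (lt ρ.toLinearMap) (rt (slot₂ k A H)) x)) (D m) := by
  induction x with
  | zero => simp
  | add y z hy hz => simp only [map_add, LinearMap.add_apply, hy, hz]
  | tmul b d =>
    rw [slide_tmul, leg_tmul, LinearMap.comp_apply, hD, ← rop_mul, ← rop_mul]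
    simp [mul_assoc]

end Basic

end BiAction

namespace BiAction

open QuasiHopfAlgebra RightComoduleAlgebra

/-! ### Coactions and twisted coactions -/

section Coactions

variable {k H A M : Type*} [Field k] [Ring H] [Algebra k H] [Ring A] [Algebra k A]
  [AddCommGroup M] [Module k M] (X : BiAction k H A M)
  (Q : QuasiHopfAlgebra k H) (R : RightComoduleAlgebra Q.toQuasiBialgebra A)

/-- The conditions on the coaction of a two-sided Hopf module. -/
structure IsCoaction (D : M →ₗ[k] M ⊗[k] H) : Prop where
  counit : ∀ m, drop M Q.ε (D m) = m
  lact : ∀ h m, D (X.L h m) = X.lop (Q.Δ h) (D m)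
  ract : ∀ a m, D (X.R a m) = X.rop (R.ρ a) (D m)
  coassoc : ∀ m, X.lop (Q.Φ : H ⊗[k] (H ⊗[k] H)) (up H D (D m)) =
    X.rop (R.Φρ : A ⊗[k] (H ⊗[k] H)) (LinearMap.lTensor M Q.Δ.toLinearMap (D m))

/-- The comultiplication twisted by `drinfeld`, as `S ⊗ S` of the opposite comultiplication. -/
def twistedComul : H →ₗ[k] H ⊗[k] H := Q.antiS (slot₁ k H H) (slot₂ k H H) ∘ₗ Q.Si

/-- The operator `x ↦ ∑ (1 ⊗ S(x³) ⊗ S(x²)) x (x¹ ⊗ 1 ⊗ 1)` for `Φρ⁻¹ = ∑ x¹ ⊗ x² ⊗ x³`,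
with the last two factors interchanged. -/
def conjPhiInv : Opr k (A ⊗[k] (H ⊗[k] H)) :=
  R.phiInv (rt (slot₁ k A (H ⊗[k] H))) (lt (last k A H ∘ₗ Q.Sl)) (lt (mid k A H ∘ₗ Q.Sl))

variable (k H) in
/-- The linear map `x ⊗ (y ⊗ z) ↦ S(z) ⊗ (S(y) ⊗ S(x))`. -/
def antiS₃ : H ⊗[k] (H ⊗[k] H) →ₗ[k] H ⊗[k] (H ⊗[k] H) :=
  leg (last k H H ∘ₗ Q.Sl) (leg (mid k H H ∘ₗ Q.Sl) (slot₁ k H (H ⊗[k] H) ∘ₗ Q.Sl))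

/-- The twisted iterate of `V`. -/
def twistedIterate (V : M →ₗ[k] M ⊗[k] H) : M →ₗ[k] M ⊗[k] (H ⊗[k] H) :=
  X.lop (antiS₃ k H Q ↑Q.Φ⁻¹) ∘ₗ
    X.slide (LinearMap.lTensor M (twistedComul Q) ∘ₗ V) (act 1 (conjPhiInv Q R))

/-- The conditions on the twisted coaction that corresponds to a coaction. -/
structure IsTwistedCoaction (V : M →ₗ[k] M ⊗[k] H) : Prop where
  counit : ∀ m, drop M Q.ε (V m) = m
  lact : ∀ h m, V (X.L (Q.Sl h) m) = X.lop (Q.antiS (slot₁ k H H) (slot₂ k H H) h) (V m)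
  ract : X.IsTwisted V (Q.conjRight R)
  coassoc : ∀ m, up H V (V m) = twistedIterate X Q R V m

/-- The twisted coaction of a coaction. -/
def toTwisted (D : M →ₗ[k] M ⊗[k] H) : M →ₗ[k] M ⊗[k] H :=
  X.lop Q.drinfeld ∘ₗ X.rop (Q.pElt R) ∘ₗ D

variable [FiniteDimensional k H]

/-- The coaction of a twisted coaction. -/
def toCoaction (V : M →ₗ[k] M ⊗[k] H) : M →ₗ[k] M ⊗[k] H :=
  X.lop ↑Q.twistUnit⁻¹ ∘ₗ X.slide V (Q.qElt R)

end Coactions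

/-! ### The two constructions are mutually inverse -/

section Correspondence

variable {k H A M : Type*} [Field k] [Ring H] [Algebra k H] [Ring A] [Algebra k A]
  [AddCommGroup M] [Module k M] {X : BiAction k H A M}
  {Q : QuasiHopfAlgebra k H} {R : RightComoduleAlgebra Q.toQuasiBialgebra A}
  {D V : M →ₗ[k] M ⊗[k] H}

/-- As `S` is surjective, the relation for `f Δ(S(h))` says that `f` conjugates `Δ` into the twisted
comultiplication. -/
theorem drinfeld_mul_comul (h : H) :
    Q.drinfeld * Q.Δ h = twistedComul Q h * Q.drinfeld := by
  have := Q.drinfeld_mul_S (isLeg_slot₁ (k := k) (A := H) (H := H)) isLeg_slot₂ comm_slot (Q.Si h)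
  rw [← Q.Δ_eq, Q.Sl_Si, leg_slot] at this
  exact this

theorem twistedComul_Sl (h : H) :
    twistedComul Q (Q.Sl h) = Q.antiS (slot₁ k H H) (slot₂ k H H) h := by
  rw [twistedComul, LinearMap.comp_apply, Q.Si_Sl]

theorem twistedComul_mul (x y : H) :
    twistedComul Q (x * y) = twistedComul Q x * twistedComul Q y := by
  have h := Q.isAntiLeg_antiS (isLeg_slot₁ (k := k) (A := H) (H := H)) isLeg_slot₂ comm_slot
  obtain ⟨x, rfl⟩ : ∃ x', Q.Sl x' = x := ⟨_, Q.Sl_Si x⟩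
  obtain ⟨y, rfl⟩ : ∃ y', Q.Sl y' = y := ⟨_, Q.Sl_Si y⟩
  rw [← Q.isAntiLeg_Sl.multiplicative]
  simp only [twistedComul_Sl]
  exact h.multiplicative _ _

theorem isInner_conjRight (a : A) : IsInner (Q.conjRight R a) :=
  isInner_leg isInner_rt_slot₁ (isInner_lt_inr Q.Sl) _

theorem act_one_conjRight (a : A) :
    act 1 (Q.conjRight R a) = LinearMap.lTensor A Q.Sl (R.ρ a) := by
  rw [conjRight, join_apply]
  induction R.ρ a with
  | zero => simp
  | add y z hy hz => simp only [map_add, hy, hz]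
  | tmul x y => simp [inl_apply, inr_apply]

theorem slide_lact {C : Type*} [Ring C] [Algebra k C] {T : M →ₗ[k] M ⊗[k] C} {h : H} {u : H ⊗[k] C}
    (hT : ∀ m, T (X.L h m) = X.lop u (T m)) (x : A ⊗[k] C) (m : M) :
    X.slide T x (X.L h m) = X.lop u (X.slide T x m) := by
  induction x with
  | zero => simp
  | add y z hy hz => simp only [map_add, LinearMap.add_apply, hy, hz]
  | tmul b d => rw [slide_tmul, slide_tmul, X.comm, hT, rop_lop]

theorem drop_slide {ε : H →ₐ[k] k} (hV : ∀ m, drop M ε (V m) = m) (x : A ⊗[k] H) (m : M) :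
    drop M ε (X.slide V x m) = X.R (dropRight A ε x) m := by
  induction x with
  | zero => simp
  | add y z hy hz => simp only [map_add, LinearMap.add_apply, hy, hz]
  | tmul b d =>
    rw [slide_tmul, drop_rop, hV]
    simp [inr_apply, X.R_one]

/-- The counit contributes `ε(α)` from `f` and `ε(β)` from `p`, and these are inverse to each other.
-/
theorem toTwisted_counit (h : ∀ m, drop M Q.ε (D m) = m) (m : M) :
    drop M Q.ε (toTwisted X Q R D m) = m := by
  rw [toTwisted, LinearMap.comp_apply, LinearMap.comp_apply, drop_lop, drop_rop, h,
    Q.drinfeld_counit_right, Q.dropRight_pElt]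
  simp [X.R_one, smul_smul, mul_comm (Q.ε Q.β), Q.counit_alpha_mul_counit_beta]

theorem toTwisted_lact (hD : ∀ h m, D (X.L h m) = X.lop (Q.Δ h) (D m)) (h : H) (m : M) :
    toTwisted X Q R D (X.L (Q.Sl h) m) =
      X.lop (Q.antiS (slot₁ k H H) (slot₂ k H H) h) (toTwisted X Q R D m) := by
  simp only [toTwisted, LinearMap.comp_apply]
  rw [hD, rop_lop, ← lop_mul, ← lop_mul, drinfeld_mul_comul, twistedComul_Sl]

/-- The relation `∑ ρ(a₀) p (1 ⊗ S(a₁)) = p (a ⊗ 1)`, read on the values of the coaction. -/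
theorem toTwisted_ract (hD : ∀ a m, D (X.R a m) = X.rop (R.ρ a) (D m)) :
    X.IsTwisted (toTwisted X Q R D) (Q.conjRight R) := by
  intro a m
  rw [toTwisted, slide_lop, slide_rop X hD]
  simp only [LinearMap.comp_apply]
  rw [rop_lop, ← rop_mul, ← Q.coact_mul_pElt]
  congr 3
  rw [act_one_conjRight, join_apply]
  induction R.ρ a with
  | zero => simp
  | add y z hy hz => simp only [map_add, hy, hz]
  | tmul x y => simp

variable [FiniteDimensional k H]

theorem twistUnit_inv_mul : ↑Q.twistUnit⁻¹ * Q.drinfeld = 1 := by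
  rw [← Q.twistUnit_val, Units.inv_mul]

theorem mul_twistUnit_inv : Q.drinfeld * ↑Q.twistUnit⁻¹ = 1 := by
  rw [← Q.twistUnit_val, Units.mul_inv]

theorem twistUnit_inv_mul_twistedComul (h : H) :
    ↑Q.twistUnit⁻¹ * twistedComul Q h = Q.Δ h * ↑Q.twistUnit⁻¹ := by
  rw [Units.inv_mul_eq_iff_eq_mul, ← mul_assoc, Units.eq_mul_inv_iff_mul_eq, Q.twistUnit_val,
    drinfeld_mul_comul]

theorem toCoaction_counit (h : ∀ m, drop M Q.ε (V m) = m) (m : M) :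
    drop M Q.ε (toCoaction X Q R V m) = m := by
  rw [toCoaction, LinearMap.comp_apply, drop_lop, drop_slide h, Q.dropRight_qElt, map_smul,
    LinearMap.smul_apply, X.R_one]
  have e := map_inv_mul (dropRight H Q.ε) Q.twistUnit
  rw [Q.twistUnit_val, Q.drinfeld_counit_right, mul_smul_comm, mul_one] at e
  rw [map_smul, ← LinearMap.smul_apply, ← map_smul, e]
  simp

theorem toCoaction_lact (hV : ∀ h m, V (X.L (Q.Sl h) m) =
    X.lop (Q.antiS (slot₁ k H H) (slot₂ k H H) h) (V m)) (h : H) (m : M) :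
    toCoaction X Q R V (X.L h m) = X.lop (Q.Δ h) (toCoaction X Q R V m) := by
  simp only [toCoaction, LinearMap.comp_apply]
  have hV' (m : M) : V (X.L h m) = X.lop (twistedComul Q h) (V m) := by
    have := hV (Q.Si h) m
    rwa [Q.Sl_Si] at this
  rw [slide_lact hV', ← lop_mul, ← lop_mul, twistUnit_inv_mul_twistedComul]

theorem toCoaction_ract (hV : X.IsTwisted V (Q.conjRight R)) (a : A) (m : M) :
    toCoaction X Q R V (X.R a m) = X.rop (R.ρ a) (toCoaction X Q R V m) := by
  simp only [toCoaction, LinearMap.comp_apply]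
  rw [rop_lop, hV.rop_slide X isInner_conjRight, ← slide_slot₁_mul, ← Q.qElt_conjRight]
  rfl

theorem toCoaction_toTwisted (hD : ∀ a m, D (X.R a m) = X.rop (R.ρ a) (D m)) :
    toCoaction X Q R (toTwisted X Q R D) = D := by
  ext1 m
  rw [toCoaction, LinearMap.comp_apply, toTwisted, slide_lop, slide_rop X hD, Q.qElt_pElt, rop_one,
    ← lop_mul, twistUnit_inv_mul, lop_one]

theorem toTwisted_toCoaction (hV : X.IsTwisted V (Q.conjRight R)) :
    toTwisted X Q R (toCoaction X Q R V) = V := by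
  ext1 m
  simp only [toCoaction, LinearMap.comp_apply, toTwisted]
  rw [rop_lop, ← lop_mul, mul_twistUnit_inv, lop_one, hV.rop_slide X isInner_conjRight,
    Q.pElt_qElt, slide_one]

end Correspondence

end BiAction

namespace BiAction

open QuasiHopfAlgebra RightComoduleAlgebra

/-! ### The two iterates of a twisted coaction -/

section Iterates

variable {k H A M : Type*} [Field k] [Ring H] [Algebra k H] [Ring A] [Algebra k A]
  [AddCommGroup M] [Module k M] {X : BiAction k H A M}
  {Q : QuasiHopfAlgebra k H} {R : RightComoduleAlgebra Q.toQuasiBialgebra A}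
  {D V : M →ₗ[k] M ⊗[k] H}

/-- The operators that describe the iterate of a twisted coaction. -/
def conjTwo (Q : QuasiHopfAlgebra k H) (R : RightComoduleAlgebra Q.toQuasiBialgebra A) :
    A →ₗ[k] Opr k (A ⊗[k] (H ⊗[k] H)) :=
  join (W := Opr k (A ⊗[k] (H ⊗[k] H))) R.ρ (Q.conjLast R) (lt (mid k A H ∘ₗ Q.Sl))

theorem isInner_conjLast (a : A) : IsInner (Q.conjLast R a) :=
  isInner_leg isInner_rt_slot₁ (isInner_lt_inr (slot₂ k H H ∘ₗ Q.Sl)) _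

theorem isInner_conjTwo (a : A) : IsInner (conjTwo Q R a) :=
  isInner_leg isInner_conjLast (isInner_lt_inr (slot₁ k H H ∘ₗ Q.Sl)) _

theorem isInner_conjPhi (t : A ⊗[k] (H ⊗[k] H)) : IsInner
    (leg (rt (slot₁ k A (H ⊗[k] H))) (leg (lt (last k A H ∘ₗ Q.Sl)) (lt (mid k A H ∘ₗ Q.Sl))) t) :=
  isInner_leg isInner_rt_slot₁ (isInner_leg (isInner_lt_inr (slot₂ k H H ∘ₗ Q.Sl))
    (isInner_lt_inr (slot₁ k H H ∘ₗ Q.Sl))) _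

theorem up_rop_slot₁ (T : M →ₗ[k] M ⊗[k] H) (b : A) (g : H) (v : M ⊗[k] H) :
    up H (X.rop (slot₂ k A H g) ∘ₗ T ∘ₗ X.R b) v =
      X.rop (mid k A H g) (up H T (X.rop (slot₁ k A H b) v)) := by
  induction v with
  | zero => simp
  | add y z hy hz => simp only [map_add, hy, hz]
  | tmul m d =>
    have := X.assoc_rop (E := H) 1 g (T (X.R b m)) d 1
    rw [mul_one] at this
    simp [up_tmul, inr_apply, inl_apply, this]

/-- The factor from `A` used by the outer slide must pass the inner `V`. By the twisted relation
this costs a factor `S(b₁)` in the last position, which is what `conjLast` records. -/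
theorem up_slide_slide (hV : X.IsTwisted V (Q.conjRight R)) (s t : A ⊗[k] H) (m : M) :
    up H (X.slide V s) (X.slide V t m) = X.slide (up H V ∘ₗ V)
      (act (onRight A (Algebra.TensorProduct.includeRight : H →ₐ[k] H ⊗[k] H) t)
        (leg (Q.conjLast R) (rt (mid k A H)) s)) m := by
  have one (b : A) (g : H) (m : M) : up H (X.slide V (b ⊗ₜ g)) (V m) =
      X.slide (up H V ∘ₗ V) (act 1 (Q.conjLast R b) * mid k A H g) m := by
    have e : X.slide V (b ⊗ₜ g) = X.rop (slot₂ k A H g) ∘ₗ V ∘ₗ X.R b := rfl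
    rw [e, up_rop_slot₁, hV, act_one_conjRight, conjLast, join_apply]
    have e' : mid k A H g = slot₂ k A (H ⊗[k] H) (slot₁ k H H g) := rfl
    rw [e', slide_mul_slot₂]
    congr 1
    induction R.ρ b with
    | zero => simp
    | add y z hy hz => simp only [map_add, LinearMap.add_apply, hy, hz]
    | tmul x y =>
      rw [LinearMap.lTensor_tmul, slide_tmul, up_rop_slot₂]
      simp [inl_apply, inr_apply]
  induction t with
  | zero => simp [act_zero]
  | add y z hy hz => simp only [map_add, act_add, LinearMap.add_apply, hy, hz]
  | tmul a h =>
  induction s with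
  | zero => simp [up]
  | add y z hy hz => 
    simp only [map_add, LinearMap.add_apply, ← hy, ← hz]
    simp [up, LinearMap.rTensor_add]
  | tmul b g =>
  rw [slide_tmul, up_rop_slot₂, one]
  have e : onRight A (Algebra.TensorProduct.includeRight : H →ₐ[k] H ⊗[k] H) (a ⊗ₜ[k] h) =
      slot₁ k A (H ⊗[k] H) a * slot₂ k A (H ⊗[k] H) (slot₂ k H H h) := by
    simp [inl_apply, inr_apply]
  have i := isInner_conjLast (Q := Q) (R := R) b a (slot₂ k H H h) 1
  rw [mul_one] at i
  have c : slot₂ k A (H ⊗[k] H) (slot₂ k H H h) * mid k A H g =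
      mid k A H g * slot₂ k A (H ⊗[k] H) (slot₂ k H H h) := by simp [inr_apply, inl_apply]
  rw [leg_tmul, act_mul, act_rt, e, i, mul_assoc, c, mul_assoc, slide_slot₁_mul, ← mul_assoc,
    slide_mul_slot₂]
  rfl

/-- The twisted relation is used once for each `V`: an element `a` leaves an antipode first in the
middle factor and then in the last one. -/
theorem isTwisted_iterate (hV : X.IsTwisted V (Q.conjRight R)) :
    X.IsTwisted (up H V ∘ₗ V) (conjTwo Q R) := by
  intro a m
  have e (v : M ⊗[k] H) : X.rop (slot₁ k A (H ⊗[k] H) a) (up H V v) =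
      up H (X.slide V (act 1 (Q.conjRight R a))) v := by
    induction v with
    | zero => simp
    | add y z hy hz => simp only [map_add, hy, hz]
    | tmul m d =>
      have := X.assoc_rop (E := H) a 1 (V m) d 1
      rw [mul_one] at this
      rw [up_tmul, up_tmul, ← hV]
      simp only [inl_apply, LinearMap.id_apply, this]
      rfl
  rw [LinearMap.comp_apply, e]
  have h := up_slide_slide hV (act 1 (Q.conjRight R a)) 1 m
  rw [slide_one, map_one] at h
  rw [h, act_one_conjRight, conjTwo, join_apply]
  congr 2
  have c (y : A) (z : H) :
      act 1 (Q.conjLast R y) * mid k A H z = mid k A H z * act 1 (Q.conjLast R y) := by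
    rw [conjLast, join_apply]
    induction R.ρ y with
    | zero => simp
    | add y z hy hz => simp only [map_add, add_mul, mul_add, hy, hz]
    | tmul u v => simp [inl_apply, inr_apply]
  induction R.ρ a with
  | zero => simp
  | add y z hy hz => simp only [map_add, hy, hz]
  | tmul y z =>
    rw [LinearMap.lTensor_tmul, leg_tmul, leg_tmul, act_mul, act_mul, act_rt, act_lt, c]
    rfl

theorem antiS_mid_last :
    Q.antiS (mid k A H) (last k A H) = inr A (Q.antiS (slot₁ k H H) (slot₂ k H H)) := by
  have h (f : H →ₗ[k] H ⊗[k] H) : inr A (f ∘ₗ Q.Sl) = inr A f ∘ₗ Q.Sl := rfl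
  rw [antiS, antiS, inr_join, h, h]

theorem lTensor_comul_rop_slot₁ (a : A) (v : M ⊗[k] H) :
    LinearMap.lTensor M (twistedComul Q) (X.rop (slot₁ k A H a) v) =
      X.rop (slot₁ k A (H ⊗[k] H) a) (LinearMap.lTensor M (twistedComul Q) v) := by
  induction v with
  | zero => simp
  | add y z hy hz => simp only [map_add, hy, hz]
  | tmul m d => simp [inl_apply]

theorem lTensor_comul_rop_slot₂ (h : H) (v : M ⊗[k] H) :
    LinearMap.lTensor M (twistedComul Q) (X.rop (slot₂ k A H h) v) =
      X.rop (slot₂ k A (H ⊗[k] H) (twistedComul Q h)) (LinearMap.lTensor M (twistedComul Q) v) := by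
  induction v with
  | zero => simp
  | add y z hy hz => simp only [map_add, hy, hz]
  | tmul m d => simp [inr_apply, twistedComul_mul]

theorem slide_slot₂_mul_slot₁ {C : Type*} [Ring C] [Algebra k C] (T : M →ₗ[k] M ⊗[k] C) (a : A)
    (c : C) (m : M) :
    X.slide T (slot₂ k A C c * slot₁ k A C a) m = X.rop (slot₂ k A C c) (T (X.R a m)) := by
  rw [inl_apply, inr_apply, Algebra.TensorProduct.tmul_mul_tmul, one_mul, mul_one]
  rfl

theorem isTwisted_comul (hV : X.IsTwisted V (Q.conjRight R)) :
    X.IsTwisted (LinearMap.lTensor M (twistedComul Q) ∘ₗ V)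
      (join R.ρ (rt (slot₁ k A (H ⊗[k] H))) (lt (Q.antiS (mid k A H) (last k A H)))) := by
  intro a m
  rw [LinearMap.comp_apply, ← lTensor_comul_rop_slot₁, hV, act_one_conjRight, join_apply,
    antiS_mid_last]
  induction R.ρ a with
  | zero => simp
  | add y z hy hz => simp only [map_add, LinearMap.add_apply, hy, hz]
  | tmul y z =>
    rw [LinearMap.lTensor_tmul, slide_tmul, lTensor_comul_rop_slot₂, leg_tmul, act_mul, act_rt,
      act_lt, one_mul, twistedComul_Sl]
    exact (slide_slot₂_mul_slot₁ (X := X) (LinearMap.lTensor M (twistedComul Q) ∘ₗ V) y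
      (Q.antiS (slot₁ k H H) (slot₂ k H H) z) m).symm

/-- Before `Φρ⁻¹` enters, `a` is twisted through the comultiplication of its `H`-component.
Quasi-coassociativity of `ρ` replaces this by the iterated coaction, so both iterates obey the same
twisted relation. -/
theorem isTwisted_twistedIterate (hV : X.IsTwisted V (Q.conjRight R)) :
    X.IsTwisted (twistedIterate X Q R V) (conjTwo Q R) := by
  intro a m
  have h₁ : IsLeg (slot₁ k A (H ⊗[k] H)) := isLeg_id.inl
  have h₂ : IsLeg (mid k A H) := isLeg_id.inl.inr
  have h₃ : IsLeg (last k A H) := isLeg_id.inr.inr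
  have h₃₂ : Comm (last k A H) (mid k A H) := ((comm_inl_inr _ _).inr).symm
  have key := phiInv_coassoc (R := R) h₁.rt (h₃.comp_anti Q.isAntiLeg_Sl).lt
    (h₂.comp_anti Q.isAntiLeg_Sl).lt (comm_rt_lt _ _) (comm_rt_lt _ _)
    ((h₃₂.comp_right _).comp_left _).lt a
  have hi : IsInner (conjPhiInv Q R) := isInner_conjPhi _
  have hc (b : A) : IsInner (join R.ρ (rt (slot₁ k A (H ⊗[k] H)))
      (lt (Q.antiS (mid k A H) (last k A H))) b) := by
    rw [antiS_mid_last]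
    rw [join_apply]
    exact isInner_leg isInner_rt_slot₁
      (isInner_lt_inr (A := A) (Q.antiS (slot₁ k H H) (slot₂ k H H))) _
  rw [twistedIterate, slide_lop, LinearMap.comp_apply, rop_lop,
    (isTwisted_comul hV).slide X hc, slide_slide _ _ hi, ← act_mul, Q.lt_antiS h₃₂.symm,
    conjPhiInv, key]
  rfl

end Iterates

end BiAction

namespace BiAction

open QuasiHopfAlgebra RightComoduleAlgebra

/-! ### Transfer of coassociativity -/

section Coassociativity

variable {k H A M : Type*} [Field k] [Ring H] [Algebra k H] [Ring A] [Algebra k A]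
  [AddCommGroup M] [Module k M] {X : BiAction k H A M}
  {Q : QuasiHopfAlgebra k H} {R : RightComoduleAlgebra Q.toQuasiBialgebra A}
  {D V : M →ₗ[k] M ⊗[k] H}

@[simp]
theorem antiS₃_tmul (x y z : H) :
    antiS₃ k H Q (x ⊗ₜ (y ⊗ₜ z)) = Q.Sl z ⊗ₜ (Q.Sl y ⊗ₜ Q.Sl x) := by
  simp [antiS₃, inl_apply, inr_apply]

theorem antiS₃_one : antiS₃ k H Q 1 = 1 := by
  rw [Algebra.TensorProduct.one_def, Algebra.TensorProduct.one_def, antiS₃_tmul,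
    Q.isAntiLeg_Sl.unital]

theorem antiS₃_mul (s t : H ⊗[k] (H ⊗[k] H)) :
    antiS₃ k H Q (s * t) = antiS₃ k H Q t * antiS₃ k H Q s := by
  induction s with
  | zero => simp
  | add y z hy hz => simp only [map_add, tensor_add_mul, tensor_mul_add, hy, hz]
  | tmul x s =>
  induction s with
  | zero => simp
  | add y z hy hz => simp only [map_add, tmul_add, tensor_add_mul, tensor_mul_add, hy, hz]
  | tmul y z =>
  induction t with
  | zero => simp
  | add y z hy hz => simp only [map_add, tensor_add_mul, tensor_mul_add, hy, hz]
  | tmul x' t =>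
  induction t with
  | zero => simp
  | add y z hy hz => simp only [map_add, tmul_add, tensor_add_mul, tensor_mul_add, hy, hz]
  | tmul y' z' =>
  simp only [Algebra.TensorProduct.tmul_mul_tmul, antiS₃_tmul, Q.isAntiLeg_Sl.multiplicative]

theorem solve_cocycle {N : Type*} [Monoid N] {u v w s p r u' v' w' p' r' : N}
    (h : u * (v * w) = s * (p * r)) (hu : u' * u = 1) (hv : v' * v = 1) (hw : w' * w = 1)
    (hp : p * p' = 1) (hr : r * r' = 1) : w' * v' * u' * s = r' * p' := by
  calc w' * v' * u' * s = w' * v' * u' * (s * (p * (r * r') * p')) := by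
        rw [hr, mul_one, hp, mul_one]
    _ = w' * v' * u' * (s * (p * r)) * (r' * p') := by simp only [mul_assoc]
    _ = w' * (v' * (u' * u) * v) * w * (r' * p') := by rw [← h]; simp only [mul_assoc]
    _ = r' * p' := by rw [hu, mul_one, hv, mul_one, hw, one_mul]

theorem rt_slot₂ : rt (slot₂ k A (H ⊗[k] H)) = leg (rt (mid k A H)) (rt (last k A H)) := by
  rw [← rt_leg]
  congr 1
  ext x y
  simp [inl_apply, inr_apply]

theorem slide_twistedIterate (x : A ⊗[k] (H ⊗[k] H)) (m : M) :
    X.slide (LinearMap.lTensor M (twistedComul Q) ∘ₗ V) x m =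
      X.lop (antiS₃ k H Q ↑Q.Φ) (X.slide (twistedIterate X Q R V)
        (act x (R.phi (rt (slot₁ k A (H ⊗[k] H))) (lt (last k A H ∘ₗ Q.Sl))
          (lt (mid k A H ∘ₗ Q.Sl)))) m) := by
  have h₁ : IsLeg (slot₁ k A (H ⊗[k] H)) := isLeg_id.inl
  have h₂ : IsLeg (mid k A H) := isLeg_id.inl.inr
  have h₃ : IsLeg (last k A H) := isLeg_id.inr.inr
  have h₃₂ : Comm (last k A H) (mid k A H) := ((comm_inl_inr _ _).inr).symm
  have hi : IsInner (conjPhiInv Q R) := isInner_conjPhi _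
  rw [twistedIterate, slide_lop, slide_slide _ _ hi, ← act_mul, conjPhiInv,
    phi_mul_phiInv h₁.rt (h₃.comp_anti Q.isAntiLeg_Sl).lt
    (h₂.comp_anti Q.isAntiLeg_Sl).lt (comm_rt_lt _ _) (comm_rt_lt _ _)
    ((h₃₂.comp_right _).comp_left _).lt, act_one, ← lop_mul,
    ← antiS₃_mul, Units.inv_mul, antiS₃_one, lop_one]

/-- The twisted relation converts right multiplication by the two copies of `p` into operators on
`q₂`, and these return `1` by `qElt₂_cancel`. Hence `T` can be read off from its slide by `q₂`. -/
theorem eq_of_slide_qElt₂ {T T' : M →ₗ[k] M ⊗[k] (H ⊗[k] H)} (h : X.IsTwisted T (conjTwo Q R))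
    (h' : X.IsTwisted T' (conjTwo Q R)) 
    (e : ∀ m, X.slide T (Q.qElt₂ R) m = X.slide T' (Q.qElt₂ R) m) (m : M) : T m = T' m := by
  have key {T : M →ₗ[k] M ⊗[k] (H ⊗[k] H)} (h : X.IsTwisted T (conjTwo Q R)) :
      X.rop (onRight A (Algebra.TensorProduct.includeLeft : H →ₐ[k] H ⊗[k] H) (Q.pElt R))
        (X.rop (splitLeft H R.ρ (Q.pElt R)) (X.slide T (Q.qElt₂ R) m)) = T m := by
    have e := Q.qElt₂_cancel R
    rw [h.rop_slide X isInner_conjTwo, h.rop_slide X isInner_conjTwo, ← act_mul]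
    nth_rewrite 1 [rt_slot₂]
    rw [leg_splitLeft, leg_onRight]
    refine (congrArg (fun t ↦ X.slide T t m) e).trans ?_
    rw [slide_one]
  rw [← key h, ← key h', e]

variable [FiniteDimensional k H]

/-- The inverse of `(f ⊗ 1) (Δ ⊗ id)(f)` for the Drinfeld twist `f`. -/
def twistInv (Q : QuasiHopfAlgebra k H) : H ⊗[k] (H ⊗[k] H) :=
  splitLeft H Q.Δ ↑Q.twistUnit⁻¹ *
    Algebra.TensorProduct.assoc k k k H H H ((↑Q.twistUnit⁻¹ : H ⊗[k] H) ⊗ₜ 1)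

theorem twistInv_isUnit : IsUnit (twistInv Q) :=
  .mul ((Q.twistUnit⁻¹).isUnit.map _)
    (IsUnit.map _ (isUnit_iff_exists.2 ⟨Q.drinfeld ⊗ₜ 1, by
      rw [Algebra.TensorProduct.tmul_mul_tmul, twistUnit_inv_mul, mul_one,
        ← Algebra.TensorProduct.one_def], by
      rw [Algebra.TensorProduct.tmul_mul_tmul, mul_twistUnit_inv, mul_one,
        ← Algebra.TensorProduct.one_def]⟩))

theorem iterate_toCoaction
    (hl : ∀ h m, V (X.L (Q.Sl h) m) = X.lop (Q.antiS (slot₁ k H H) (slot₂ k H H) h) (V m))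
    (hr : X.IsTwisted V (Q.conjRight R)) (m : M) :
    up H (toCoaction X Q R V) (toCoaction X Q R V m) =
      X.lop (twistInv Q) (X.slide (up H V ∘ₗ V) (Q.qElt₂ R) m) := by
  have h₁ : toCoaction X Q R V m = X.lop ↑Q.twistUnit⁻¹ (X.slide V (Q.qElt R) m) := rfl
  rw [h₁, up_splitLeft X (toCoaction_lact hl), toCoaction, up_lop, up_slide_slide hr, ← lop_mul]
  rfl

theorem lTensor_twist (v : M ⊗[k] H) : LinearMap.lTensor M Q.Δ.toLinearMap v =
    X.lop (inr H LinearMap.id ↑Q.twistUnit⁻¹) (X.rop (inr A LinearMap.id Q.drinfeld)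
      (LinearMap.lTensor M (twistedComul Q) v)) := by
  induction v with
  | zero => simp
  | add y z hy hz => simp only [map_add, hy, hz]
  | tmul m d =>
    simp only [LinearMap.lTensor_tmul, inr_apply, LinearMap.id_apply, rop_tmul, lop_tmul, X.R_one,
      map_one, Module.End.one_apply]
    rw [← drinfeld_mul_comul, ← mul_assoc, twistUnit_inv_mul, one_mul]
    rfl

theorem lTensor_slide (x : A ⊗[k] H) (m : M) :
    LinearMap.lTensor M Q.Δ.toLinearMap (X.slide V x m) =
      X.lop (inr H LinearMap.id ↑Q.twistUnit⁻¹)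
        (X.slide (LinearMap.lTensor M (twistedComul Q) ∘ₗ V)
          (inr A LinearMap.id Q.drinfeld * onRight A Q.Δ x) m) := by
  induction x with
  | zero => simp
  | add y z hy hz => simp only [map_add, mul_add, LinearMap.add_apply, hy, hz]
  | tmul a h =>
    rw [slide_tmul, lTensor_rop X _ Q.Δ.toLinearMap (fun c d ↦ map_mul Q.Δ d c),
      lTensor_twist (X := X) (Q := Q), rop_lop, ← rop_mul]
    simp only [inr_apply, LinearMap.id_apply, LinearMap.lTensor_tmul, AlgHom.toLinearMap_apply,
      onRight_tmul, Algebra.TensorProduct.tmul_mul_tmul, one_mul]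
    rfl

/-- This is `drinfeld_cocycle` solved for the inverse twists. -/
theorem twistInv_eq : (↑Q.Φ⁻¹ : H ⊗[k] (H ⊗[k] H)) * onRight H Q.Δ ↑Q.twistUnit⁻¹ *
    inr H LinearMap.id (↑Q.twistUnit⁻¹ : H ⊗[k] H) * antiS₃ k H Q ↑Q.Φ = twistInv Q := by
  have h₁ : IsLeg (slot₁ k H (H ⊗[k] H)) := isLeg_id.inl
  have h₂ : IsLeg (mid k H H) := isLeg_id.inl.inr
  have h₃ : IsLeg (last k H H) := isLeg_id.inr.inr
  have key := Q.drinfeld_cocycle h₁ h₂ h₃ (comm_inl_inr _ _) (comm_inl_inr _ _) (comm_inl_inr _ _).inr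
  have e₁ (t : H ⊗[k] H) : leg (mid k H H) (last k H H) t = inr H LinearMap.id t := by
    induction t with
    | zero => simp
    | add y z hy hz => simp only [map_add, hy, hz]
    | tmul y z => simp [inl_apply, inr_apply]
  have e₂ (t : H ⊗[k] H) :
      leg (slot₁ k H (H ⊗[k] H)) (join Q.Δ (mid k H H) (last k H H)) t = onRight H Q.Δ t := by
    induction t with
    | zero => simp
    | add y z hy hz => simp only [map_add, hy, hz]
    | tmul y z => rw [leg_tmul, join_apply, e₁]; simp [inl_apply, inr_apply]
  have e₃ (t : H ⊗[k] (H ⊗[k] H)) :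
      leg (slot₁ k H (H ⊗[k] H)) (leg (mid k H H) (last k H H)) t = t := by
    induction t with
    | zero => simp
    | add y z hy hz => simp only [map_add, hy, hz]
    | tmul y z => rw [leg_tmul, e₁]; simp [inl_apply, inr_apply]
  have e₄ (t : H ⊗[k] H) : leg (slot₁ k H (H ⊗[k] H)) (mid k H H) t =
      Algebra.TensorProduct.assoc k k k H H H (t ⊗ₜ 1) := by
    rw [← e₃ (Algebra.TensorProduct.assoc k k k H H H (t ⊗ₜ 1)), leg_assoc, h₃.unital, mul_one]
  have e₅ (t : H ⊗[k] H) : leg (join Q.Δ (slot₁ k H (H ⊗[k] H)) (mid k H H)) (last k H H) t =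
      splitLeft H Q.Δ t := by
    rw [← e₃ (splitLeft H Q.Δ t), leg_splitLeft]
  rw [e₁, e₂, e₃, e₄, e₅] at key
  refine solve_cocycle key ?_ ?_ (Units.inv_mul _) ?_ ?_
  · rw [← (isLeg_id.inr).multiplicative, twistUnit_inv_mul, isLeg_id.inr.unital]
  · rw [← map_mul, twistUnit_inv_mul, map_one]
  · rw [← map_mul, Algebra.TensorProduct.tmul_mul_tmul, mul_twistUnit_inv, mul_one,
      ← Algebra.TensorProduct.one_def, map_one]
  · rw [← map_mul, mul_twistUnit_inv, map_one]

/-- The twist converts `Δ` into the twisted comultiplication. Then `qElt_coherence` reduces the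
argument to `q₂` and `twistInv_eq` the prefactor to `twistInv`, so the result has the shape of
`iterate_toCoaction`. -/
theorem comul_toCoaction (hr : X.IsTwisted V (Q.conjRight R)) (m : M) :
    X.lop ↑Q.Φ⁻¹ (X.rop (R.Φρ : A ⊗[k] (H ⊗[k] H))
      (LinearMap.lTensor M Q.Δ.toLinearMap (toCoaction X Q R V m))) =
      X.lop (twistInv Q) (X.slide (twistedIterate X Q R V) (Q.qElt₂ R) m) := by
  have h₁ : toCoaction X Q R V m = X.lop ↑Q.twistUnit⁻¹ (X.slide V (Q.qElt R) m) := rfl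
  rw [h₁, lTensor_lop X _ Q.Δ.toLinearMap (fun c d ↦ map_mul Q.Δ c d), lTensor_slide,
    slide_twistedIterate (R := R), rop_lop, rop_lop, rop_lop, ← lop_mul, ← lop_mul, ← lop_mul,
    (isTwisted_twistedIterate hr).rop_slide X isInner_conjTwo, ← act_mul,
    rt_slot₂]
  have h₂ := Q.qElt_coherence R
  rw [phi, phi] at h₂
  rw [phi, conjTwo, h₂]
  exact congrArg (fun t ↦ X.lop t _) twistInv_eq

/-- The coaction is the one recovered from its own twisted coaction, so both sides of its
coassociativity have the form `twistInv` times a slide by `q₂`; both factors are cancelled. -/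
theorem IsCoaction.toTwisted (h : X.IsCoaction Q R D) :
    X.IsTwistedCoaction Q R (X.toTwisted Q R D) where
  counit := toTwisted_counit h.counit
  lact := toTwisted_lact h.lact
  ract := toTwisted_ract h.ract
  coassoc := by
    have hl := toTwisted_lact (R := R) h.lact
    have hr := toTwisted_ract h.ract
    refine eq_of_slide_qElt₂ (isTwisted_iterate hr) (isTwisted_twistedIterate hr) fun m ↦ ?_
    have e₁ := iterate_toCoaction hl hr m
    have e₂ := comul_toCoaction hr m
    rw [toCoaction_toTwisted h.ract] at e₁ e₂
    rw [← h.coassoc, ← lop_mul, Units.inv_mul, lop_one, e₁] at e₂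
    obtain ⟨u, hu⟩ := twistInv_isUnit (Q := Q)
    rw [← hu] at e₂
    have e₃ := congrArg (X.lop ↑u⁻¹) e₂
    rwa [lop_inv_lop, lop_inv_lop] at e₃

theorem IsTwistedCoaction.toCoaction (h : X.IsTwistedCoaction Q R V) :
    X.IsCoaction Q R (X.toCoaction Q R V) where
  counit := toCoaction_counit h.counit
  lact := toCoaction_lact h.lact
  ract := toCoaction_ract h.ract
  coassoc m := by
    rw [iterate_toCoaction h.lact h.ract, show up H V ∘ₗ V = twistedIterate X Q R V from
      LinearMap.ext h.coassoc, ← comul_toCoaction h.ract, ← lop_mul, Units.mul_inv, lop_one]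

end Coassociativity

end BiAction

/-! ### Right modules over a smash product by generators -/

section SmashRepresentations

variable {k H Y M : Type*} [Field k] [Ring H] [Algebra k H] {Q : QuasiBialgebra k H}
  [AddCommGroup Y] [Module k Y] [AddCommGroup M] [Module k M] (B : LeftModuleAlgebra Q Y)

namespace SmashProduct

/-- The map `y # h ↦ K h ∘ w y`. -/
def lift (K : H →ₗ[k] Module.End k M) (w : Y →ₗ[k] Module.End k M) :
    Y ⊗[k] H →ₗ[k] Module.End k M :=
  TensorProduct.lift ((LinearMap.mul k (Module.End k M)).flip.compl₁₂ w K)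

@[simp]
theorem lift_tmul (K : H →ₗ[k] Module.End k M) (w : Y →ₗ[k] Module.End k M) (y : Y) (h : H)
    (m : M) : lift K w (y ⊗ₜ h) m = K h (w y m) := rfl

/-- The conditions under which `y # h ↦ K h ∘ w y` is a right action of the smash product. -/
structure IsRep (K : H →ₗ[k] Module.End k M) (w : Y →ₗ[k] Module.End k M) : Prop where
  K_one : ∀ m, K 1 m = m
  K_mul : ∀ g h m, K (g * h) m = K h (K g m)
  w_one : ∀ m, w B.one m = m
  w_K : ∀ y h m, w y (K h m) =
    lift K w (tensorOp B.act.toLinearMap (LinearMap.mul k H) (Q.Δ h) (y ⊗ₜ 1)) m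
  w_w : ∀ y z m, w z (w y m) = lift K w (contract B y z 1 ↑Q.Φ⁻¹) m

variable {B} {K : H →ₗ[k] Module.End k M} {w : Y →ₗ[k] Module.End k M}

/-- In `(y # g)(z # g')` the factor `g` is moved past `z` by `w_K`, after which `w_w` multiplies `y`
by `g₁ z`. The `Φ⁻¹` in `w_w` is the one in the product of the smash product. -/
theorem IsRep.lift_mulMap (h : IsRep B K w) (s t : Y ⊗[k] H) (m : M) :
    lift K w (mulMap B s t) m = lift K w t (lift K w s m) := by
  induction s with
  | zero => simp
  | add x y hx hy => simp only [map_add, LinearMap.add_apply, hx, hy]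
  | tmul y g =>
  induction t with
  | zero => simp
  | add x y hx hy => simp only [map_add, LinearMap.add_apply, hx, hy]
  | tmul z g' =>
  rw [mulMap_tmul, lift_tmul, lift_tmul, h.w_K]
  induction Q.Δ g with
  | zero => simp
  | add x y hx hy => simp only [map_add, tensor_mul_add, LinearMap.add_apply, hx, hy]
  | tmul a b =>
  simp only [tensorOp_tmul, lift_tmul, AlgHom.toLinearMap_apply, LinearMap.mul_apply', mul_one,
    h.w_w]
  induction (↑Q.Φ⁻¹ : H ⊗[k] (H ⊗[k] H)) with
  | zero => simp
  | add x y hx hy => simp only [map_add, tensor_add_mul, LinearMap.add_apply, hx, hy]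
  | tmul p t =>
  induction t with
  | zero => simp
  | add x y hx hy => simp only [map_add, tmul_add, tensor_add_mul, LinearMap.add_apply, hx, hy]
  | tmul q r => simp [h.K_mul]

theorem IsRep.lift_one (h : IsRep B K w) (m : M) : lift K w (B.one ⊗ₜ 1) m = m := by
  rw [lift_tmul, h.w_one, h.K_one]

variable (B)

theorem mulMap_tmul_one (y z : Y) :
    mulMap B (y ⊗ₜ 1) (z ⊗ₜ 1) = contract B y z 1 ↑Q.Φ⁻¹ := by
  rw [mulMap_tmul, map_one, map_one, mul_one]

theorem mulMap_one_tmul (h : H) (y : Y) (g : H) : mulMap B (B.one ⊗ₜ h) (y ⊗ₜ g) =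
    tensorOp B.act.toLinearMap (LinearMap.mul k H) (Q.Δ h) (y ⊗ₜ g) := by
  have aux (t : H ⊗[k] (H ⊗[k] H)) : contract B B.one y g t =
      tensorOp B.act.toLinearMap (LinearMap.mul k H) (dropLeft (H ⊗[k] H) Q.ε t) (y ⊗ₜ g) := by
    induction t with
    | zero => simp
    | add x y hx hy => simp only [map_add, LinearMap.add_apply, hx, hy]
    | tmul p t =>
    induction t with
    | zero => simp
    | add x y hx hy => simp only [map_add, LinearMap.add_apply, tmul_add, hx, hy]
    | tmul q r => simp [B.act_one, B.one_mul, smul_tmul']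
  rw [mulMap_tmul, aux, map_mul, map_inv_eq_one _ _ Q.normalized_left, one_mul]
  simp

theorem mulMap_tmul_one_tmul (y : Y) (h : H) : mulMap B (y ⊗ₜ 1) (B.one ⊗ₜ h) = y ⊗ₜ h := by
  have aux (t : H ⊗[k] (H ⊗[k] H)) : contract B y B.one h t =
      tensorOp B.act.toLinearMap (LinearMap.mul k H) (onRight H (dropLeft H Q.ε) t)
        (y ⊗ₜ h) := by
    induction t with
    | zero => simp
    | add x y hx hy => simp only [map_add, LinearMap.add_apply, hx, hy]
    | tmul p t =>
    induction t with
    | zero => simp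
    | add x y hx hy => simp only [map_add, LinearMap.add_apply, tmul_add, hx, hy]
    | tmul q r => simp [B.act_one, B.mul_one, smul_tmul']
  rw [mulMap_tmul, map_one, map_one, mul_one, aux, map_inv_eq_one _ _ Q.normalized,
    Algebra.TensorProduct.one_def]
  simp

theorem mulMap_one_tmul_one (g h : H) :
    mulMap B (B.one ⊗ₜ g) (B.one ⊗ₜ h) = B.one ⊗ₜ (g * h) := by
  rw [mulMap_one_tmul]
  have aux (t : H ⊗[k] H) : tensorOp B.act.toLinearMap (LinearMap.mul k H) t (B.one ⊗ₜ h) =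
      B.one ⊗ₜ (dropLeft H Q.ε t * h) := by
    induction t with
    | zero => simp
    | add x y hx hy => simp only [map_add, LinearMap.add_apply, add_mul, tmul_add, hx, hy]
    | tmul q r => simp [B.act_one, smul_tmul']
  rw [aux, Q.counit_left]

section OfAction

variable {B} {ω : Y ⊗[k] H →ₗ[k] Module.End k M}

/-- The map `h ↦ ω (1 # h)`. -/
def actRight (B : LeftModuleAlgebra Q Y) (ω : Y ⊗[k] H →ₗ[k] Module.End k M) :
    H →ₗ[k] Module.End k M := ω ∘ₗ TensorProduct.mk k Y H B.one

/-- The map `y ↦ ω (y # 1)`. -/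
def actLeft (ω : Y ⊗[k] H →ₗ[k] Module.End k M) :
    Y →ₗ[k] Module.End k M := ω ∘ₗ (TensorProduct.mk k Y H).flip 1

/-- Because `y # h = (y # 1)(1 # h)`, an action is determined by its restrictions to the two
factors. -/
theorem lift_actRight_actLeft (hω : ∀ s t m, ω (mulMap B s t) m = ω t (ω s m)) :
    lift (actRight B ω) (actLeft ω) = ω := by
  ext y h m
  have := hω (y ⊗ₜ 1) (B.one ⊗ₜ h) m
  rw [mulMap_tmul_one_tmul] at this
  exact this.symm

theorem isRep_of_action (hω : ∀ s t m, ω (mulMap B s t) m = ω t (ω s m))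
    (h1 : ∀ m, ω (B.one ⊗ₜ 1) m = m) : IsRep B (actRight B ω) (actLeft ω) where
  K_one := h1
  K_mul g h m := by
    have := hω (B.one ⊗ₜ g) (B.one ⊗ₜ h) m
    rwa [mulMap_one_tmul_one] at this
  w_one := h1
  w_K y h m := by
    rw [lift_actRight_actLeft hω, ← mulMap_one_tmul]
    exact (hω _ _ _).symm
  w_w y z m := by
    rw [lift_actRight_actLeft hω, ← mulMap_tmul_one]
    exact (hω _ _ _).symm

end OfAction

end SmashProduct

end SmashRepresentations

namespace BiAction

open QuasiHopfAlgebra RightComoduleAlgebra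

/-! ### Evaluating twisted coactions against functionals -/

section Evaluation

variable {k H A M N : Type*} [Field k] [Ring H] [Algebra k H] [Ring A] [Algebra k A]
  [AddCommGroup M] [Module k M] [AddCommGroup N] [Module k N]

variable (M) in
/-- The evaluation `id ⊗ φ`. -/
def ev (φ : Module.Dual k H) : M ⊗[k] H →ₗ[k] M :=
  (TensorProduct.rid k M).toLinearMap ∘ₗ LinearMap.lTensor M φ

@[simp]
theorem ev_tmul (φ : Module.Dual k H) (m : M) (h : H) : ev M φ (m ⊗ₜ h) = φ h • m := rfl

/-- A finite basis of `H` and its coordinate functionals recover a tensor from its evaluations. -/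
theorem eq_of_ev [FiniteDimensional k H] {v w : M ⊗[k] H} (h : ∀ φ, ev M φ v = ev M φ w) :
    v = w := by
  let b := Module.finBasis k H
  have key (v : M ⊗[k] H) : ∑ i, ev M (b.coord i) v ⊗ₜ b i = v := by
    induction v with
    | zero => simp
    | add y z hy hz =>
      simp only [map_add, add_tmul, Finset.sum_add_distrib]
      rw [hy, hz]
    | tmul m g =>
      conv_rhs => rw [← b.sum_repr g, tmul_sum]
      simp [smul_tmul']
  rw [← key v, ← key w]
  simp only [h]

theorem ev_rTensor (φ : Module.Dual k H) (f : M →ₗ[k] N) (v : M ⊗[k] H) :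
    ev N φ (LinearMap.rTensor H f v) = f (ev M φ v) := by
  induction v with
  | zero => simp
  | add y z hy hz => simp only [map_add, hy, hz]
  | tmul m g => simp

variable (Q : QuasiHopfAlgebra k H)

variable (M) in
/-- The evaluation of `φ ∘ S⁻¹`. -/
def evS : Module.Dual k H →ₗ[k] M ⊗[k] H →ₗ[k] M where
  toFun φ := ev M (φ ∘ₗ Q.Si)
  map_add' φ ψ := by ext; simp [add_smul]
  map_smul' c φ := by ext; simp [smul_smul]

@[simp]
theorem evS_tmul (φ : Module.Dual k H) (m : M) (h : H) : evS M Q φ (m ⊗ₜ h) = φ (Q.Si h) • m := rfl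

theorem evS_tmul_Sl (φ : Module.Dual k H) (m : M) (h : H) :
    evS M Q φ (m ⊗ₜ Q.Sl h) = φ h • m := by
  rw [evS_tmul, Q.Si_Sl]

variable {Q} in
theorem eq_of_evS [FiniteDimensional k H] {v w : M ⊗[k] H} (h : ∀ φ, evS M Q φ v = evS M Q φ w) :
    v = w := by
  refine eq_of_ev fun φ ↦ ?_
  have e : φ = (φ ∘ₗ Q.Sl) ∘ₗ Q.Si := by ext x; simp [Q.Sl_Si]
  rw [e]
  exact h _

variable (M) in
/-- The evaluation `m ⊗ (x ⊗ y) ↦ φ(S⁻¹(y)) ψ(S⁻¹(x)) m`. -/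
def evS₂ (φ ψ : Module.Dual k H) : M ⊗[k] (H ⊗[k] H) →ₗ[k] M :=
  evS M Q ψ ∘ₗ evS (M ⊗[k] H) Q φ ∘ₗ (TensorProduct.assoc k M H H).symm.toLinearMap

@[simp]
theorem evS₂_tmul (φ ψ : Module.Dual k H) (m : M) (x y : H) :
    evS₂ M Q φ ψ (m ⊗ₜ (x ⊗ₜ y)) = φ (Q.Si y) • ψ (Q.Si x) • m := by
  simp [evS₂]

variable {Q} in
theorem eq_of_evS₂ [FiniteDimensional k H] {v w : M ⊗[k] (H ⊗[k] H)}
    (h : ∀ φ ψ, evS₂ M Q φ ψ v = evS₂ M Q φ ψ w) : v = w :=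
  (TensorProduct.assoc k M H H).symm.injective <|
    eq_of_evS fun φ ↦ eq_of_evS fun ψ ↦ h φ ψ

theorem evS_evS (φ ψ : Module.Dual k H) (V : M →ₗ[k] M ⊗[k] H) (v : M ⊗[k] H) :
    evS M Q ψ (V (evS M Q φ v)) = evS₂ M Q φ ψ (up H V v) := by
  induction v with
  | zero => simp
  | add y z hy hz => simp only [map_add, hy, hz]
  | tmul m g => simp [up_tmul, evS₂]

theorem evS_counit (v : M ⊗[k] H) : evS M Q Q.ε.toLinearMap v = drop M Q.ε v := by
  induction v with
  | zero => simp
  | add y z hy hz => simp only [map_add, hy, hz]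
  | tmul m g => simp [Q.counit_Si]

variable (X : BiAction k H A M) (R : RightComoduleAlgebra Q.toQuasiBialgebra A)

theorem evS_rop_slot₁ (φ : Module.Dual k H) (a : A) (v : M ⊗[k] H) :
    evS M Q φ (X.rop (slot₁ k A H a) v) = X.R a (evS M Q φ v) := by
  induction v with
  | zero => simp
  | add y z hy hz => simp only [map_add, hy, hz]
  | tmul m g => simp [inl_apply]

/-- Writing the tensor factor as `S(g)`, the product `S(g) S(h) = S(hg)` is evaluated to `φ(hg)`.
This is why functionals are precomposed with `S⁻¹`. -/
theorem evS_rop_slot₂ (φ : Module.Dual k H) (h : H) (v : M ⊗[k] H) :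
    evS M Q φ (X.rop (slot₂ k A H (Q.Sl h)) v) = evS M Q (dualRight k H h φ) v := by
  induction v with
  | zero => simp
  | add y z hy hz => simp only [map_add, hy, hz]
  | tmul m g =>
    obtain ⟨g, rfl⟩ : ∃ g', Q.Sl g' = g := ⟨_, Q.Sl_Si g⟩
    rw [inr_apply, LinearMap.id_apply, rop_tmul, ← Q.isAntiLeg_Sl.multiplicative, evS_tmul_Sl,
      evS_tmul_Sl, X.R_one, dualRight_apply]

/-- The action of `A ⊗ H*` that is given by a twisted coaction. -/
def base (V : M →ₗ[k] M ⊗[k] H) : A ⊗[k] Module.Dual k H →ₗ[k] Module.End k M :=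
  TensorProduct.lift <| LinearMap.mk₂ k (fun (a : A) (φ : Module.Dual k H) ↦ evS M Q φ ∘ₗ V ∘ₗ X.R a)
    (by intros; ext; simp) (by intros; ext; simp) (by intros; ext; simp) (by intros; ext; simp)

@[simp]
theorem base_tmul (V : M →ₗ[k] M ⊗[k] H) (a : A) (φ : Module.Dual k H) (m : M) :
    X.base Q V (a ⊗ₜ φ) m = evS M Q φ (V (X.R a m)) := rfl

variable {Q}

/-- The factor `S(h₁)` acts on the functional as `h₁ ⇀ φ`, and `S(h₂)` acts on `M`, which is the
right action of `h₂`. -/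
theorem evS_lop_antiS (φ : Module.Dual k H) (h : H) (V : M →ₗ[k] M ⊗[k] H) (a : A) (m : M) :
    evS M Q φ (X.lop (Q.antiS (slot₁ k H H) (slot₂ k H H) h) (V (X.R a m))) =
      SmashProduct.lift (X.L.toLinearMap ∘ₗ Q.Sl) (X.base Q V)
        (tensorOp R.quasiSmashAct.toLinearMap (LinearMap.mul k H) (Q.Δ h)
          ((a ⊗ₜ φ) ⊗ₜ 1)) m := by
  rw [antiS, join_apply]
  induction Q.Δ h with
  | zero => simp
  | add y z hy hz => simp only [map_add, LinearMap.add_apply, hy, hz]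
  | tmul x y =>
  have e : SmashProduct.lift (X.L.toLinearMap ∘ₗ Q.Sl) (X.base Q V)
        (tensorOp R.quasiSmashAct.toLinearMap (LinearMap.mul k H) (x ⊗ₜ y)
          ((a ⊗ₜ φ) ⊗ₜ 1)) m = X.L (Q.Sl y) (evS M Q (dualLeft k H x φ) (V (X.R a m))) := by
    simp
  rw [e]
  generalize V (X.R a m) = v
  have e' : leg (slot₂ k H H ∘ₗ Q.Sl) (slot₁ k H H ∘ₗ Q.Sl) (x ⊗ₜ y) = Q.Sl y ⊗ₜ Q.Sl x := by
    simp [inl_apply, inr_apply]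
  rw [e']
  induction v with
  | zero => simp
  | add y z hy hz => simp only [map_add, hy, hz]
  | tmul m g =>
    obtain ⟨g, rfl⟩ : ∃ g', Q.Sl g' = g := ⟨_, Q.Sl_Si g⟩
    rw [lop_tmul, ← Q.isAntiLeg_Sl.multiplicative, evS_tmul_Sl, evS_tmul_Sl, dualLeft_apply,
      map_smul]

theorem evS_slide (φ : Module.Dual k H) (V : M →ₗ[k] M ⊗[k] H) (t : A ⊗[k] H) (m : M) :
    evS M Q φ (X.slide V (LinearMap.lTensor A Q.Sl t) m) =
      X.base Q V (LinearMap.lTensor A ((dualRight k H).flip φ) t) m := by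
  induction t with
  | zero => simp
  | add y z hy hz => simp only [map_add, LinearMap.add_apply, hy, hz]
  | tmul a h =>
    rw [LinearMap.lTensor_tmul, slide_tmul, evS_rop_slot₂]
    rfl

/-- The terms match one for one: `Φ⁻¹` gives `x¹ ⇀ φ`, `x² ⇀ ψ` and the action of `x³`; `Φρ⁻¹` gives
the right actions on functionals; and the twisted comultiplication gives the convolution. -/
theorem evS₂_twistedIterate (φ ψ : Module.Dual k H) (V : M →ₗ[k] M ⊗[k] H) (m : M) :
    evS₂ M Q φ ψ (twistedIterate X Q R V m) =
      SmashProduct.lift (X.L.toLinearMap ∘ₗ Q.Sl) (X.base Q V)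
        (SmashProduct.contract R.quasiSmash (1 ⊗ₜ φ) (1 ⊗ₜ ψ) 1 ↑Q.Φ⁻¹) m := by
  rw [twistedIterate, LinearMap.comp_apply, conjPhiInv, phiInv]
  induction (↑Q.Φ⁻¹ : H ⊗[k] (H ⊗[k] H)) with
  | zero => simp
  | add y z hy hz => simp only [map_add, LinearMap.add_apply, hy, hz]
  | tmul x t =>
  induction t with
  | zero => simp
  | add y z hy hz => simp only [map_add, tmul_add, LinearMap.add_apply, hy, hz]
  | tmul y z =>
  have e : SmashProduct.contract R.quasiSmash (1 ⊗ₜ φ) (1 ⊗ₜ ψ) 1 (x ⊗ₜ (y ⊗ₜ z)) =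
      R.spread 1 (dualLeft k H x φ ⊗ₜ dualLeft k H y ψ) ↑R.Φρ⁻¹ ⊗ₜ z := by
    rw [SmashProduct.contract_tmul, mul_one]
    change R.quasiSmashMul (1 ⊗ₜ dualLeft k H x φ) (1 ⊗ₜ dualLeft k H y ψ) ⊗ₜ z = _
    rw [quasiSmashMul_tmul, map_one, map_one, one_mul]
  rw [e, SmashProduct.lift_tmul, antiS₃_tmul]
  induction (↑R.Φρ⁻¹ : A ⊗[k] (H ⊗[k] H)) with
  | zero => simp
  | add y z hy hz => simp only [map_add, LinearMap.add_apply, hy, hz]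
  | tmul u t =>
  induction t with
  | zero => simp
  | add y z hy hz => simp only [map_add, tmul_add, LinearMap.add_apply, hy, hz]
  | tmul p q =>
  have e' : act 1 (leg (rt (slot₁ k A (H ⊗[k] H))) (leg (lt (last k A H ∘ₗ Q.Sl))
      (lt (mid k A H ∘ₗ Q.Sl))) (u ⊗ₜ (p ⊗ₜ q))) = u ⊗ₜ[k] (Q.Sl q ⊗ₜ[k] Q.Sl p) := by
    simp [inl_apply, inr_apply]
  rw [e', spread_tmul, one_mul, slide_tmul, base_tmul, LinearMap.comp_apply]
  generalize V (X.R u m) = v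
  induction v with
  | zero => simp
  | add y z hy hz => simp only [map_add, hy, hz]
  | tmul m g =>
  -- On `S(g)` the twisted comultiplication is `∑ S(g₂) ⊗ S(g₁)`, so evaluation in reversed order
  -- produces `φ(g₁) ψ(g₂)`.
  obtain ⟨g, rfl⟩ : ∃ g', Q.Sl g' = g := ⟨_, Q.Sl_Si g⟩
  rw [LinearMap.lTensor_tmul, twistedComul_Sl, evS_tmul_Sl, convolution_apply, antiS, join_apply]
  induction Q.Δ g with
  | zero => simp
  | add y z hy hz => simp only [map_add, tmul_add, add_smul, hy, hz]
  | tmul c d =>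
  have e'' : leg (slot₂ k H H ∘ₗ Q.Sl) (slot₁ k H H ∘ₗ Q.Sl) (c ⊗ₜ d) = Q.Sl d ⊗ₜ Q.Sl c := by
    simp [inl_apply, inr_apply]
  rw [e'', inr_apply, LinearMap.id_apply, rop_tmul, lop_tmul]
  simp only [Algebra.TensorProduct.tmul_mul_tmul, ← Q.isAntiLeg_Sl.multiplicative, evS₂_tmul,
    Q.Si_Sl, X.R_one, dualDistrib_apply, dualRight_apply, dualLeft_apply, map_smul, smul_smul,
    LinearMap.comp_apply, AlgHom.toLinearMap_apply, mul_assoc]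

end Evaluation

end BiAction

/-! ### Invariant elements of a module algebra -/

section Invariants

variable {k H Y A M : Type*} [Field k] [Ring H] [Algebra k H] {Q : QuasiBialgebra k H}
  [AddCommGroup Y] [Module k Y] [AddCommGroup M] [Module k M] [Ring A] [Algebra k A]

/-- Elements on which `H` acts through `ε`. -/
def LeftModuleAlgebra.IsInvariant (B : LeftModuleAlgebra Q Y) (y : Y) : Prop :=
  ∀ h, B.act h y = Q.ε h • y

namespace SmashProduct

variable {B : LeftModuleAlgebra Q Y} {K : H →ₗ[k] Module.End k M} {w : Y →ₗ[k] Module.End k M}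

/-- On an invariant element one leg of `Φ⁻¹` is replaced by `ε`, and the normalization makes the
reassociator disappear. -/
theorem contract_invariant_left {y : Y} (hy : B.IsInvariant y) (z : Y) (g : H) :
    contract B y z g ↑Q.Φ⁻¹ = B.mul y z ⊗ₜ g := by
  have aux (t : H ⊗[k] (H ⊗[k] H)) : contract B y z g t = LinearMap.rTensor H (B.mul y)
      (tensorOp B.act.toLinearMap (LinearMap.mul k H) (dropLeft (H ⊗[k] H) Q.ε t) (z ⊗ₜ g)) := by
    induction t with
    | zero => simp
    | add x y hx hy => simp only [map_add, LinearMap.add_apply, hx, hy]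
    | tmul p t =>
    induction t with
    | zero => simp
    | add x y hx hy => simp only [map_add, LinearMap.add_apply, tmul_add, hx, hy]
    | tmul q r => simp [hy p, smul_tmul']
  rw [aux, map_inv_eq_one _ _ Q.normalized_left, Algebra.TensorProduct.one_def]
  simp

theorem contract_invariant_right (y : Y) {z : Y} (hz : B.IsInvariant z) (g : H) :
    contract B y z g ↑Q.Φ⁻¹ = B.mul y z ⊗ₜ g := by
  have aux (t : H ⊗[k] (H ⊗[k] H)) : contract B y z g t = LinearMap.rTensor H (B.mul.flip z)
      (tensorOp B.act.toLinearMap (LinearMap.mul k H) (onRight H (dropLeft H Q.ε) t)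
        (y ⊗ₜ g)) := by
    induction t with
    | zero => simp
    | add x y hx hy => simp only [map_add, LinearMap.add_apply, hx, hy]
    | tmul p t =>
    induction t with
    | zero => simp
    | add x y hx hy => simp only [map_add, LinearMap.add_apply, tmul_add, hx, hy]
    | tmul q r => simp [hz q, smul_tmul']
  rw [aux, map_inv_eq_one _ _ Q.normalized, Algebra.TensorProduct.one_def]
  simp

theorem IsRep.w_mul_left (h : IsRep B K w) {y : Y} (hy : B.IsInvariant y) (z : Y) (m : M) :
    w z (w y m) = w (B.mul y z) m := by
  rw [h.w_w, contract_invariant_left hy, lift_tmul, h.K_one]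

theorem IsRep.w_mul_right (h : IsRep B K w) (y : Y) {z : Y} (hz : B.IsInvariant z) (m : M) :
    w z (w y m) = w (B.mul y z) m := by
  rw [h.w_w, contract_invariant_right y hz, lift_tmul, h.K_one]

theorem IsRep.w_K_invariant (h : IsRep B K w) {y : Y} (hy : B.IsInvariant y) (g : H) (m : M) :
    w y (K g m) = K g (w y m) := by
  have aux (t : H ⊗[k] H) : tensorOp B.act.toLinearMap (LinearMap.mul k H) t (y ⊗ₜ 1) =
      y ⊗ₜ dropLeft H Q.ε t := by
    induction t with
    | zero => simp
    | add x y hx hy => simp only [map_add, LinearMap.add_apply, tmul_add, hx, hy]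
    | tmul q r => simp [hy q, smul_tmul']
  rw [h.w_K, aux, Q.counit_left, lift_tmul]

end SmashProduct

namespace RightComoduleAlgebra

variable (R : RightComoduleAlgebra Q A)

/-- Hence the elements `a # ε` multiply without reassociators and commute with `H`, so they supply
the right `A`-action of a two-sided Hopf module. -/
theorem isInvariant_tmul_counit (a : A) :
    R.quasiSmash.IsInvariant (a ⊗ₜ Q.ε.toLinearMap) := fun h ↦ by
  change a ⊗ₜ dualLeft k H h Q.ε.toLinearMap = _
  rw [dualLeft_counit, tmul_smul]

theorem tmul_counit_mul (a b : A) (φ : Module.Dual k H) :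
    R.quasiSmash.mul (a ⊗ₜ Q.ε.toLinearMap) (b ⊗ₜ φ) = (a * b) ⊗ₜ φ := by
  change R.quasiSmashMul _ _ = _
  rw [quasiSmashMul_tmul, spread_counit_left, map_mul (onRight A (dropLeft H Q.ε)),
    map_inv_eq_one _ _ R.normalized_middle, mul_one, drop_extend, R.counit, tensorOp_tmul]
  congr 1
  ext; simp

theorem mul_tmul_counit (a : A) (φ : Module.Dual k H) :
    R.quasiSmash.mul (1 ⊗ₜ φ) (a ⊗ₜ Q.ε.toLinearMap) =
      LinearMap.lTensor A ((dualRight k H).flip φ) (R.ρ a) := by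
  change R.quasiSmashMul _ _ = _
  rw [quasiSmashMul_tmul, spread_counit_right, map_mul (onRight A (dropRight H Q.ε)),
    map_inv_eq_one _ _ R.normalized_right, mul_one]
  induction R.ρ a with
  | zero => simp
  | add x y hx hy => simp only [map_add, LinearMap.add_apply, hx, hy]
  | tmul b h => simp

end RightComoduleAlgebra

end Invariants

namespace BiAction

open QuasiHopfAlgebra RightComoduleAlgebra SmashProduct

/-! ### Twisted coactions are representations of the smash product -/

section Equivalence

variable {k H A M : Type*} [Field k] [Ring H] [Algebra k H] [Ring A] [Algebra k A]
  [AddCommGroup M] [Module k M] {X : BiAction k H A M} {Q : QuasiHopfAlgebra k H}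
  {R : RightComoduleAlgebra Q.toQuasiBialgebra A} {V : M →ₗ[k] M ⊗[k] H}

theorem base_spread (a : A) (φ ψ : Module.Dual k H) (t : A ⊗[k] H) (m : M) :
    X.base Q V (R.quasiSmash.mul (LinearMap.lTensor A ((dualRight k H).flip φ) t) (1 ⊗ₜ ψ))
      (X.R a m) = X.base Q V (R.spread a (φ ⊗ₜ ψ) (R.extend t * ↑R.Φρ⁻¹)) m := by
  induction t with
  | zero => simp
  | add y z hy hz => simp only [map_add, LinearMap.add_apply, tensor_add_mul, hy, hz]
  | tmul b h =>
  change X.base Q V (R.quasiSmashMul (b ⊗ₜ dualRight k H h φ) (1 ⊗ₜ ψ)) _ = _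
  rw [quasiSmashMul_tmul, map_one, map_one, one_mul, extend_tmul]
  induction (↑R.Φρ⁻¹ : A ⊗[k] (H ⊗[k] H)) with
  | zero => simp
  | add y z hy hz => simp only [map_add, LinearMap.add_apply, tensor_mul_add, hy, hz]
  | tmul u t =>
  induction t with
  | zero => simp
  | add y z hy hz => simp only [map_add, tmul_add, LinearMap.add_apply, tensor_mul_add, hy, hz]
  | tmul p q => simp [dualRight_dualRight, X.R_mul]

/-- The first factor `a` merely acts on `m`, while `b` enters the product only through `ρ(b)` acting
on `φ`. This reduces products of general elements to those with second factor `1 # ψ`. -/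
theorem lift_contract (a b : A) (φ ψ : Module.Dual k H) (T : H ⊗[k] (H ⊗[k] H)) (m : M) :
    SmashProduct.lift (X.L.toLinearMap ∘ₗ Q.Sl) (X.base Q V) (contract R.quasiSmash
      (LinearMap.lTensor A ((dualRight k H).flip φ) (R.ρ b)) (1 ⊗ₜ ψ) 1 T) (X.R a m) =
    SmashProduct.lift (X.L.toLinearMap ∘ₗ Q.Sl) (X.base Q V)
      (contract R.quasiSmash (a ⊗ₜ φ) (b ⊗ₜ ψ) 1 T) m := by
  induction T with
  | zero => simp
  | add y z hy hz => simp only [map_add, LinearMap.add_apply, hy, hz]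
  | tmul x t =>
  induction t with
  | zero => simp
  | add y z hy hz => simp only [map_add, tmul_add, LinearMap.add_apply, hy, hz]
  | tmul y z =>
  have e : R.quasiSmash.act x (LinearMap.lTensor A ((dualRight k H).flip φ) (R.ρ b)) =
      LinearMap.lTensor A ((dualRight k H).flip (dualLeft k H x φ)) (R.ρ b) := by
    induction R.ρ b with
    | zero => simp
    | add y z hy hz => simp only [map_add, hy, hz]
    | tmul c h =>
      change R.quasiSmashAct x (c ⊗ₜ dualRight k H h φ) = c ⊗ₜ dualRight k H h (dualLeft k H x φ)
      rw [quasiSmashAct_tmul, dualRight_dualLeft]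
  rw [contract_tmul, contract_tmul, e, lift_tmul, lift_tmul]
  exact congrArg _ (base_spread _ _ _ _ _)

theorem IsTwistedCoaction.base_base (h : X.IsTwistedCoaction Q R V) (y : A ⊗[k] Module.Dual k H)
    (ψ : Module.Dual k H) (m : M) : evS M Q ψ (V (X.base Q V y m)) =
      SmashProduct.lift (X.L.toLinearMap ∘ₗ Q.Sl) (X.base Q V)
        (contract R.quasiSmash y (1 ⊗ₜ ψ) 1 ↑Q.Φ⁻¹) m := by
  induction y with
  | zero => simp [contract]
  | add y z hy hz =>
    simp only [map_add, LinearMap.add_apply, hy, hz]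
    simp [contract, add_tmul]
  | tmul a φ =>
    rw [← lift_contract, map_one, Algebra.TensorProduct.one_def, base_tmul, evS_evS, h.coassoc,
      evS₂_twistedIterate]
    congr 4
    rw [LinearMap.lTensor_tmul]
    congr 1
    ext; simp

theorem IsTwistedCoaction.isRep (h : X.IsTwistedCoaction Q R V) :
    IsRep R.quasiSmash (X.L.toLinearMap ∘ₗ Q.Sl) (X.base Q V) where
  K_one m := by
    rw [LinearMap.comp_apply, Q.isAntiLeg_Sl.unital]
    simp
  K_mul g g' m := by
    rw [LinearMap.comp_apply, Q.isAntiLeg_Sl.multiplicative]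
    simp
  w_one m := by
    change X.base Q V (1 ⊗ₜ Q.ε.toLinearMap) m = m
    rw [base_tmul, evS_counit, h.counit, X.R_one]
  w_K y g m := by
    induction y with
    | zero => simp
    | add y z hy hz => simp only [map_add, LinearMap.add_apply, add_tmul, hy, hz]
    | tmul a φ =>
      rw [base_tmul, LinearMap.comp_apply, AlgHom.toLinearMap_apply, X.comm, h.lact,
        evS_lop_antiS X R]
      rfl
  w_w y z m := by
    induction y with
    | zero => simp [contract]
    | add y z hy hz => 
      simp only [map_add, LinearMap.add_apply, hy, hz]
      simp [contract, add_tmul]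
    | tmul a φ =>
    induction z with
    | zero => simp [contract]
    | add y z hy hz => 
      simp only [map_add, LinearMap.add_apply, hy, hz]
      simp [contract, add_tmul, tmul_add]
    | tmul b ψ =>
    -- The action of `b` is pulled through the first evaluation as right multiplication by `b ⊗ 1`;
    -- the twisted relation and `evS_slide` turn it into the action of `ρ(b)` on `φ`.
    rw [base_tmul, base_tmul, ← evS_rop_slot₁, h.ract, act_one_conjRight, evS_slide]
    exact (h.base_base _ _ _).trans (lift_contract _ _ _ _ _ _)

variable [FiniteDimensional k H]

/-- Each axiom is tested against functionals, where it becomes a relation of the smash product: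
`w_K` on `1 # φ`, the product of `1 # φ` with the invariant `a # ε`, and `w_w` on `1 # φ` and `1 #
ψ`. -/
theorem isTwistedCoaction_of_isRep
    (h : IsRep R.quasiSmash (X.L.toLinearMap ∘ₗ Q.Sl) (X.base Q V)) :
    X.IsTwistedCoaction Q R V := by
  have counit (m : M) : drop M Q.ε (V m) = m := by
    have := h.w_one m
    change X.base Q V (1 ⊗ₜ Q.ε.toLinearMap) m = m at this
    rwa [base_tmul, evS_counit, X.R_one] at this
  refine ⟨counit, fun g m ↦ eq_of_evS (Q := Q) fun φ ↦ ?_, fun a m ↦ eq_of_evS (Q := Q) fun φ ↦ ?_, fun m ↦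
    eq_of_evS₂ (Q := Q) fun φ ψ ↦ ?_⟩
  · have e := h.w_K (1 ⊗ₜ φ) g m
    rw [base_tmul, X.R_one] at e
    have e' := evS_lop_antiS X R φ g V 1 m
    rw [X.R_one] at e'
    rw [e']
    exact e
  · rw [evS_rop_slot₁, act_one_conjRight, evS_slide, ← mul_tmul_counit,
      ← h.w_mul_right _ (R.isInvariant_tmul_counit a), base_tmul, base_tmul, evS_counit, counit,
      X.R_one]
  · rw [evS₂_twistedIterate, ← evS_evS]
    have e := h.w_w (1 ⊗ₜ φ) (1 ⊗ₜ ψ) m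
    rwa [base_tmul, base_tmul, X.R_one, X.R_one] at e

end Equivalence

end BiAction

namespace BiAction

open QuasiHopfAlgebra RightComoduleAlgebra SmashProduct

/-! ### Two-sided Hopf modules from representations -/

section OfRep

variable {k H A M : Type*} [Field k] [Ring H] [Algebra k H] [Ring A] [Algebra k A]
  [AddCommGroup M] [Module k M] {Q : QuasiHopfAlgebra k H}
  {R : RightComoduleAlgebra Q.toQuasiBialgebra A}
  {K : H →ₗ[k] Module.End k M} {w : A ⊗[k] Module.Dual k H →ₗ[k] Module.End k M}

/-- From `(a # ε)(1 # φ) = a # φ`: the whole action is determined by `A` and the operators of `1 #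
φ`. -/
theorem w_tmul (h : IsRep R.quasiSmash K w) (a : A) (φ : Module.Dual k H) (m : M) :
    w (1 ⊗ₜ φ) (w (a ⊗ₜ Q.ε.toLinearMap) m) = w (a ⊗ₜ φ) m := by
  rw [h.w_mul_left (R.isInvariant_tmul_counit a), tmul_counit_mul, mul_one]

/-- The two actions given by a right action of the smash product. -/
def ofRep (h : IsRep R.quasiSmash K w) : BiAction k H A M where
  L := AlgHom.ofLinearMap (K ∘ₗ Q.Si)
    (by
      ext m
      have e : Q.Si 1 = 1 := by rw [← Q.isAntiLeg_Sl.unital, Q.Si_Sl, Q.isAntiLeg_Sl.unital]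
      rw [LinearMap.comp_apply, e, h.K_one, Module.End.one_apply])
    (fun x y ↦ by
      ext m
      have e : Q.Si (x * y) = Q.Si y * Q.Si x := by
        rw [← Q.Si_Sl (Q.Si y * Q.Si x), Q.isAntiLeg_Sl.multiplicative, Q.Sl_Si, Q.Sl_Si]
      rw [LinearMap.comp_apply, e, h.K_mul, Module.End.mul_apply]
      rfl)
  R := w ∘ₗ (TensorProduct.mk k A (Module.Dual k H)).flip Q.ε.toLinearMap
  R_one m := h.w_one m
  R_mul a b m := by
    simp only [LinearMap.comp_apply, LinearMap.flip_apply, TensorProduct.mk_apply]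
    rw [h.w_mul_left (R.isInvariant_tmul_counit a), tmul_counit_mul]
  comm g a m := h.w_K_invariant (R.isInvariant_tmul_counit a) _ _

theorem ofRep_L (h : IsRep R.quasiSmash K w) (g : H) (m : M) :
    (ofRep h).L g m = K (Q.Si g) m := rfl

theorem ofRep_R (h : IsRep R.quasiSmash K w) (a : A) (m : M) :
    (ofRep h).R a m = w (a ⊗ₜ Q.ε.toLinearMap) m := rfl

theorem ofRep_comp_Sl (h : IsRep R.quasiSmash K w) :
    (ofRep h).L.toLinearMap ∘ₗ Q.Sl = K := by
  ext g m
  simp only [LinearMap.comp_apply, AlgHom.toLinearMap_apply]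
  rw [ofRep_L, Q.Si_Sl]

variable [FiniteDimensional k H]

/-- The twisted coaction given by a right action of the smash product. -/
def dualCoaction (Q : QuasiHopfAlgebra k H) (w : A ⊗[k] Module.Dual k H →ₗ[k] Module.End k M) :
    M →ₗ[k] M ⊗[k] H :=
  ∑ i, (TensorProduct.mk k M H).flip (Q.Sl (Module.finBasis k H i)) ∘ₗ
    w (1 ⊗ₜ (Module.finBasis k H).coord i)

theorem dualCoaction_apply (m : M) : dualCoaction Q w m =
    ∑ i, w (1 ⊗ₜ (Module.finBasis k H).coord i) m ⊗ₜ Q.Sl (Module.finBasis k H i) := by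
  simp [dualCoaction, LinearMap.sum_apply]

theorem evS_dualCoaction (φ : Module.Dual k H) (m : M) :
    evS M Q φ (dualCoaction Q w m) = w (1 ⊗ₜ φ) m := by
  have e : φ = ∑ i, φ (Module.finBasis k H i) • (Module.finBasis k H).coord i :=
    ((Module.finBasis k H).sum_dual_apply_smul_coord φ).symm
  conv_rhs => rw [e]
  rw [dualCoaction_apply, map_sum, tmul_sum, map_sum, LinearMap.sum_apply]
  refine Finset.sum_congr rfl fun i _ ↦ ?_
  rw [evS_tmul_Sl, tmul_smul, map_smul, LinearMap.smul_apply]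

theorem base_ofRep (h : IsRep R.quasiSmash K w) :
    (ofRep h).base Q (dualCoaction Q w) = w := by
  ext a φ m
  exact (evS_dualCoaction _ _).trans (w_tmul h _ _ _)

theorem isTwistedCoaction_ofRep (h : IsRep R.quasiSmash K w) :
    (ofRep h).IsTwistedCoaction Q R (dualCoaction Q w) :=
  isTwistedCoaction_of_isRep (by rwa [ofRep_comp_Sl, base_ofRep])

/-- The coaction given by a right action of the smash product. -/
def coactionOfRep (h : IsRep R.quasiSmash K w) : M →ₗ[k] M ⊗[k] H :=
  (ofRep h).toCoaction Q R (dualCoaction Q w)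

theorem isCoaction_ofRep (h : IsRep R.quasiSmash K w) :
    (ofRep h).IsCoaction Q R (coactionOfRep h) :=
  (isTwistedCoaction_ofRep h).toCoaction

theorem toTwisted_coactionOfRep (h : IsRep R.quasiSmash K w) :
    (ofRep h).toTwisted Q R (coactionOfRep h) = dualCoaction Q w :=
  toTwisted_toCoaction (isTwistedCoaction_ofRep h).ract

/-- The actions are recovered from `S⁻¹` and from counitality of the twisted coaction, and the
twisted coaction from its evaluations; `toCoaction_toTwisted` then gives back `D`. -/
theorem coactionOfRep_eq {X : BiAction k H A M} {D : M →ₗ[k] M ⊗[k] H}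
    (hD : X.IsCoaction Q R D)
    (h : IsRep R.quasiSmash (X.L.toLinearMap ∘ₗ Q.Sl) (X.base Q (X.toTwisted Q R D))) :
    ofRep h = X ∧ coactionOfRep h = D := by
  have e : ofRep h = X := by
    have hL : (ofRep h).L = X.L := by
      ext g m
      rw [ofRep_L, LinearMap.comp_apply, Q.Sl_Si]
      rfl
    have hR : (ofRep h).R = X.R := by
      ext a m
      rw [ofRep_R, base_tmul, evS_counit, toTwisted_counit hD.counit]
    generalize ofRep h = Y at hL hR
    cases X; cases Y; cases hL; cases hR; rfl
  have hV : dualCoaction Q (X.base Q (X.toTwisted Q R D)) = X.toTwisted Q R D := by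
    ext m
    refine eq_of_evS (Q := Q) fun φ ↦ ?_
    rw [evS_dualCoaction, base_tmul, X.R_one]
  refine ⟨e, ?_⟩
  rw [coactionOfRep, hV, e, toCoaction_toTwisted hD.ract]

end OfRep

/-! ### Naturality in the module -/

section Naturality

variable {k H A M N C : Type*} [Field k] [Ring H] [Algebra k H] [Ring A] [Algebra k A]
  [AddCommGroup M] [Module k M] [AddCommGroup N] [Module k N] [Ring C] [Algebra k C]
  {Q : QuasiHopfAlgebra k H} {R : RightComoduleAlgebra Q.toQuasiBialgebra A}
  {X : BiAction k H A M} {Y : BiAction k H A N} {f : M →ₗ[k] N}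

theorem rTensor_lop (hL : ∀ h m, f (X.L h m) = Y.L h (f m)) (t : H ⊗[k] C) (v : M ⊗[k] C) :
    LinearMap.rTensor C f (X.lop t v) = Y.lop t (LinearMap.rTensor C f v) := by
  induction v with
  | zero => simp
  | add y z hy hz => simp only [map_add, hy, hz]
  | tmul m d =>
  induction t with
  | zero => simp
  | add y z hy hz => simp only [map_add, LinearMap.add_apply, hy, hz]
  | tmul h c => simp [hL]

theorem rTensor_rop (hR : ∀ a m, f (X.R a m) = Y.R a (f m)) (t : A ⊗[k] C) (v : M ⊗[k] C) :
    LinearMap.rTensor C f (X.rop t v) = Y.rop t (LinearMap.rTensor C f v) := by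
  induction v with
  | zero => simp
  | add y z hy hz => simp only [map_add, hy, hz]
  | tmul m d =>
  induction t with
  | zero => simp
  | add y z hy hz => simp only [map_add, LinearMap.add_apply, hy, hz]
  | tmul h c => simp [hR]

theorem rTensor_toTwisted (hL : ∀ h m, f (X.L h m) = Y.L h (f m))
    (hR : ∀ a m, f (X.R a m) = Y.R a (f m)) {D : M →ₗ[k] M ⊗[k] H} {D' : N →ₗ[k] N ⊗[k] H}
    (hD : ∀ m, LinearMap.rTensor H f (D m) = D' (f m)) (m : M) :
    LinearMap.rTensor H f (X.toTwisted Q R D m) = Y.toTwisted Q R D' (f m) := by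
  simp only [toTwisted, LinearMap.comp_apply]
  rw [rTensor_lop hL, rTensor_rop hR, hD]

theorem rTensor_slide (hR : ∀ a m, f (X.R a m) = Y.R a (f m)) {T : M →ₗ[k] M ⊗[k] C}
    {T' : N →ₗ[k] N ⊗[k] C} (hT : ∀ m, LinearMap.rTensor C f (T m) = T' (f m)) (x : A ⊗[k] C)
    (m : M) : LinearMap.rTensor C f (X.slide T x m) = Y.slide T' x (f m) := by
  induction x with
  | zero => simp
  | add y z hy hz => simp only [map_add, LinearMap.add_apply, hy, hz]
  | tmul a c => rw [slide_tmul, slide_tmul, rTensor_rop hR, hT, hR]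

theorem map_base (hR : ∀ a m, f (X.R a m) = Y.R a (f m)) {V : M →ₗ[k] M ⊗[k] H}
    {V' : N →ₗ[k] N ⊗[k] H} (hV : ∀ m, LinearMap.rTensor H f (V m) = V' (f m))
    (y : A ⊗[k] Module.Dual k H) (m : M) : f (X.base Q V y m) = Y.base Q V' y (f m) := by
  induction y with
  | zero => simp
  | add y z hy hz => simp only [map_add, LinearMap.add_apply, hy, hz]
  | tmul a φ =>
    rw [base_tmul, base_tmul, ← hR, ← hV]
    exact (ev_rTensor _ _ _).symm

variable [FiniteDimensional k H] {K : H →ₗ[k] Module.End k M} {K' : H →ₗ[k] Module.End k N}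
  {w : A ⊗[k] Module.Dual k H →ₗ[k] Module.End k M}
  {w' : A ⊗[k] Module.Dual k H →ₗ[k] Module.End k N}

theorem rTensor_coactionOfRep (h : IsRep R.quasiSmash K w) (h' : IsRep R.quasiSmash K' w')
    (hK : ∀ g m, f (K g m) = K' g (f m)) (hw : ∀ y m, f (w y m) = w' y (f m)) (m : M) :
    LinearMap.rTensor H f (coactionOfRep h m) = coactionOfRep h' (f m) := by
  have hL (g : H) (m : M) : f ((ofRep h).L g m) = (ofRep h').L g (f m) := hK _ _
  have hR (a : A) (m : M) : f ((ofRep h).R a m) = (ofRep h').R a (f m) := hw _ _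
  simp only [coactionOfRep, toCoaction, LinearMap.comp_apply]
  rw [rTensor_lop hL, rTensor_slide hR fun m ↦ ?_]
  rw [dualCoaction_apply, dualCoaction_apply, map_sum]
  simp only [LinearMap.rTensor_tmul, hw]

end Naturality

end BiAction

namespace SmashProduct

/-! ### Representations as modules over the opposite of the smash product -/

section Modules

variable {k H Y M N : Type*} [Field k] [Ring H] [Algebra k H] {Q : QuasiBialgebra k H}
  [AddCommGroup Y] [Module k Y] [AddCommGroup M] [Module k M] {B : LeftModuleAlgebra Q Y}
  {K : H →ₗ[k] Module.End k M} {w : Y →ₗ[k] Module.End k M}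

/-- The right module over the smash product given by a representation. -/
abbrev IsRep.module (h : IsRep B K w) : Module (SmashProduct B)ᵐᵒᵖ M where
  smul x m := lift K w (unop x) m
  one_smul := h.lift_one
  mul_smul x y m := h.lift_mulMap (unop y) (unop x) m
  smul_zero x := map_zero (lift K w (unop x))
  smul_add x := map_add (lift K w (unop x))
  add_smul x y m := LinearMap.congr_fun (map_add (lift K w) (unop x) (unop y)) m
  zero_smul m := LinearMap.congr_fun (map_zero (lift K w)) m

/-- The scalar `c` is the element `c (1 # 1)`, and `1 # 1` acts as the identity; so restriction of
scalars returns the given vector space. -/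
theorem IsRep.compHom_module (h : IsRep B K w) :
    @Module.compHom (SmashProduct B)ᵐᵒᵖ k M _ _ h.module _ (algebraMap k _) =
      (inferInstance : Module k M) := by
  refine Module.ext ?_
  ext c m
  change lift K w (c • (B.one ⊗ₜ[k] (1 : H))) m = c • m
  rw [map_smul, LinearMap.smul_apply, h.lift_one]

/-- The right action of the smash product on a module, as a linear map. -/
def action [AddCommGroup N] [Module k N] [Module (SmashProduct B)ᵐᵒᵖ N]
    (hk : ∀ (c : k) (n : N), algebraMap k (SmashProduct B)ᵐᵒᵖ c • n = c • n) :
    Y ⊗[k] H →ₗ[k] Module.End k N where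
  toFun t :=
    { toFun := fun n ↦ op (α := SmashProduct B) t • n
      map_add' := smul_add _
      map_smul' := fun c n ↦ by
        rw [← hk, ← hk, RingHom.id_apply, smul_smul, smul_smul, Algebra.commutes] }
  map_add' s t := LinearMap.ext fun n ↦ add_smul (op (α := SmashProduct B) s) (op (α := SmashProduct B) t) n
  map_smul' c t := LinearMap.ext fun n ↦ by
    have e : op (α := SmashProduct B) (c • t) =
        algebraMap k (SmashProduct B)ᵐᵒᵖ c * op (α := SmashProduct B) t :=
      Algebra.smul_def c (op (α := SmashProduct B) t)
    exact (congrArg (· • n) e).trans ((mul_smul _ _ _).trans (hk _ _))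

variable [AddCommGroup N] [Module k N] [Module (SmashProduct B)ᵐᵒᵖ N]
  (hk : ∀ (c : k) (n : N), algebraMap k (SmashProduct B)ᵐᵒᵖ c • n = c • n)

theorem isRep_action : IsRep B (actRight B (action hk)) (actLeft (action hk)) :=
  isRep_of_action (fun s t n ↦ mul_smul (op (α := SmashProduct B) t) (op (α := SmashProduct B) s) n)
    fun n ↦ one_smul (SmashProduct B)ᵐᵒᵖ n

theorem isRep_action_module : (isRep_action hk).module = ‹Module (SmashProduct B)ᵐᵒᵖ N› := by
  refine Module.ext ?_
  ext x n
  change lift (actRight B (action hk)) (actLeft (action hk)) (unop x) n = x • n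
  rw [lift_actRight_actLeft fun s t n ↦ mul_smul (op (α := SmashProduct B) t) (op (α := SmashProduct B) s) n]
  rfl

theorem IsRep.actRight_action (h : IsRep B K w)
    (hk : letI := h.module; ∀ (c : k) (n : M), algebraMap k (SmashProduct B)ᵐᵒᵖ c • n = c • n) :
    letI := h.module
    actRight B (action hk) = K := by
  ext g m
  change lift K w (B.one ⊗ₜ[k] g) m = _
  rw [lift_tmul, h.w_one]

theorem IsRep.actLeft_action (h : IsRep B K w)
    (hk : letI := h.module; ∀ (c : k) (n : M), algebraMap k (SmashProduct B)ᵐᵒᵖ c • n = c • n) :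
    letI := h.module
    actLeft (action hk) = w := by
  ext y m
  change lift K w (y ⊗ₜ[k] (1 : H)) m = _
  rw [lift_tmul, h.K_one]

theorem map_lift {K : H →ₗ[k] Module.End k M} {w : Y →ₗ[k] Module.End k M}
    {K' : H →ₗ[k] Module.End k N} {w' : Y →ₗ[k] Module.End k N} {f : M →ₗ[k] N}
    (hK : ∀ g m, f (K g m) = K' g (f m)) (hw : ∀ y m, f (w y m) = w' y (f m)) (t : Y ⊗[k] H)
    (m : M) : f (lift K w t m) = lift K' w' t (f m) := by
  induction t with
  | zero => simp
  | add x y hx hy => simp only [map_add, LinearMap.add_apply, hx, hy]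
  | tmul y h => rw [lift_tmul, lift_tmul, hK, hw]

end Modules

end SmashProduct

namespace TwoSidedHopfModule

open BiAction SmashProduct

/-! ### Two-sided Hopf modules and modules on the same space -/

section Correspondence

variable {k H A : Type*} [Field k] [Ring H] [Algebra k H] [Ring A] [Algebra k A]
  {Q : QuasiHopfAlgebra k H} {R : RightComoduleAlgebra Q.toQuasiBialgebra A}

theorem tensorOp_mul : tensorOp (LinearMap.mul k H) (LinearMap.mul k H) =
    LinearMap.mul k (H ⊗[k] H) := by
  ext; simp

theorem tensorOp_mul_flip : tensorOp (LinearMap.mul k H).flip (LinearMap.mul k H).flip =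
    (LinearMap.mul k (H ⊗[k] H)).flip := by
  ext; simp

/-- The two actions on a two-sided Hopf module. -/
def biAction (M : TwoSidedHopfModule.{w} R) : BiAction k H A M.carrier where
  L := M.lact
  R := M.ract
  R_one := M.ract_one
  R_mul := M.ract_mul
  comm := M.lact_ract

theorem isCoaction (M : TwoSidedHopfModule.{w} R) : M.biAction.IsCoaction Q R M.coact where
  counit := M.counit
  lact := M.coact_lact
  ract := M.coact_ract
  coassoc m := by
    have := M.quasi_coassoc m
    rw [tensorOp_mul, tensorOp_mul_flip] at this
    exact this

section OfCoaction

variable {M : Type w} [AddCommGroup M] [Module k M] {X Y : BiAction k H A M}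
  {D D' : M →ₗ[k] M ⊗[k] H}

/-- The two-sided Hopf module given by two commuting actions and a compatible coaction. -/
def ofCoaction (h : X.IsCoaction Q R D) : TwoSidedHopfModule.{w} R where
  carrier := M
  lact := X.L
  ract := X.R
  ract_one := X.R_one
  ract_mul := X.R_mul
  lact_ract := X.comm
  coact := D
  counit := h.counit
  quasi_coassoc m := by
    rw [tensorOp_mul, tensorOp_mul_flip]
    exact h.coassoc m
  coact_lact := h.lact
  coact_ract := h.ract

theorem ofCoaction_congr (h : X.IsCoaction Q R D) (h' : Y.IsCoaction Q R D') (hX : X = Y)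
    (hD : D = D') : ofCoaction h = ofCoaction h' := by
  subst hX hD
  rfl

end OfCoaction

/-- The action of `H` on the right module given by a two-sided Hopf module. -/
def repRight (M : TwoSidedHopfModule.{w} R) : H →ₗ[k] Module.End k M.carrier :=
  M.biAction.L.toLinearMap ∘ₗ Q.Sl

/-- The action of the quasi-smash product on the right module given by a two-sided Hopf module. -/
def repLeft (M : TwoSidedHopfModule.{w} R) :
    A ⊗[k] Module.Dual k H →ₗ[k] Module.End k M.carrier :=
  M.biAction.base Q (M.biAction.toTwisted Q R M.coact)

theorem isRep [FiniteDimensional k H] (M : TwoSidedHopfModule.{w} R) : IsRep R.quasiSmash M.repRight M.repLeft :=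
  M.isCoaction.toTwisted.isRep

theorem Hom.map_repRight {M N : TwoSidedHopfModule.{w} R} (f : Hom M N) (g : H) (m : M.carrier) :
    f.toLinearMap (M.repRight g m) = N.repRight g (f.toLinearMap m) := f.map_lact _ _

theorem Hom.map_repLeft {M N : TwoSidedHopfModule.{w} R} (f : Hom M N)
    (y : A ⊗[k] Module.Dual k H) (m : M.carrier) :
    f.toLinearMap (M.repLeft y m) = N.repLeft y (f.toLinearMap m) :=
  map_base (X := M.biAction) (Y := N.biAction) f.map_ract
    (rTensor_toTwisted (X := M.biAction) (Y := N.biAction) f.map_lact f.map_ract f.map_coact) y m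

variable [FiniteDimensional k H] {M : Type w} [AddCommGroup M] [Module k M]
  {K : H →ₗ[k] Module.End k M} {w : A ⊗[k] Module.Dual k H →ₗ[k] Module.End k M}

/-- The two-sided Hopf module given by a representation of the smash product. -/
def ofRep (h : IsRep R.quasiSmash K w) : TwoSidedHopfModule.{w} R :=
  ofCoaction (isCoaction_ofRep h)

theorem repRight_ofRep (h : IsRep R.quasiSmash K w) : (ofRep h).repRight = K :=
  ofRep_comp_Sl h

theorem repLeft_ofRep (h : IsRep R.quasiSmash K w) : (ofRep h).repLeft = w := by
  have e : (ofRep h).repLeft =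
      (BiAction.ofRep h).base Q ((BiAction.ofRep h).toTwisted Q R (coactionOfRep h)) := rfl
  rw [e, toTwisted_coactionOfRep, base_ofRep]

theorem isRep_ofRep_module (h : IsRep R.quasiSmash K w) : (ofRep h).isRep.module = h.module := by
  refine Module.ext ?_
  ext x m
  change SmashProduct.lift (ofRep h).repRight (ofRep h).repLeft (unop x) m =
    SmashProduct.lift K w (unop x) m
  rw [repRight_ofRep, repLeft_ofRep]
  rfl

theorem ofRep_isRep (M : TwoSidedHopfModule.{w} R) : ofRep M.isRep = M := by
  obtain ⟨hX, hD⟩ := coactionOfRep_eq M.isCoaction M.isRep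
  exact ofCoaction_congr _ M.isCoaction hX hD

end Correspondence

end TwoSidedHopfModule

namespace TwoSidedHopfModule

open SmashProduct

/-! ### The isomorphism of categories -/

section Functors

section Heq

variable {k H A : Type*} [Field k] [Ring H] [Algebra k H] [Ring A] [Algebra k A]
  {Q : QuasiBialgebra k H} {R : RightComoduleAlgebra Q A}

/-- Equality of functors demands heterogeneous equality of morphisms between equal objects; it is
enough to compare underlying functions. -/
theorem Hom.heq {M M' N N' : TwoSidedHopfModule.{w} R} (hM : M = M') (hN : N = N') (f : M ⟶ N)
    (f' : M' ⟶ N') (h : HEq (Hom.toLinearMap f).toFun (Hom.toLinearMap f').toFun) :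
    HEq f f' := by
  subst hM hN
  exact heq_of_eq (Hom.ext (LinearMap.ext (congrFun (eq_of_heq h))))

end Heq

variable {k : Type u₁} {H : Type u₂} {A : Type u₃} [Field k] [Ring H] [Algebra k H]
  [FiniteDimensional k H] [Ring A] [Algebra k A] {Q : QuasiHopfAlgebra k H}
  {R : RightComoduleAlgebra Q.toQuasiBialgebra A}

section OfModule

variable {M N : Type w} [AddCommGroup M] [AddCommGroup N]

theorem ofRep_congr [Module k M] {K K' : H →ₗ[k] Module.End k M}
    {w w' : A ⊗[k] Module.Dual k H →ₗ[k] Module.End k M} (h : IsRep R.quasiSmash K w)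
    (h' : IsRep R.quasiSmash K' w') (hK : K = K') (hw : w = w') : ofRep h = ofRep h' := by
  subst hK hw
  rfl

/-- The two-sided Hopf module given by a right module over the smash product. -/
def ofModule [Module k N] [Module (SmashProduct R.quasiSmash)ᵐᵒᵖ N]
    (hk : ∀ (c : k) (n : N), algebraMap k (SmashProduct R.quasiSmash)ᵐᵒᵖ c • n = c • n) :
    TwoSidedHopfModule.{w} R :=
  ofRep (isRep_action hk)

/-- The `k`-structure `j` induced through the smash product equals the original one only
propositionally, so it is kept as a variable until it can be substituted. -/
theorem ofModule_module (j : Module k M) [i : Module k M] (hj : j = i)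
    {K : H →ₗ[k] Module.End k M} {w : A ⊗[k] Module.Dual k H →ₗ[k] Module.End k M}
    (h : IsRep R.quasiSmash K w)
    (hk : letI := h.module; ∀ (c : k) (m : M),
      algebraMap k (SmashProduct R.quasiSmash)ᵐᵒᵖ c • m = j.toSMul.smul c m) :
    @ofModule k H A _ _ _ _ _ _ Q R M _ j h.module hk = ofRep h := by
  subst hj
  exact ofRep_congr _ _ (h.actRight_action hk) (h.actLeft_action hk)

end OfModule

theorem _root_.ModuleCat.hom_heq {S : Type*} [Ring S] {M M' N N' : ModuleCat.{w} S} (hM : M = M')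
    (hN : N = N') (f : M ⟶ N) (f' : M' ⟶ N') (h : HEq f.hom.toFun f'.hom.toFun) : HEq f f' := by
  subst hM hN
  exact heq_of_eq (ModuleCat.hom_ext (LinearMap.ext (congrFun (eq_of_heq h))))

theorem _root_.ModuleCat.of_congr {S : Type*} [Ring S] {M : Type w} [AddCommGroup M]
    (i j : Module S M) (h : i = j) :
    @ModuleCat.of S _ M _ i = @ModuleCat.of S _ M _ j := by
  subst h
  rfl

variable (R)

/-- The functor from two-sided Hopf modules to right modules over the smash product. -/
def toModuleFunctor :
    TwoSidedHopfModule.{w} R ⥤ ModuleCat.{w} (SmashProduct R.quasiSmash)ᵐᵒᵖ where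
  obj M := @ModuleCat.of _ _ M.carrier _ M.isRep.module
  map {M N} f := @ModuleCat.ofHom _ _ _ _ _ M.isRep.module _ N.isRep.module
    (letI := M.isRep.module
     letI := N.isRep.module
     { toFun := (Hom.toLinearMap f)
       map_add' := map_add (Hom.toLinearMap f)
       map_smul' := fun x m ↦
        map_lift (Hom.map_repRight f) (Hom.map_repLeft f) (unop x) m })

variable {R} in
/-- The underlying vector space of a module over the smash product. -/
abbrev scalars (N : ModuleCat.{w} (SmashProduct R.quasiSmash)ᵐᵒᵖ) : Module k N :=
  Module.compHom N (algebraMap k (SmashProduct R.quasiSmash)ᵐᵒᵖ)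

/-- The functor from right modules over the smash product to two-sided Hopf modules. -/
def ofModuleFunctor :
    ModuleCat.{w} (SmashProduct R.quasiSmash)ᵐᵒᵖ ⥤ TwoSidedHopfModule.{w} R where
  obj N := letI := scalars N; ofModule (N := N) fun _ _ ↦ rfl
  map {M N} f :=
    letI := scalars M
    letI := scalars N
    let f' : M →ₗ[k] N :=
      { toFun := f.hom, map_add' := map_add f.hom, map_smul' := fun c m ↦ map_smul f.hom _ m }
    { toLinearMap := f'
      map_lact := fun g (m : M) ↦ f.hom.map_smul _ m
      map_ract := fun a (m : M) ↦ f.hom.map_smul _ m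
      map_coact := fun m ↦ BiAction.rTensor_coactionOfRep
        (isRep_action (N := M) fun _ _ ↦ rfl) (isRep_action (N := N) fun _ _ ↦ rfl) (f := f')
        (fun g m ↦ map_smul f.hom _ m) (fun y m ↦ map_smul f.hom _ m) m }

theorem toModuleFunctor_comp_ofModuleFunctor :
    toModuleFunctor.{w} R ⋙ ofModuleFunctor R = 𝟭 _ := by
  have e (M : TwoSidedHopfModule.{w} R) :
      (toModuleFunctor R ⋙ ofModuleFunctor R).obj M = M :=
    (ofModule_module _ M.isRep.compHom_module M.isRep _).trans M.ofRep_isRep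
  -- Both functors keep the carrier and the underlying function definitionally, so nothing remains
  -- to be compared on morphisms.
  exact Functor.hext e fun M N f ↦ Hom.heq (e M) (e N) _ _ HEq.rfl

theorem ofModuleFunctor_comp_toModuleFunctor :
    ofModuleFunctor.{w} R ⋙ toModuleFunctor R = 𝟭 _ := by
  have e (N : ModuleCat.{w} (SmashProduct R.quasiSmash)ᵐᵒᵖ) :
      (ofModuleFunctor R ⋙ toModuleFunctor R).obj N = N := by
    let := scalars N
    exact ModuleCat.of_congr (M := N) _ _ ((isRep_ofRep_module _).trans (isRep_action_module _))
  exact Functor.hext e fun M N f ↦ ModuleCat.hom_heq (e M) (e N) _ _ HEq.rfl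

theorem toModuleFunctor_comp_restrictScalars :
    toModuleFunctor.{w} R ⋙
        ModuleCat.restrictScalars (algebraMap k (SmashProduct R.quasiSmash)ᵐᵒᵖ) =
      forgetToModuleCat R := by
  have e (M : TwoSidedHopfModule.{w} R) : (toModuleFunctor R ⋙
      ModuleCat.restrictScalars (algebraMap k (SmashProduct R.quasiSmash)ᵐᵒᵖ)).obj M =
        (forgetToModuleCat R).obj M :=
    ModuleCat.of_congr (M := M.carrier) _ _ M.isRep.compHom_module
  exact Functor.hext e fun M N f ↦ ModuleCat.hom_heq (e M) (e N) _ _ HEq.rfl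

end Functors

end TwoSidedHopfModule

end

end QuasiHopf

theorem corollary3p6 {k : Type u₁} {H : Type u₂} {A : Type u₃} [Field k] [Ring H] [Algebra k H]
    [FiniteDimensional k H] [Ring A] [Algebra k A] (Q : QuasiHopf.QuasiHopfAlgebra k H)
    (R : QuasiHopf.RightComoduleAlgebra Q.toQuasiBialgebra A) :
    ∃ (F : QuasiHopf.TwoSidedHopfModule.{w} R ⥤
          ModuleCat.{w} (QuasiHopf.SmashProduct R.quasiSmash)ᵐᵒᵖ)
      (G : ModuleCat.{w} (QuasiHopf.SmashProduct R.quasiSmash)ᵐᵒᵖ ⥤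
          QuasiHopf.TwoSidedHopfModule.{w} R),
      F ⋙ G = 𝟭 _ ∧ G ⋙ F = 𝟭 _ ∧
        F ⋙ ModuleCat.restrictScalars (algebraMap k (QuasiHopf.SmashProduct R.quasiSmash)ᵐᵒᵖ) =
          QuasiHopf.TwoSidedHopfModule.forgetToModuleCat R :=
  ⟨QuasiHopf.TwoSidedHopfModule.toModuleFunctor R, QuasiHopf.TwoSidedHopfModule.ofModuleFunctor R,
    QuasiHopf.TwoSidedHopfModule.toModuleFunctor_comp_ofModuleFunctor R,
    QuasiHopf.TwoSidedHopfModule.ofModuleFunctor_comp_toModuleFunctor R,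
    QuasiHopf.TwoSidedHopfModule.toModuleFunctor_comp_restrictScalars R⟩
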